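/- Let $F$ be a finite extension of $\mathbb Q_p$ with ring of integers $\mathcal O$, uniformizer $\pi$ and residue field $\mathbb F_q$, and let $n\ge 1$. Let $\mathbb H_0$ be a one-dimensional formal $\mathcal O$-module of height $n$ over $\mathbb F_q$. Let $\mathfrak X_0\simeq \mathrm{Spf}\,\mathcal O[[x_1,\dots,x_{n-1}]]$ be its universal deformation space (the Lubin–Tate space) and let $F^{univ}$ be a universal formal $\mathcal O$-module law over $\mathcal O[[x_1,\dots,x_{n-1}]]$, the coordinates $x_i$ and the law being chosen so that $$[\pi]_{F^{univ}}(T)=\pi u_0T+x_1u_1T^q+\dots+x_{n-1}u_{n-1}T^{q^{n-1}}+u_nT^{q^n}$$ with units $u_0,\dots,u_n$ of $\mathcal O[[x_1,\dots,x_{n-1}]][[T]]$. Let $L|F$ be an extension complete for a valuation $v$ with values in $\mathbb R\cup\{+\infty\}$ that extends the valuation of $F$ and satisfies $v(\pi)=1$, and let $C$ be a complete algebraically closed valued extension of $L$. For $\underline x\in\mathfrak X_0(\mathcal O_L)$ let $H_{\underline x}$ be the formal $\mathcal O$-module over $\mathcal O_L$ obtained by specializing $F^{univ}$ at $\underline x$.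 The valuation of a point of $H_{\underline x}$ with values in $\mathcal O_C$ is the valuation of its coordinate $T$. Put $$\mathcal D=\{\underline x : v(x_i)\ge 1-\tfrac in \text{ for } 1\le i\le n-1\},\qquad \partial_i\mathcal D=\{\underline x\in\mathcal D : v(x_i)=1-\tfrac in\}\quad(1\le i\le n-1).$$ **Proposition 3.5 (Faltings).** Let $\underline x\in\mathcal D$, let $\underline x'\in\mathfrak X_0(\mathcal O_L)$, and let $f:H_{\underline x}\to H_{\underline x'}$ be an isogeny of formal $\mathcal O$-modules over $\mathcal O_L$ that is not an isomorphism and does not factor through multiplication by $\pi$. Then $\underline x'\in\mathcal D$ if and only if there is an $i\in\{1,\dots,n-1\}$ such that $\underline x\in\partial_i\mathcal D$ and $\ker f$ is the subgroup of rank $i$ of $H_{\underline x}[\pi]$ made of the $q^i$ points of largest valuation; that is, $(\ker f)(\mathcal O_C)\subseteq H_{\underline x}[\pi](\mathcal O_C)$ has $q^i$ elements, and each of them has strictly larger valuation than every other element of $H_{\underline x}[\pi](\mathcal O_C)$. Moreover, for every such $i$, one has $\underline x'\in\partial_{n-i}\mathcal D$. -/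

import Mathlib

universe u

/-! ### Formal `O`-modules of dimension one and their homomorphisms -/

section FormalModules

open PowerSeries

/-- Homomorphisms of one-dimensional formal group laws: power series `f` without constant term such
that `f (F (X, Y)) = F' (f X, f Y)`. -/
structure FormalGroup.IsHom {R : Type*} [CommRing R] (F F' : FormalGroup R)
    (f : PowerSeries R) : Prop where
  constantCoeff_eq_zero : constantCoeff f = 0
  map_add : PowerSeries.subst F.toPowerSeries f =
    MvPowerSeries.subst
      (fun i : Fin 2 => PowerSeries.subst (MvPowerSeries.X i : MvPowerSeries (Fin 2) R) f)
      F'.toPowerSeries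

/-- A one-dimensional formal `O`-module over an `O`-algebra `R`: a commutative formal group law with
a ring homomorphism `a ↦ [a]` from `O` to its endomorphism ring, such that
`[a] (T) = a T + higher order terms`. -/
structure FormalModule (O R : Type*) [CommRing O] [CommRing R] [Algebra O R] where
  law : FormalGroup R
  isComm : law.IsComm
  /-- The power series `[a]`. -/
  act : O → PowerSeries R
  act_isHom : ∀ a, law.IsHom law (act a)
  act_one : act 1 = X
  act_add : ∀ a b, act (a + b) = MvPowerSeries.subst ![act a, act b] law.toPowerSeries
  act_mul : ∀ a b, act (a * b) = PowerSeries.subst (act b) (act a)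
  coeff_one_act : ∀ a, coeff 1 (act a) = algebraMap O R a

namespace FormalModule

variable {O R S : Type*} [CommRing O] [CommRing R] [CommRing S] [Algebra O R] [Algebra O S]

/-- Base change of a formal `O`-module, by applying a homomorphism of `O`-algebras to all
coefficients. -/
noncomputable def map (G : FormalModule O R) (φ : R →ₐ[O] S) : FormalModule O S where
  law := G.law.map (φ : R →+* S)
  isComm := ⟨by
    have h := congrArg (MvPowerSeries.map (φ : R →+* S)) G.isComm.comm
    rw [MvPowerSeries.map_subst MvPowerSeries.HasSubst.X_X] at h
    refine h.trans ?_
    congr 1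
    funext i
    fin_cases i <;> simp⟩
  act a := PowerSeries.map (φ : R →+* S) (G.act a)
  act_isHom a := by
    obtain ⟨h0, h1⟩ := G.act_isHom a
    refine ⟨by
      rw [← coeff_zero_eq_constantCoeff_apply, coeff_map, coeff_zero_eq_constantCoeff_apply, h0,
        map_zero], ?_⟩
    have h := congrArg (MvPowerSeries.map (φ : R →+* S)) h1
    have hF : PowerSeries.HasSubst G.law.toPowerSeries :=
      HasSubst.of_constantCoeff_zero G.law.zero_constantCoeff
    have hX : ∀ i : Fin 2, HasSubst (MvPowerSeries.X i : MvPowerSeries (Fin 2) R) :=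
      fun i => HasSubst.X i
    have hs : MvPowerSeries.HasSubst (fun i : Fin 2 =>
        PowerSeries.subst (MvPowerSeries.X i : MvPowerSeries (Fin 2) R) (G.act a)) :=
      MvPowerSeries.hasSubst_of_constantCoeff_zero fun i =>
        PowerSeries.constantCoeff_subst_eq_zero (by simp) _ h0
    rw [PowerSeries.map_subst hF, MvPowerSeries.map_subst hs] at h
    refine h.trans ?_
    congr 1
    funext i
    rw [PowerSeries.map_subst (hX i), MvPowerSeries.map_X]
  act_one := by simp [G.act_one]
  act_add a b := by
    have hs : MvPowerSeries.HasSubst ![G.act a, G.act b] :=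
      MvPowerSeries.hasSubst_of_constantCoeff_zero fun i => by
        fin_cases i
        · exact (G.act_isHom a).constantCoeff_eq_zero
        · exact (G.act_isHom b).constantCoeff_eq_zero
    have h := congrArg (MvPowerSeries.map (φ : R →+* S)) (G.act_add a b)
    rw [MvPowerSeries.map_subst hs] at h
    refine h.trans ?_
    congr 1
    funext i
    fin_cases i <;> rfl
  act_mul a b := by
    rw [G.act_mul]
    exact PowerSeries.map_subst
      (HasSubst.of_constantCoeff_zero (G.act_isHom b).constantCoeff_eq_zero) _
  coeff_one_act a := by
    simp [G.coeff_one_act]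

/-- Homomorphisms of formal `O`-modules. -/
structure IsHom (G H : FormalModule O R) (f : PowerSeries R) : Prop where
  isHom_law : G.law.IsHom H.law f
  map_act : ∀ a : O, PowerSeries.subst (G.act a) f = PowerSeries.subst f (H.act a)

/-- Isomorphisms of formal `O`-modules. -/
def IsIso (G H : FormalModule O R) (f : PowerSeries R) : Prop :=
  G.IsHom H f ∧ ∃ g : PowerSeries R, H.IsHom G g ∧
    PowerSeries.subst f g = X ∧ PowerSeries.subst g f = X

/-- Isogenies of formal `O`-modules (over a complete local ring): homomorphisms `f` with finite flat
kernel `Spec R⟦T⟧/(f)`, that is, homomorphisms that do not vanish modulo the maximal ideal. -/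
def IsIsogeny (G H : FormalModule O R) (f : PowerSeries R) : Prop :=
  G.IsHom H f ∧ ∃ k : ℕ, IsUnit (coeff k f)

/-- `f : G → H` factors through multiplication by `a`, that is, `f = g ∘ [a]` for some
homomorphism `g : G → H`. -/
def FactorsThroughMul (G H : FormalModule O R) (f : PowerSeries R) (a : O) : Prop :=
  ∃ g : PowerSeries R, G.IsHom H g ∧ f = PowerSeries.subst (G.act a) g

end FormalModule

end FormalModules

/-! ### Universal deformations -/

section Deformations

open IsLocalRing

variable {O : Type u} [CommRing O] [IsLocalRing O]

/-- A formal `O`-module `Φ` over the residue field of `O` has height `n` if `[ϖ]` is a power series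
in `T ^ (q ^ n)` with nonzero leading term, where `ϖ` is a uniformizer and `q` is the cardinality of
the residue field. -/
def FormalModule.HasHeight (Φ : FormalModule O (ResidueField O)) (ϖ : O) (n : ℕ) : Prop :=
  (Φ.act ϖ).order = (Nat.card (ResidueField O) ^ n : ℕ)

/-- The augmentation `O⟦x⟧ → O → k` onto the residue field `k` of `O`. -/
noncomputable def augmentation (σ : Type*) (O : Type*) [CommRing O] [IsLocalRing O] :
    MvPowerSeries σ O →ₐ[O] ResidueField O where
  toRingHom := (residue O).comp MvPowerSeries.constantCoeff
  commutes' r := by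
    simp [MvPowerSeries.algebraMap_apply, ResidueField.algebraMap_eq]

/-- Let `Φ` be a formal `O`-module over the residue field `k` of `O`, and `𝓕` a formal `O`-module
over `O⟦x⟧`. This says that `𝓕` is a universal deformation of `Φ`, i.e. `𝓕` reduces to `Φ` and
`Spf O⟦x⟧` represents the functor that sends a complete noetherian local `O`-algebra `R`
with residue field `k` (given by a homomorphism `ε : R → k` of `O`-algebras, which is unique)
to the set of deformations of `Φ` to `R` up to `⋆`-isomorphisms, that is, isomorphisms that reduce
to the identity of `Φ`. (A homomorphism `φ : O⟦x⟧ → R` of `O`-algebras is automatically local.) -/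
def IsUniversalDeformation {σ : Type} (Φ : FormalModule O (ResidueField O))
    (𝓕 : FormalModule O (MvPowerSeries σ O)) : Prop :=
  𝓕.map (augmentation σ O) = Φ ∧
    ∀ (R : Type u) [CommRing R] [IsLocalRing R] [IsNoetherianRing R] [Algebra O R]
      [IsAdicComplete (maximalIdeal R) R] (ε : R →ₐ[O] ResidueField O) (G : FormalModule O R),
      G.map ε = Φ →
      ∃! φ : MvPowerSeries σ O →ₐ[O] R, ∃ f : PowerSeries R,
        (𝓕.map φ).IsIso G f ∧ PowerSeries.map (ε : R →+* ResidueField O) f = PowerSeries.X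

/-- The index set `{1, …, n - 1}` of the coordinates on the Lubin–Tate space of height `n`. -/
abbrev LTIndex (n : ℕ) : Type := {i : ℕ // 1 ≤ i ∧ i < n}

/-- The elements `x_0 = ϖ, x_1, …, x_{n-1}, x_n = 1` of `O⟦x_1, …, x_{n-1}⟧`, where
`x_1, …, x_{n-1}` are the variables. -/
noncomputable def ltCoord (n : ℕ) (ϖ : O) (i : ℕ) : MvPowerSeries (LTIndex n) O :=
  if h : 1 ≤ i ∧ i < n then MvPowerSeries.X ⟨i, h⟩
  else if i = 0 then MvPowerSeries.C ϖ else 1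

/-- The formal `O`-module `𝓕` over `O⟦x_1, …, x_{n-1}⟧` satisfies
`[ϖ] = ϖ u_0 T + x_1 u_1 T ^ q + ⋯ + x_{n-1} u_{n-1} T ^ (q ^ (n-1)) + u_n T ^ (q ^ n)`
for some units `u_0, …, u_n` of `O⟦x_1, …, x_{n-1}⟧⟦T⟧`. -/
def IsInStandardCoordinates {n : ℕ} (𝓕 : FormalModule O (MvPowerSeries (LTIndex n) O))
    (ϖ : O) : Prop :=
  ∃ u : ℕ → PowerSeries (MvPowerSeries (LTIndex n) O), (∀ i, IsUnit (u i)) ∧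
    𝓕.act ϖ = ∑ i ∈ Finset.range (n + 1),
      PowerSeries.C (ltCoord n ϖ i) * u i * PowerSeries.X ^ (Nat.card (ResidueField O) ^ i)

end Deformations

/-! ### Valued fields, points of the Lubin–Tate space and the fundamental domain -/

section ValuedFields

/-- The valuation ring of a nonarchimedean normed field. -/
noncomputable abbrev ValRing (K : Type*) [NormedField K] [IsUltrametricDist K] : ValuationSubring K :=
  (NormedField.valuation (K := K)).valuationSubring

/-- If `L` is a normed extension of `F`, then the valuation of `L` extends that of `F`. In particular
the valuation ring of `L` is an algebra over that of `F`. -/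
instance instHasExtensionNormedField (F L : Type*) [NormedField F] [IsUltrametricDist F]
    [NormedField L] [IsUltrametricDist L] [NormedAlgebra F L] :
    (NormedField.valuation (K := F)).HasExtension (NormedField.valuation (K := L)) where
  val_isEquiv_comap := by
    intro x y
    simp [NormedField.valuation_apply]

/-- The additive valuation on a normed field, normalized by `v(ϖ) = 1`; here `ϖ` is an element with
`0 < ‖ϖ‖ < 1` of a subfield. -/
noncomputable def normVal {F K : Type*} [NormedField F] [NormedField K] (ϖ : F) (z : K) :
    WithTop ℝ :=
  open Classical in if z = 0 then ⊤ else ((Real.log ‖z‖ / Real.log ‖ϖ‖ : ℝ) : WithTop ℝ)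

section Points

/-- The set of points of the Lubin–Tate space `Spf 𝓞_F⟦x_1, …, x_{n-1}⟧` with values in `𝓞_L`: local
homomorphisms of `𝓞_F`-algebras `𝓞_F⟦x_1, …, x_{n-1}⟧ → 𝓞_L`. When `L` is complete, such a
homomorphism is the evaluation at a tuple `(x_1, …, x_{n-1})` in the maximal ideal of `𝓞_L`. -/
structure LTPoint (L F : Type*) [NormedField F] [IsUltrametricDist F] [NormedField L]
    [IsUltrametricDist L] [NormedAlgebra F L] (n : ℕ) where
  toAlgHom : MvPowerSeries (LTIndex n) (ValRing F) →ₐ[ValRing F] ValRing L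
  isLocalHom : IsLocalHom toAlgHom.toRingHom

variable {F L : Type*} [NormedField F] [IsUltrametricDist F] [NormedField L]
  [IsUltrametricDist L] [NormedAlgebra F L]

/-- The `i`-th coordinate `x_i` of a point of the Lubin–Tate space, an element of `L`. -/
noncomputable def LTPoint.coord {n : ℕ} (x : LTPoint L F n) (i : LTIndex n) : L :=
  (x.toAlgHom (MvPowerSeries.X i) : L)

/-- The specialization at the point `x` of a formal `𝓞_F`-module `𝓕` over the Lubin–Tate space. -/
noncomputable def LTPoint.fiber {n : ℕ} (x : LTPoint L F n)
    (𝓕 : FormalModule (ValRing F) (MvPowerSeries (LTIndex n) (ValRing F))) :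
    FormalModule (ValRing F) (ValRing L) :=
  𝓕.map x.toAlgHom

variable (L) in
/-- The fundamental domain `𝓓`, defined by `v(x_i) ≥ 1 - i / n` for `1 ≤ i ≤ n - 1`. -/
def fundamentalDomain (ϖ : F) (n : ℕ) : Set (LTPoint L F n) :=
  {x | ∀ i : LTIndex n, ((1 - (i : ℕ) / (n : ℝ) : ℝ) : WithTop ℝ) ≤ normVal ϖ (x.coord i)}

variable (L) in
/-- The part `∂_i 𝓓` of the fundamental domain `𝓓` where `v(x_i) = 1 - i / n`. -/
def fundamentalDomainBoundary (ϖ : F) (n : ℕ) (i : LTIndex n) : Set (LTPoint L F n) :=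
  {x | x ∈ fundamentalDomain L ϖ n ∧
    normVal ϖ (x.coord i) = ((1 - (i : ℕ) / (n : ℝ) : ℝ) : WithTop ℝ)}

end Points

section Zeros

variable {L : Type*} (C : Type*) [NormedField L] [IsUltrametricDist L] [NormedField C]
  [NormedAlgebra L C]

/-- The value at `z` of a power series with coefficients in `𝓞_L`, where `z` is an element of norm
`< 1` of a complete extension `C` of `L`. -/
noncomputable def evalSeries {C : Type*} [NormedField C] [NormedAlgebra L C]
    (f : PowerSeries (ValRing L)) (z : C) : C :=
  ∑' k : ℕ, algebraMap L C ((PowerSeries.coeff k f : ValRing L) : L) * z ^ k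

/-- The set of `C`-valued points of the kernel of a homomorphism `f` of formal groups over `𝓞_L`:
the elements of the maximal ideal of `𝓞_C` at which `f` vanishes. -/
def kernelPoints (f : PowerSeries (ValRing L)) : Set C :=
  {z | ‖z‖ < 1 ∧ evalSeries f z = 0}

/-- `S` consists of the `m` elements of `T` of largest valuation: `S ⊆ T` has `m` elements, and each
of them has a larger valuation (for the valuation normalized by `ϖ`) than each element of
`T \ S`. There is at most one such `S`. -/
def IsLargestValuationSubset {F C : Type*} [NormedField F] [NormedField C] (ϖ : F) (m : ℕ)
    (S T : Set C) : Prop :=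
  S ⊆ T ∧ S.encard = m ∧ ∀ a ∈ S, ∀ b ∈ T \ S, normVal ϖ b < normVal ϖ a

end Zeros

end ValuedFields

/-!
The argument translates the fundamental domain into semistability. For a finite `O`-submodule `K` of
the `C`-points of a formal module `G`, let `deg K` be the sum of the valuations of its nonzero
points, normalized by `v (ϖ) = 1`, and call `deg K / log_q |K|` its slope. A power series that
defines an isogeny `f : G → H` is, up to a unit, the product of `T - k` over the points `k` of
its kernel (Weierstrass preparation; the zeros are simple because `f' (0) ≠ 0`), so the valuation of
a point of `H` is the sum of the valuations of its preimages (`Point.norm_eq_prod_fiber`). Hence the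
degree is additive, `deg M = deg (ker f) + deg (f M)` for `M` containing `ker f`
(`IsStandard.deg_eq_add`), and the `ϖ ^ e`-torsion has slope `1 / n`
(`IsStandard.card_deg_torsion_pow`).

The Newton polygon of `[ϖ]` at `x` lies above the one with vertices `(q ^ i, 1 - i / n)`, i.e.
`x ∈ 𝓓`, if and only if all submodules of the `ϖ`-torsion have slope at most `1 / n`. On `𝓓`,
a submodule of order `q ^ i` has slope `1 / n` if and only if `v (x_i) = 1 - i / n` and it is made
of the `q ^ i` points of largest valuation. The Newton polygon is tested by evaluating `[ϖ]` at points
`y` for which a single term dominates: the valuation of `[ϖ] (y)` is read off from the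
coefficients (`IsStandard.exists_norm_smul_sub_lt`) as well as from the torsion points
(`IsStandard.exists_norm_smul_eq`); see `IsStandard.deg_le_of_card_eq_pow`,
`IsStandard.exists_submodule_of_norm_eq` and `IsStandard.norm_le_of_deg_le`.

On `𝓓` the slope inequality extends to all finite submodules, and can only be an equality for
submodules that contain, or are contained in, the `ϖ`-torsion (`slope_le`): nonzero points of
valuation at most `1 / (n (q - 1))` have all their divisions by `ϖ` in the range where the last term
of `[ϖ]` dominates, so that division by `ϖ` divides the valuation by `q ^ n`
(`IsStandard.nu_smul`), and one can use induction on `K` via `K ∩ G[ϖ]` and `ϖ K`.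

Now let `K` be the kernel of an isogeny `f : G → H` with `G` in `𝓓`. By additivity, the slope
inequalities for `G`, for `H` and the equality for `G[ϖ ^ e] ⊇ K` show that if `H` lies in `𝓓`, then
the slope of `K` is `1 / n`. As `f` is not an isomorphism and does not factor through `ϖ`, the
submodule `K` is nonzero and does not contain `G[ϖ]` (`isIso_of_ker_eq_bot`, `exists_factor`), so
that `K` is a proper submodule of `G[ϖ]`. Conversely, if `K` has slope `1 / n`, then the slope
inequality for `f ⁻¹ (W)` gives the one for `W`, and `f (G[ϖ])` is a submodule of order
`q ^ (n - i)` and slope `1 / n`, which gives `v (x'_{n-i}) = i / n`.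
-/

set_option linter.unusedSectionVars false

namespace LubinTate

open Filter Topology

/-! ### Evaluation of power series over valuation rings -/

section ValRing

variable {C : Type*} [NormedField C] [IsUltrametricDist C]

lemma norm_valRing_le_one (z : ValRing C) : ‖z‖ ≤ 1 := by
  have := z.2
  rw [Valuation.mem_valuationSubring_iff] at this
  exact_mod_cast this

lemma mem_valRing_iff {z : C} : z ∈ ValRing C ↔ ‖z‖ ≤ 1 := by
  rw [Valuation.mem_valuationSubring_iff]
  exact Iff.rfl

lemma norm_coe_valRing (z : ValRing C) : ‖(z : C)‖ = ‖z‖ := rfl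

lemma isUnit_valRing_iff {z : ValRing C} : IsUnit z ↔ ‖z‖ = 1 := by
  constructor
  · rintro ⟨u, rfl⟩
    have h := congrArg (fun z : ValRing C => ‖(z : C)‖) u.mul_inv
    simp only [MulMemClass.coe_mul, norm_mul, OneMemClass.coe_one, norm_one] at h
    have h1 := norm_valRing_le_one (u : ValRing C)
    have h2 := norm_valRing_le_one (↑u⁻¹ : ValRing C)
    rw [← norm_coe_valRing] at h1 h2 ⊢
    nlinarith [norm_nonneg ((u : ValRing C) : C),
      norm_nonneg (((u⁻¹ : (ValRing C)ˣ) : ValRing C) : C)]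
  · intro h
    rw [← norm_coe_valRing] at h
    have h0 : (z : C) ≠ 0 := by
      intro h0
      simp [h0] at h
    refine IsUnit.of_mul_eq_one ⟨(z : C)⁻¹, mem_valRing_iff.2 (by simp [h])⟩ ?_
    ext
    simp [h0]

lemma mem_maximalIdeal_valRing_iff {z : ValRing C} :
    z ∈ IsLocalRing.maximalIdeal (ValRing C) ↔ ‖z‖ < 1 := by
  rw [IsLocalRing.mem_maximalIdeal, mem_nonunits_iff, isUnit_valRing_iff]
  exact ⟨fun h => lt_of_le_of_ne (norm_valRing_le_one z) h, fun h => h.ne⟩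

lemma dvd_valRing_iff {a b : ValRing C} : a ∣ b ↔ ‖b‖ ≤ ‖a‖ := by
  constructor
  · rintro ⟨c, rfl⟩
    rw [norm_mul]
    exact mul_le_of_le_one_right (norm_nonneg _) (norm_valRing_le_one c)
  · intro h
    by_cases ha : a = 0
    · subst ha
      have : b = 0 := by simpa using h
      simp [this]
    have ha' : (a : C) ≠ 0 := by simpa using ha
    refine ⟨⟨(b : C) / a, mem_valRing_iff.2 ?_⟩, ?_⟩
    · rw [norm_div]
      exact div_le_one_of_le₀ h (norm_nonneg _)
    · ext
      simp [mul_div_cancel₀ _ ha']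

/-- The closed ball of radius `B` in a valuation ring, as an ideal. -/
def ballIdeal (C : Type*) [NormedField C] [IsUltrametricDist C] {B : ℝ} (hB : 0 ≤ B) :
    Ideal (ValRing C) where
  carrier := {x | ‖x‖ ≤ B}
  add_mem' {a b} ha hb := (IsUltrametricDist.norm_add_le_max a b).trans (max_le ha hb)
  zero_mem' := by simpa using hB
  smul_mem' c x hx := by
    rw [Set.mem_ofPred_eq, smul_eq_mul, norm_mul]
    exact (mul_le_of_le_one_left (norm_nonneg _) (norm_valRing_le_one c)).trans hx

lemma mem_ballIdeal {B : ℝ} (hB : 0 ≤ B) {x : ValRing C} : x ∈ ballIdeal C hB ↔ ‖x‖ ≤ B := Iff.rfl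

/-- The topology of a valuation ring has a basis of neighbourhoods of `0` made of ideals, namely
the closed balls. -/
instance : IsLinearTopology (ValRing C) (ValRing C) := by
  refine IsLinearTopology.mk_of_hasBasis' (S := Ideal (ValRing C)) (ι := ℝ) (p := fun ε => 0 < ε)
    (s := fun ε => if h : 0 ≤ ε then ballIdeal C h else ⊥) _ ?_ ?_
  · refine Metric.nhds_basis_closedBall.congr (fun _ => Iff.rfl) fun ε hε => ?_
    rw [dif_pos hε.le]
    ext x
    rw [mem_closedBall_zero_iff]
    rfl
  · exact fun s r m hm => s.smul_mem r hm

instance [CompleteSpace C] : CompleteSpace (ValRing C) := by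
  have h : ((ValRing C : ValuationSubring C) : Set C) = Metric.closedBall 0 1 := by
    ext z
    rw [mem_closedBall_zero_iff]
    exact mem_valRing_iff
  have h' : IsClosed ((ValRing C : ValuationSubring C) : Set C) := by
    rw [h]
    exact Metric.isClosed_closedBall
  exact h'.isComplete.completeSpace_coe

end ValRing

section Evaluation

variable {C : Type*} [NormedField C] [IsUltrametricDist C] [CompleteSpace C]
variable {R : Type*} [CommRing R] [Algebra R (ValRing C)] {σ τ : Type*}

/-- The value of a power series with coefficients in an algebra `R` over which the valuation ring
of `C` is an algebra. The ring `R` carries the discrete topology, so that the values are the sums of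
the corresponding series at all points with coordinates of norm `< 1`. -/
noncomputable def evalAt (a : σ → ValRing C) (f : MvPowerSeries σ R) : ValRing C :=
  letI : UniformSpace R := ⊥
  MvPowerSeries.eval₂ (algebraMap R (ValRing C)) a f

lemma hasEval_of_norm_lt_one [Finite σ] {a : σ → ValRing C} (ha : ∀ s, ‖a s‖ < 1) :
    MvPowerSeries.HasEval a where
  hpow s := tendsto_pow_atTop_nhds_zero_of_norm_lt_one (ha s)
  tendsto_zero := by simp [Filter.cofinite_eq_bot]

variable [Finite σ] [Finite τ] {a : σ → ValRing C}

variable (R) in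
/-- Evaluation of power series at a point with coordinates of norm `< 1`, as a ring
homomorphism. -/
noncomputable def evalHom (ha : ∀ s, ‖a s‖ < 1) : MvPowerSeries σ R →+* ValRing C :=
  letI : UniformSpace R := ⊥
  haveI : DiscreteUniformity R := ⟨rfl⟩
  MvPowerSeries.eval₂Hom (φ := algebraMap R (ValRing C)) continuous_of_discreteTopology
    (hasEval_of_norm_lt_one ha)

lemma evalHom_apply (ha : ∀ s, ‖a s‖ < 1) (f : MvPowerSeries σ R) :
    evalHom R ha f = evalAt a f := by
  let : UniformSpace R := ⊥
  have : DiscreteUniformity R := ⟨rfl⟩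
  exact congrFun (MvPowerSeries.coe_eval₂Hom (φ := algebraMap R (ValRing C))
    continuous_of_discreteTopology (hasEval_of_norm_lt_one ha)) f

lemma evalAt_X (s : σ) : evalAt a (MvPowerSeries.X s : MvPowerSeries σ R) = a s := by
  let : UniformSpace R := ⊥
  exact MvPowerSeries.eval₂_X _ _ _

lemma evalAt_C (r : R) : evalAt a (MvPowerSeries.C r : MvPowerSeries σ R) = algebraMap R _ r := by
  let : UniformSpace R := ⊥
  exact MvPowerSeries.eval₂_C _ _ _

lemma hasSum_evalAt (ha : ∀ s, ‖a s‖ < 1) (f : MvPowerSeries σ R) :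
    HasSum (fun d : σ →₀ ℕ => algebraMap R (ValRing C) (MvPowerSeries.coeff d f) *
      d.prod fun s e => a s ^ e) (evalAt a f) := by
  let : UniformSpace R := ⊥
  have : DiscreteUniformity R := ⟨rfl⟩
  exact MvPowerSeries.hasSum_eval₂ continuous_of_discreteTopology (hasEval_of_norm_lt_one ha) f

lemma evalAt_subst {b : τ → ValRing C} {g : σ → MvPowerSeries τ R} (hg : MvPowerSeries.HasSubst g)
    (hb : ∀ s, ‖b s‖ < 1) (f : MvPowerSeries σ R) :
    evalAt b (MvPowerSeries.subst g f) = evalAt (fun s => evalAt b (g s)) f := by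
  let : UniformSpace R := ⊥
  have : DiscreteUniformity R := ⟨rfl⟩
  exact MvPowerSeries.eval₂_subst hg (hasEval_of_norm_lt_one hb) f

/-- Closed balls are closed under infinite sums. -/
lemma norm_le_of_hasSum {ι : Type*} {f : ι → ValRing C} {s : ValRing C} (h : HasSum f s) {B : ℝ}
    (hB : 0 ≤ B) (hf : ∀ i, ‖f i‖ ≤ B) : ‖s‖ ≤ B := by
  refine le_of_tendsto h.norm (Eventually.of_forall fun t => ?_)
  exact IsUltrametricDist.norm_sum_le_of_forall_le_of_nonneg hB fun i _ => hf i

lemma norm_evalAt_le (ha : ∀ s, ‖a s‖ < 1) {f : MvPowerSeries σ R}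
    (hf : MvPowerSeries.constantCoeff f = 0) {B : ℝ} (hB : 0 ≤ B) (hab : ∀ s, ‖a s‖ ≤ B) :
    ‖evalAt a f‖ ≤ B := by
  classical
  refine norm_le_of_hasSum (hasSum_evalAt ha f) hB fun d => ?_
  by_cases hd : d = 0
  · subst hd
    rw [MvPowerSeries.coeff_zero_eq_constantCoeff, hf]
    simpa using hB
  · obtain ⟨s, hs⟩ := Finsupp.ne_iff.1 hd
    refine (ballIdeal C hB).mul_mem_left _ ?_
    rw [Finsupp.prod, ← Finset.mul_prod_erase _ _ (Finsupp.mem_support_iff.2 hs)]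
    exact Ideal.mul_mem_right _ _ (Ideal.pow_mem_of_mem _ ((mem_ballIdeal hB).2 (hab s)) _
      (Nat.pos_of_ne_zero hs))

lemma norm_evalAt_lt_one (ha : ∀ s, ‖a s‖ < 1) {f : MvPowerSeries σ R}
    (hf : MvPowerSeries.constantCoeff f = 0) : ‖evalAt a f‖ < 1 := by
  obtain ⟨B, hB0, hB1, hB⟩ : ∃ B : ℝ, 0 ≤ B ∧ B < 1 ∧ ∀ s, ‖a s‖ ≤ B := by
    rcases isEmpty_or_nonempty σ with h | h
    · exact ⟨0, le_rfl, zero_lt_one, fun s => h.elim s⟩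
    · obtain ⟨s, hs⟩ := Finite.exists_max fun s => ‖a s‖
      exact ⟨‖a s‖, norm_nonneg _, ha s, hs⟩
  exact (norm_evalAt_le ha hf hB0 hB).trans_lt hB1

/-- Power series with coefficients in a valuation ring are `1`-Lipschitz. -/
lemma norm_evalAt_sub_le {b : σ → ValRing C} (ha : ∀ s, ‖a s‖ < 1) (hb : ∀ s, ‖b s‖ < 1)
    {B : ℝ} (hB : 0 ≤ B) (hab : ∀ s, ‖a s - b s‖ ≤ B) (f : MvPowerSeries σ R) :
    ‖evalAt a f - evalAt b f‖ ≤ B := by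
  refine norm_le_of_hasSum ((hasSum_evalAt ha f).sub (hasSum_evalAt hb f)) hB fun d => ?_
  rw [← mul_sub]
  refine (ballIdeal C hB).mul_mem_left _ ?_
  rw [← Ideal.Quotient.eq, map_finsuppProd, map_finsuppProd]
  refine Finsupp.prod_congr fun s _ => ?_
  rw [map_pow, map_pow, Ideal.Quotient.eq.2 ((mem_ballIdeal hB).2 (hab s))]

/-- Evaluation is compatible with a change of the ring of coefficients. -/
lemma evalAt_map {R' : Type*} [CommRing R'] [Algebra R' (ValRing C)] (φ : R →+* R')
    (hφ : ∀ r, algebraMap R' (ValRing C) (φ r) = algebraMap R (ValRing C) r)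
    (ha : ∀ s, ‖a s‖ < 1) (f : MvPowerSeries σ R) :
    evalAt a (MvPowerSeries.map φ f) = evalAt a f := by
  refine (hasSum_evalAt ha _).unique ?_
  simp_rw [MvPowerSeries.coeff_map, hφ]
  exact hasSum_evalAt ha f

end Evaluation

section OneVariable

variable {C : Type*} [NormedField C] [IsUltrametricDist C] [CompleteSpace C]
variable {R : Type*} [CommRing R] [Algebra R (ValRing C)] {z w : ValRing C}

/-- The value at `z` of a power series in one variable. -/
noncomputable abbrev ev (z : ValRing C) (f : PowerSeries R) : ValRing C :=
  evalAt (fun _ : Unit => z) f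

lemma ev_add (hz : ‖z‖ < 1) (f g : PowerSeries R) : ev z (f + g) = ev z f + ev z g := by
  simp_rw [ev, ← evalHom_apply (fun _ => hz)]
  exact map_add _ _ _

lemma ev_sub (hz : ‖z‖ < 1) (f g : PowerSeries R) : ev z (f - g) = ev z f - ev z g := by
  simp_rw [ev, ← evalHom_apply (fun _ => hz)]
  exact map_sub _ _ _

lemma ev_mul (hz : ‖z‖ < 1) (f g : PowerSeries R) : ev z (f * g) = ev z f * ev z g := by
  simp_rw [ev, ← evalHom_apply (fun _ => hz)]
  exact map_mul _ _ _

lemma ev_pow (hz : ‖z‖ < 1) (f : PowerSeries R) (k : ℕ) : ev z (f ^ k) = ev z f ^ k := by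
  simp_rw [ev, ← evalHom_apply (fun _ => hz)]
  exact map_pow _ _ _

lemma ev_sum (hz : ‖z‖ < 1) {ι : Type*} (s : Finset ι) (f : ι → PowerSeries R) :
    ev z (∑ i ∈ s, f i) = ∑ i ∈ s, ev z (f i) := by
  simp_rw [ev, ← evalHom_apply (fun _ => hz)]
  exact map_sum _ _ _

lemma ev_X : ev z (PowerSeries.X : PowerSeries R) = z := evalAt_X _

lemma ev_C (r : R) : ev z (PowerSeries.C r) = algebraMap R _ r := evalAt_C _

lemma ev_coe (p : Polynomial R) : ev z (p : PowerSeries R) = Polynomial.aeval z p := by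
  let : UniformSpace R := ⊥
  exact PowerSeries.eval₂_coe _ _ _

lemma ev_subst (hz : ‖z‖ < 1) {g : PowerSeries R} (hg : PowerSeries.constantCoeff g = 0)
    (f : PowerSeries R) : ev z (PowerSeries.subst g f) = ev (ev z g) f :=
  evalAt_subst (PowerSeries.HasSubst.of_constantCoeff_zero' hg).const (fun _ => hz) f

lemma norm_ev_le (hz : ‖z‖ < 1) {f : PowerSeries R} (hf : PowerSeries.constantCoeff f = 0) :
    ‖ev z f‖ ≤ ‖z‖ :=
  norm_evalAt_le (fun _ => hz) hf (norm_nonneg z) fun _ => le_rfl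

lemma norm_ev_sub_le (hz : ‖z‖ < 1) (hw : ‖w‖ < 1) (f : PowerSeries R) :
    ‖ev z f - ev w f‖ ≤ ‖z - w‖ :=
  norm_evalAt_sub_le (fun _ => hz) (fun _ => hw) (norm_nonneg _) (fun _ => le_rfl) f

/-- A power series with invertible constant coefficient has values of norm `1`. -/
lemma norm_ev_of_isUnit (hz : ‖z‖ < 1) {f : PowerSeries R} (hf : IsUnit f) : ‖ev z f‖ = 1 := by
  rw [ev, ← evalHom_apply (fun _ => hz), ← isUnit_valRing_iff]
  exact hf.map _

lemma hasSum_ev (hz : ‖z‖ < 1) (f : PowerSeries R) :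
    HasSum (fun k : ℕ => algebraMap R (ValRing C) (PowerSeries.coeff k f) * z ^ k) (ev z f) := by
  let : UniformSpace R := ⊥
  have : DiscreteUniformity R := ⟨rfl⟩
  exact PowerSeries.hasSum_eval₂ continuous_of_discreteTopology
    (tendsto_pow_atTop_nhds_zero_of_norm_lt_one hz) f

lemma ev_map {R' : Type*} [CommRing R'] [Algebra R' (ValRing C)] (φ : R →+* R')
    (hφ : ∀ r, algebraMap R' (ValRing C) (φ r) = algebraMap R (ValRing C) r)
    (hz : ‖z‖ < 1) (f : PowerSeries R) : ev z (PowerSeries.map φ f) = ev z f :=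
  evalAt_map φ hφ (fun _ => hz) f

end OneVariable

/-! ### Weierstrass preparation and zeros of power series -/

section Weierstrass

variable {C : Type*} [NormedField C] [IsUltrametricDist C] [CompleteSpace C]

lemma mem_span_pow_iff {a x : ValRing C} {n : ℕ} :
    x ∈ (Ideal.span {a} ^ n • ⊤ : Submodule (ValRing C) (ValRing C)) ↔ ‖x‖ ≤ ‖a‖ ^ n := by
  rw [smul_eq_mul, Ideal.mul_top, Ideal.span_singleton_pow, Ideal.mem_span_singleton,
    dvd_valRing_iff, norm_pow]

lemma isAdicComplete_valRing {a : ValRing C} (ha : ‖a‖ < 1) :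
    IsAdicComplete (Ideal.span {a}) (ValRing C) where
  haus' x hx := by
    simp_rw [SModEq.zero, mem_span_pow_iff] at hx
    have := ge_of_tendsto' (tendsto_pow_atTop_nhds_zero_of_lt_one (norm_nonneg a) ha) hx
    simpa using this
  prec' f hf := by
    simp_rw [SModEq.sub_mem, mem_span_pow_iff] at hf ⊢
    have hc : CauchySeq f := cauchySeq_of_le_geometric ‖a‖ 1 ha fun n => by
      rw [dist_eq_norm, one_mul]
      exact hf n.le_succ
    obtain ⟨l, hl⟩ := cauchySeq_tendsto_of_complete hc
    refine ⟨l, fun n => ?_⟩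
    exact le_of_tendsto (tendsto_const_nhds.sub hl).norm
      ((eventually_ge_atTop n).mono fun k hk => hf hk)

/-- Weierstrass division over the valuation ring of a complete field. The maximal ideal of such a
ring may be idempotent, so the division is with respect to a principal ideal that contains the
coefficients of index `< m` of the divisor. -/
lemma exists_weierstrass_division (hC : ∃ c : C, 0 < ‖c‖ ∧ ‖c‖ < 1) {f : PowerSeries (ValRing C)}
    {m : ℕ} (hm : IsUnit (PowerSeries.coeff m f))
    (hlt : ∀ i < m, ¬ IsUnit (PowerSeries.coeff i f)) (g : PowerSeries (ValRing C)) :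
    ∃ (q : PowerSeries (ValRing C)) (r : Polynomial (ValRing C)), r.degree < m ∧ g = f * q + r := by
  obtain ⟨c, hc0, hc1⟩ := hC
  obtain ⟨a, ha1, ha⟩ : ∃ a : ValRing C, ‖a‖ < 1 ∧ ∀ i < m, ‖PowerSeries.coeff i f‖ ≤ ‖a‖ := by
    rcases Nat.eq_zero_or_pos m with rfl | hm0
    · exact ⟨⟨c, mem_valRing_iff.2 hc1.le⟩, hc1, by simp⟩
    · obtain ⟨i, hi, hmax⟩ := Finset.exists_max_image (Finset.range m)
        (fun i => ‖PowerSeries.coeff i f‖) ⟨0, by simpa using hm0⟩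
      refine ⟨PowerSeries.coeff i f, ?_, fun j hj => hmax j (by simpa using hj)⟩
      exact mem_maximalIdeal_valRing_iff.1 (hlt i (by simpa using hi))
  have := isAdicComplete_valRing ha1
  have hord : (f.map (Ideal.Quotient.mk (Ideal.span {a}))).order = m := by
    rw [PowerSeries.order_eq_nat]
    refine ⟨?_, fun i hi => ?_⟩
    · rw [PowerSeries.coeff_map, Ne, Ideal.Quotient.eq_zero_iff_mem, Ideal.mem_span_singleton,
        dvd_valRing_iff, isUnit_valRing_iff.1 hm]
      exact ha1.not_ge
    · rw [PowerSeries.coeff_map, Ideal.Quotient.eq_zero_iff_mem, Ideal.mem_span_singleton,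
        dvd_valRing_iff]
      exact ha i hi
  have hdiv : f.IsWeierstrassDivisorAt (Ideal.span {a}) := by
    rw [PowerSeries.IsWeierstrassDivisorAt, hord]
    exact hm
  obtain ⟨h1, h2⟩ := hdiv.isWeierstrassDivisionAt_div_mod g
  rw [hord] at h1
  exact ⟨_, _, h1, h2⟩

/-- Weierstrass preparation: a power series whose coefficient of index `m` is the first unit is
the product of a unit and of a distinguished polynomial of degree `m`. -/
lemma exists_weierstrass_preparation (hC : ∃ c : C, 0 < ‖c‖ ∧ ‖c‖ < 1)
    {f : PowerSeries (ValRing C)} {m : ℕ} (hm : IsUnit (PowerSeries.coeff m f))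
    (hlt : ∀ i < m, ¬ IsUnit (PowerSeries.coeff i f)) :
    ∃ (q : PowerSeries (ValRing C)) (P : Polynomial (ValRing C)), IsUnit q ∧ P.Monic ∧
      P.natDegree = m ∧ (∀ i < m, ‖P.coeff i‖ < 1) ∧ (P : PowerSeries (ValRing C)) = f * q := by
  obtain ⟨q, r, hr, hq⟩ := exists_weierstrass_division hC hm hlt (PowerSeries.X ^ m)
  -- the product `f * q` is `X ^ m - r`
  have hcoeff : ∀ i ≤ m, ∀ h : PowerSeries (ValRing C), PowerSeries.coeff i (f * h) -
      PowerSeries.coeff i f * PowerSeries.constantCoeff h ∈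
        IsLocalRing.maximalIdeal (ValRing C) := by
    intro i hi h
    rw [PowerSeries.coeff_mul, Finset.Nat.sum_antidiagonal_eq_sum_range_succ_mk,
      Finset.sum_range_succ, Nat.sub_self, PowerSeries.coeff_zero_eq_constantCoeff_apply,
      add_sub_cancel_right]
    refine Ideal.sum_mem _ fun j hj => Ideal.mul_mem_right _ _ ?_
    exact hlt j ((Finset.mem_range.1 hj).trans_le hi)
  have hr' : ∀ i < m, PowerSeries.coeff i (f * q) = - r.coeff i := by
    intro i hi
    have := congrArg (PowerSeries.coeff i) hq
    rw [PowerSeries.coeff_X_pow, if_neg hi.ne, map_add, Polynomial.coeff_coe] at this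
    exact eq_neg_of_add_eq_zero_left this.symm
  have hqm : PowerSeries.coeff m (f * q) = 1 := by
    have := congrArg (PowerSeries.coeff m) hq
    rw [PowerSeries.coeff_X_pow, if_pos rfl, map_add, Polynomial.coeff_coe,
      Polynomial.coeff_eq_zero_of_degree_lt hr, add_zero] at this
    exact this.symm
  refine ⟨q, Polynomial.X ^ m - r, ?_, ?_, ?_, fun i hi => ?_, ?_⟩
  · rw [PowerSeries.isUnit_iff_constantCoeff]
    have h := hcoeff m le_rfl q
    rw [hqm] at h
    by_contra h'
    have h1 : PowerSeries.constantCoeff q ∈ IsLocalRing.maximalIdeal (ValRing C) := h'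
    have h2 := Ideal.add_mem _ h (Ideal.mul_mem_left _ (PowerSeries.coeff m f) h1)
    rw [sub_add_cancel] at h2
    exact (Ideal.ne_top_iff_one _).1 (IsLocalRing.maximalIdeal.isMaximal _).ne_top h2
  · exact Polynomial.monic_X_pow_sub hr
  · refine Polynomial.natDegree_eq_of_degree_eq_some ?_
    rw [Polynomial.degree_sub_eq_left_of_degree_lt (by rwa [Polynomial.degree_X_pow]),
      Polynomial.degree_X_pow]
  · rw [Polynomial.coeff_sub, Polynomial.coeff_X_pow, if_neg hi.ne, zero_sub, ← hr' i hi,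
      ← mem_maximalIdeal_valRing_iff]
    have h := hcoeff i hi.le q
    have h2 := Ideal.add_mem _ h (Ideal.mul_mem_right (PowerSeries.constantCoeff q) _
      (show PowerSeries.coeff i f ∈ IsLocalRing.maximalIdeal (ValRing C) from hlt i hi))
    rwa [sub_add_cancel] at h2
  · rw [Polynomial.coe_sub, Polynomial.coe_pow, Polynomial.coe_X, hq, add_sub_cancel_right]

/-- Over a complete algebraically closed field, a power series whose coefficient of index `m` is
the first unit has `m` zeros, with multiplicities, in the open unit disc, and its values there have
the same norm as the values of the monic polynomial with these zeros. -/
lemma exists_zeros [IsAlgClosed C] (hC : ∃ c : C, 0 < ‖c‖ ∧ ‖c‖ < 1)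
    {f : PowerSeries (ValRing C)} {m : ℕ} (hm : IsUnit (PowerSeries.coeff m f))
    (hlt : ∀ i < m, ¬ IsUnit (PowerSeries.coeff i f)) :
    ∃ s : Multiset (ValRing C), Multiset.card s = m ∧ (∀ z ∈ s, ‖z‖ < 1) ∧
      ∀ y : ValRing C, ‖y‖ < 1 → ‖ev y f‖ = (s.map fun z => ‖y - z‖).prod := by
  obtain ⟨q, P, hq, hP, hdeg, hlow, hPq⟩ := exists_weierstrass_preparation hC hm hlt
  have hP' : (P.map (algebraMap (ValRing C) C)).Monic := hP.map _
  have hroot : ∀ z ∈ (P.map (algebraMap (ValRing C) C)).roots, ‖z‖ < 1 := by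
    intro z hz
    by_contra hz1
    rw [not_lt] at hz1
    have h0 := (Polynomial.mem_roots'.1 hz).2
    rw [Polynomial.IsRoot, Polynomial.eval_map, Polynomial.eval₂_eq_sum_range, hdeg,
      Finset.sum_range_succ] at h0
    have hlead : P.coeff m = 1 := by rw [← hdeg]; exact hP
    rw [hlead, map_one, one_mul] at h0
    have h1 : ‖z ^ m‖ = ‖∑ i ∈ Finset.range m, algebraMap (ValRing C) C (P.coeff i) * z ^ i‖ := by
      rw [← norm_neg (z ^ m)]
      congr 1
      exact (eq_neg_of_add_eq_zero_left h0).symm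
    have hm0 : m ≠ 0 := by
      rintro rfl
      simp at h0
    have h2 : ‖∑ i ∈ Finset.range m, algebraMap (ValRing C) C (P.coeff i) * z ^ i‖ < ‖z ^ m‖ := by
      obtain ⟨i, hi, hle⟩ := IsUltrametricDist.exists_norm_finsetSum_le (Finset.range m)
        (fun i => algebraMap (ValRing C) C (P.coeff i) * z ^ i)
      have hi' : i < m := by
        simpa using hi ⟨0, by simpa using Nat.pos_of_ne_zero hm0⟩
      refine hle.trans_lt ?_
      rw [norm_mul, norm_pow, norm_pow]
      calc _ < 1 * ‖z‖ ^ i :=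
            mul_lt_mul_of_pos_right (hlow i hi') (pow_pos (zero_lt_one.trans_le hz1) _)
        _ ≤ ‖z‖ ^ m := by rw [one_mul]; exact pow_le_pow_right₀ hz1 hi'.le
    exact h2.ne' h1
  have hsplit : (P.map (algebraMap (ValRing C) C)).Splits := IsAlgClosed.splits _
  obtain ⟨s, hs⟩ : ∃ s : Multiset (ValRing C),
      s.map (algebraMap (ValRing C) C) = (P.map (algebraMap (ValRing C) C)).roots := by
    have h : ∀ z ∈ (P.map (algebraMap (ValRing C) C)).roots, z ∈ ValRing C := fun z hz =>
      mem_valRing_iff.2 (hroot z hz).le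
    exact ⟨(P.map (algebraMap (ValRing C) C)).roots.pmap Subtype.mk h, by
      rw [Multiset.map_pmap]; exact Multiset.pmap_eq_map _ _ _ _ |>.trans (Multiset.map_id _)⟩
  refine ⟨s, ?_, fun z hz => hroot z ?_, fun y hy => ?_⟩
  · rw [← hdeg, ← hP.natDegree_map (algebraMap (ValRing C) C), hsplit.natDegree_eq_card_roots, ← hs,
      Multiset.card_map]
  · rw [← hs]
    exact Multiset.mem_map_of_mem _ hz
  · have h1 : ‖ev y f‖ = ‖Polynomial.aeval y P‖ := by
      rw [← ev_coe, hPq, ev_mul hy, norm_mul, norm_ev_of_isUnit hy hq, mul_one]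
    have h2 : ((Polynomial.aeval y P : ValRing C) : C) =
        (s.map (fun z : ValRing C => (y : C) - (z : C))).prod := by
      have : ((Polynomial.aeval y P : ValRing C) : C) =
          (P.map (algebraMap (ValRing C) C)).eval (y : C) := by
        rw [Polynomial.eval_map]
        exact (Polynomial.hom_eval₂ P (RingHom.id _) (algebraMap (ValRing C) C) y)
      rw [this, hsplit.eval_eq_prod_roots_of_monic hP', ← hs, Multiset.map_map]
      rfl
    rw [h1, ← norm_coe_valRing, h2, ← normHom_apply, map_multiset_prod, Multiset.map_map]
    rfl

end Weierstrass

/-! ### Points of formal modules -/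

section Leading

variable {C : Type*} [NormedField C] [IsUltrametricDist C] [CompleteSpace C]
variable {R : Type*} [CommRing R] [Algebra R (ValRing C)] {z : ValRing C}

/-- A power series is approximated by its leading term near `0`. -/
lemma norm_ev_sub_leading_le (hz : ‖z‖ < 1) {f : PowerSeries R} {k : ℕ}
    (hk : ∀ i < k, algebraMap R (ValRing C) (PowerSeries.coeff i f) = 0) :
    ‖ev z f - algebraMap R (ValRing C) (PowerSeries.coeff k f) * z ^ k‖ ≤ ‖z‖ ^ (k + 1) := by
  have h := (hasSum_ev hz f).sub (hasSum_ite_eq k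
    (algebraMap R (ValRing C) (PowerSeries.coeff k f) * z ^ k))
  refine norm_le_of_hasSum h (by positivity) fun i => ?_
  rcases lt_trichotomy i k with hi | rfl | hi
  · rw [hk i hi, if_neg hi.ne]
    simp
  · simp
  · rw [if_neg hi.ne', sub_zero, norm_mul, norm_pow]
    exact (mul_le_of_le_one_left (by positivity) (norm_valRing_le_one _)).trans
      (pow_le_pow_of_le_one (norm_nonneg _) hz.le hi)

/-- Near `0` a power series has the norm of its leading term. -/
lemma norm_ev_eq_leading (hz : ‖z‖ < 1) {f : PowerSeries R} {k : ℕ}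
    (hk : ∀ i < k, algebraMap R (ValRing C) (PowerSeries.coeff i f) = 0)
    (hzk : ‖z‖ < ‖algebraMap R (ValRing C) (PowerSeries.coeff k f)‖) :
    ‖ev z f‖ = ‖algebraMap R (ValRing C) (PowerSeries.coeff k f)‖ * ‖z‖ ^ k := by
  rcases eq_or_ne z 0 with rfl | hz0
  · have h := norm_ev_sub_leading_le hz hk
    rw [norm_zero, zero_pow k.succ_ne_zero, norm_le_zero_iff, sub_eq_zero] at h
    rw [h, norm_mul, norm_pow]
  have h := norm_ev_sub_leading_le hz hk
  have h1 : ‖z‖ ^ (k + 1) < ‖algebraMap R (ValRing C) (PowerSeries.coeff k f) * z ^ k‖ := by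
    rw [norm_mul, norm_pow, pow_succ, mul_comm]
    exact mul_lt_mul_of_pos_right hzk (pow_pos (norm_pos_iff.2 hz0) _)
  have h2 := IsUltrametricDist.norm_add_eq_max_of_norm_ne_norm (h.trans_lt h1).ne
  rw [sub_add_cancel, max_eq_right (h.trans_lt h1).le] at h2
  rw [h2, norm_mul, norm_pow]

end Leading

section Points

variable {O R : Type*} [CommRing O] [CommRing R] [Algebra O R]
variable (C : Type*) [NormedField C] [IsUltrametricDist C]

/-- The points of a formal module with values in the valuation ring of `C`: the elements of the
maximal ideal, with the addition and the action of `O` given by the power series of the formal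
module. -/
@[ext]
structure Point (G : FormalModule O R) where
  val : ValRing C
  norm_lt_one : ‖val‖ < 1

variable {C} [CompleteSpace C] [Algebra R (ValRing C)] {σ : Type*} [Finite σ]

lemma norm_cons_lt_one {z w : ValRing C} (hz : ‖z‖ < 1) (hw : ‖w‖ < 1) (i : Fin 2) :
    ‖(![z, w] : Fin 2 → ValRing C) i‖ < 1 := by
  fin_cases i
  exacts [hz, hw]

lemma evalAt_subst_cons {b : σ → ValRing C} (hb : ∀ s, ‖b s‖ < 1) {g h : MvPowerSeries σ R}
    (hg : MvPowerSeries.constantCoeff g = 0) (hh : MvPowerSeries.constantCoeff h = 0)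
    (F : MvPowerSeries (Fin 2) R) :
    evalAt b (MvPowerSeries.subst ![g, h] F) = evalAt ![evalAt b g, evalAt b h] F := by
  rw [evalAt_subst _ hb]
  · congr 1
    funext i
    fin_cases i <;> rfl
  · exact MvPowerSeries.hasSubst_of_constantCoeff_zero fun i => by fin_cases i <;> simpa

lemma evalAt_powerSeries_subst {b : σ → ValRing C} (hb : ∀ s, ‖b s‖ < 1) {g : MvPowerSeries σ R}
    (hg : MvPowerSeries.constantCoeff g = 0) (f : PowerSeries R) :
    evalAt b (PowerSeries.subst g f) = ev (evalAt b g) f :=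
  evalAt_subst (PowerSeries.HasSubst.of_constantCoeff_zero hg).const hb f

/-- Homomorphisms of formal group laws are additive on points. -/
lemma ev_evalAt_of_isHom {F F' : FormalGroup R} {f : PowerSeries R} (hf : F.IsHom F' f)
    {z w : ValRing C} (hz : ‖z‖ < 1) (hw : ‖w‖ < 1) :
    ev (evalAt ![z, w] F.toPowerSeries) f = evalAt ![ev z f, ev w f] F'.toPowerSeries := by
  have h := congrArg (evalAt ![z, w]) hf.map_add
  rw [evalAt_powerSeries_subst (norm_cons_lt_one hz hw) F.zero_constantCoeff, evalAt_subst _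
    (norm_cons_lt_one hz hw)] at h
  · rw [h]
    congr 1
    funext i
    rw [evalAt_powerSeries_subst (norm_cons_lt_one hz hw) (by simp)]
    fin_cases i <;> simp [evalAt_X]
  · exact MvPowerSeries.hasSubst_of_constantCoeff_zero fun i =>
      PowerSeries.constantCoeff_subst_eq_zero (by simp) _ hf.constantCoeff_eq_zero

namespace Point

variable {G H : FormalModule O R}

noncomputable instance : Zero (Point C G) := ⟨⟨0, by simp⟩⟩

noncomputable instance : Add (Point C G) :=
  ⟨fun x y => ⟨evalAt ![x.val, y.val] G.law.toPowerSeries,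
    norm_evalAt_lt_one (norm_cons_lt_one x.norm_lt_one y.norm_lt_one) G.law.zero_constantCoeff⟩⟩

noncomputable instance : SMul O (Point C G) :=
  ⟨fun a x => ⟨ev x.val (G.act a),
    norm_evalAt_lt_one (fun _ => x.norm_lt_one) (G.act_isHom a).constantCoeff_eq_zero⟩⟩

noncomputable instance : Neg (Point C G) := ⟨fun x => (-1 : O) • x⟩

lemma zero_val : (0 : Point C G).val = 0 := rfl

lemma smul_val (a : O) (x : Point C G) : (a • x).val = ev x.val (G.act a) := rfl

lemma norm_pair_lt_one (x y : Point C G) (i : Fin 2) :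
    ‖(![x.val, y.val] : Fin 2 → ValRing C) i‖ < 1 :=
  norm_cons_lt_one x.norm_lt_one y.norm_lt_one i

protected lemma add_assoc (x y z : Point C G) : x + y + z = x + (y + z) := by
  have hb : ∀ i, ‖(![x.val, y.val, z.val] : Fin 3 → ValRing C) i‖ < 1 := by
    intro i
    fin_cases i
    exacts [x.norm_lt_one, y.norm_lt_one, z.norm_lt_one]
  have hF : ∀ i j : Fin 3, MvPowerSeries.constantCoeff (MvPowerSeries.subst
      ![(MvPowerSeries.X i : MvPowerSeries (Fin 3) R), MvPowerSeries.X j]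
        G.law.toPowerSeries) = 0 := fun i j =>
    MvPowerSeries.constantCoeff_subst_eq_zero MvPowerSeries.HasSubst.X_X
      (fun k => by fin_cases k <;> simp) G.law.zero_constantCoeff
  have h := congrArg (evalAt ![x.val, y.val, z.val]) G.law.assoc
  rw [evalAt_subst_cons hb (hF _ _) (by simp), evalAt_subst_cons hb (by simp) (hF _ _),
    evalAt_subst_cons hb (by simp) (by simp), evalAt_subst_cons hb (by simp) (by simp)] at h
  simp only [evalAt_X] at h
  ext1
  exact h

protected lemma add_comm (x y : Point C G) : x + y = y + x := by
  have h := congrArg (evalAt ![x.val, y.val]) G.isComm.comm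
  rw [evalAt_subst_cons (norm_pair_lt_one x y) (by simp) (by simp)] at h
  simp only [evalAt_X] at h
  ext1
  exact h

lemma evalAt_zero (b : σ → ValRing C) : evalAt b (0 : MvPowerSeries σ R) = 0 := by
  rw [← map_zero MvPowerSeries.C, evalAt_C, map_zero]

protected lemma zero_add (x : Point C G) : 0 + x = x := by
  have h := congrArg (ev x.val) (G.law.zero_add (f := (PowerSeries.X : PowerSeries R))
    PowerSeries.HasSubst.X')
  have hX : MvPowerSeries.constantCoeff (PowerSeries.X : PowerSeries R) = 0 :=
    PowerSeries.constantCoeff_X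
  rw [ev, evalAt_subst_cons (fun _ => x.norm_lt_one) (map_zero _) hX, evalAt_zero] at h
  change evalAt ![0, ev x.val PowerSeries.X] _ = ev x.val PowerSeries.X at h
  rw [ev_X] at h
  ext1
  exact h

protected lemma smul_add (a : O) (x y : Point C G) : a • (x + y) = a • x + a • y := by
  ext1
  exact ev_evalAt_of_isHom (G.act_isHom a) x.norm_lt_one y.norm_lt_one

protected lemma smul_zero (a : O) : a • (0 : Point C G) = 0 := by
  ext1
  rw [smul_val, zero_val, ← norm_le_zero_iff]
  exact (norm_ev_le (by simp) (G.act_isHom a).constantCoeff_eq_zero).trans (by simp)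

protected lemma add_smul (a b : O) (x : Point C G) : (a + b) • x = a • x + b • x := by
  ext1
  have h := congrArg (ev x.val) (G.act_add a b)
  rw [ev, ev, evalAt_subst_cons (fun _ => x.norm_lt_one) (G.act_isHom a).constantCoeff_eq_zero
    (G.act_isHom b).constantCoeff_eq_zero] at h
  exact h

protected lemma mul_smul (a b : O) (x : Point C G) : (a * b) • x = a • b • x := by
  ext1
  rw [smul_val, G.act_mul, ev_subst x.norm_lt_one (G.act_isHom b).constantCoeff_eq_zero]
  rfl

protected lemma one_smul (x : Point C G) : (1 : O) • x = x := by
  ext1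
  rw [smul_val, G.act_one, ev_X]

lemma coeff_zero_act (a : O) : PowerSeries.coeff 0 (G.act a) = 0 := by
  rw [PowerSeries.coeff_zero_eq_constantCoeff_apply, (G.act_isHom a).constantCoeff_eq_zero]

protected lemma zero_smul (x : Point C G) : (0 : O) • x = 0 := by
  -- the element `u = [0] (x)` satisfies `u = [0] (u)`, hence `‖u‖ ≤ ‖u‖ ^ 2`
  have h : (0 : O) • (0 : O) • x = (0 : O) • x := by rw [← Point.mul_smul, mul_zero]
  generalize (0 : O) • x = u at h
  have h1 := norm_ev_sub_leading_le (z := u.val) (k := 1) u.norm_lt_one (f := G.act (0 : O))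
    (fun i hi => by
      obtain rfl : i = 0 := by omega
      rw [coeff_zero_act, map_zero])
  rw [← smul_val, h, G.coeff_one_act, map_zero, map_zero, zero_mul, sub_zero] at h1
  ext1
  rw [zero_val, ← norm_le_zero_iff]
  by_contra! hu
  rw [pow_succ, pow_one] at h1
  exact h1.not_gt (mul_lt_of_lt_one_right hu u.norm_lt_one)

noncomputable instance : AddCommGroup (Point C G) where
  add_assoc := Point.add_assoc
  zero_add := Point.zero_add
  add_zero x := by rw [Point.add_comm, Point.zero_add]
  add_comm := Point.add_comm
  neg_add_cancel x := by
    have h := Point.add_smul (-1 : O) 1 x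
    rw [neg_add_cancel, Point.zero_smul, Point.one_smul] at h
    exact h.symm
  nsmul := nsmulRec
  zsmul := zsmulRec

noncomputable instance : Module O (Point C G) where
  one_smul := Point.one_smul
  mul_smul := Point.mul_smul
  smul_zero := Point.smul_zero
  smul_add := Point.smul_add
  add_smul := Point.add_smul
  zero_smul := Point.zero_smul

lemma val_eq_zero {x : Point C G} : x.val = 0 ↔ x = 0 :=
  ⟨fun h => by ext1; exact h, fun h => h ▸ rfl⟩

lemma norm_add_right_sub_le (x y z : Point C G) :
    ‖(x + z).val - (y + z).val‖ ≤ ‖x.val - y.val‖ := by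
  refine norm_evalAt_sub_le (norm_pair_lt_one x z) (norm_pair_lt_one y z) (norm_nonneg _)
    (fun i => ?_) _
  fin_cases i <;> simp

/-- The difference in a formal group has the norm of the difference of the coordinates. -/
lemma norm_sub_val (x y : Point C G) : ‖(x - y).val‖ = ‖x.val - y.val‖ := by
  refine le_antisymm ?_ ?_
  · have h := norm_add_right_sub_le x y (-y)
    rwa [add_neg_cancel, zero_val, sub_zero, ← sub_eq_add_neg] at h
  · have h := norm_add_right_sub_le (x - y) 0 y
    rwa [sub_add_cancel, _root_.zero_add, zero_val, sub_zero] at h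

lemma norm_smul_le (a : O) (x : Point C G) : ‖(a • x).val‖ ≤ ‖x.val‖ :=
  norm_ev_le x.norm_lt_one (G.act_isHom a).constantCoeff_eq_zero

lemma norm_neg_val (x : Point C G) : ‖(-x).val‖ = ‖x.val‖ := by
  rw [← zero_sub, norm_sub_val, zero_val, zero_sub, norm_neg]

lemma norm_add_le_max (x y : Point C G) : ‖(x + y).val‖ ≤ max ‖x.val‖ ‖y.val‖ := by
  rw [← sub_neg_eq_add, norm_sub_val, ← norm_neg_val y]
  have h := IsUltrametricDist.norm_add_le_max x.val (-(-y).val)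
  rwa [norm_neg, ← sub_eq_add_neg] at h

/-- The map on points given by a homomorphism of formal modules. -/
noncomputable def map {f : PowerSeries R} (hf : G.IsHom H f) : Point C G →ₗ[O] Point C H where
  toFun x := ⟨ev x.val f,
    norm_evalAt_lt_one (fun _ => x.norm_lt_one) hf.isHom_law.constantCoeff_eq_zero⟩
  map_add' x y := by
    ext1
    exact ev_evalAt_of_isHom hf.isHom_law x.norm_lt_one y.norm_lt_one
  map_smul' a x := by
    ext1
    have h := congrArg (ev x.val) (hf.map_act a)
    rw [ev_subst x.norm_lt_one (G.act_isHom a).constantCoeff_eq_zero,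
      ev_subst x.norm_lt_one hf.isHom_law.constantCoeff_eq_zero] at h
    exact h

lemma map_val {f : PowerSeries R} (hf : G.IsHom H f) (x : Point C G) :
    (map hf x).val = ev x.val f := rfl

/-- The closed ball of radius `r`, as a submodule of the points. -/
noncomputable def ball (G : FormalModule O R) {r : ℝ} (hr : 0 ≤ r) : Submodule O (Point C G) where
  carrier := {x | ‖x.val‖ ≤ r}
  add_mem' {x y} hx hy := (norm_add_le_max x y).trans (max_le hx hy)
  zero_mem' := by simpa [zero_val] using hr
  smul_mem' a x hx := (norm_smul_le a x).trans hx

end Point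

end Points

/-! ### Kernels and fibres of isogenies -/

section Isogeny

variable {O R : Type*} [CommRing O] [CommRing R] [Algebra O R]
variable {C : Type*} [NormedField C] [IsUltrametricDist C] [CompleteSpace C] [Algebra R (ValRing C)]
variable {G H : FormalModule O R} {f : PowerSeries R} {ϖ : O}

namespace Point

lemma algebraMap_coeff_zero (hf : G.IsHom H f) :
    algebraMap R (ValRing C) (PowerSeries.coeff 0 f) = 0 := by
  rw [PowerSeries.coeff_zero_eq_constantCoeff_apply, hf.isHom_law.constantCoeff_eq_zero, map_zero]

lemma norm_map_of_norm_lt (hf : G.IsHom H f) {x : Point C G}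
    (hx : ‖x.val‖ < ‖algebraMap R (ValRing C) (PowerSeries.coeff 1 f)‖) :
    ‖(map hf x).val‖ = ‖algebraMap R (ValRing C) (PowerSeries.coeff 1 f)‖ * ‖x.val‖ := by
  rw [map_val, norm_ev_eq_leading (k := 1) x.norm_lt_one _ hx, pow_one]
  intro i hi
  obtain rfl : i = 0 := by omega
  exact algebraMap_coeff_zero hf

lemma norm_smul_of_norm_lt {x : Point C G}
    (hx : ‖x.val‖ < ‖algebraMap R (ValRing C) (algebraMap O R ϖ)‖) :
    ‖(ϖ • x).val‖ = ‖algebraMap R (ValRing C) (algebraMap O R ϖ)‖ * ‖x.val‖ := by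
  rw [smul_val, ← G.coeff_one_act]
  rw [← G.coeff_one_act] at hx
  rw [norm_ev_eq_leading (k := 1) x.norm_lt_one _ hx, pow_one]
  intro i hi
  obtain rfl : i = 0 := by omega
  rw [coeff_zero_act, map_zero]

lemma norm_smul_lt (hϖ : ‖algebraMap R (ValRing C) (algebraMap O R ϖ)‖ < 1) {x : Point C G}
    (hx : x ≠ 0) : ‖(ϖ • x).val‖ < ‖x.val‖ := by
  have hx0 : 0 < ‖x.val‖ := norm_pos_iff.2 (mt val_eq_zero.1 hx)
  have h := norm_ev_sub_leading_le (f := G.act ϖ) (k := 1) x.norm_lt_one fun i hi => by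
    obtain rfl : i = 0 := by omega
    rw [coeff_zero_act, map_zero]
  rw [G.coeff_one_act, ← smul_val, pow_one] at h
  have h1 := IsUltrametricDist.norm_add_le_max
    ((ϖ • x).val - algebraMap R (ValRing C) (algebraMap O R ϖ) * x.val)
    (algebraMap R (ValRing C) (algebraMap O R ϖ) * x.val)
  rw [sub_add_cancel] at h1
  refine h1.trans_lt (max_lt (h.trans_lt ?_) ?_)
  · rw [pow_succ, pow_one]
    exact mul_lt_of_lt_one_right hx0 x.norm_lt_one
  · rw [norm_mul]
    exact mul_lt_of_lt_one_left hx0 hϖ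

/-- An isogeny has a nonzero linear coefficient: if its leading term is `c T ^ k`, then
`f ([ϖ] T) = [ϖ] (f T)` gives `c ϖ ^ k = ϖ c`. -/
lemma coeff_one_ne_zero (hϖ0 : 0 < ‖algebraMap R (ValRing C) (algebraMap O R ϖ)‖)
    (hϖ1 : ‖algebraMap R (ValRing C) (algebraMap O R ϖ)‖ < 1) (hf : G.IsIsogeny H f) :
    algebraMap R (ValRing C) (PowerSeries.coeff 1 f) ≠ 0 := by
  classical
  have hex : ∃ k, algebraMap R (ValRing C) (PowerSeries.coeff k f) ≠ 0 :=
    hf.2.imp fun k hk => (hk.map (algebraMap R (ValRing C))).ne_zero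
  obtain ⟨k, hk, hmin⟩ : ∃ k, algebraMap R (ValRing C) (PowerSeries.coeff k f) ≠ 0 ∧
      ∀ i < k, algebraMap R (ValRing C) (PowerSeries.coeff i f) = 0 :=
    ⟨Nat.find hex, Nat.find_spec hex, fun i hi => not_not.1 (Nat.find_min hex hi)⟩
  suffices h : k = 1 from h ▸ hk
  set c := algebraMap R (ValRing C) (PowerSeries.coeff k f) with hc
  set p := algebraMap R (ValRing C) (algebraMap O R ϖ) with hp
  have hc0 : 0 < ‖c‖ := norm_pos_iff.2 hk
  have hc1 := norm_valRing_le_one c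
  have hy1 : ‖c * p ^ 2‖ < ‖c‖ := by
    rw [norm_mul, norm_pow]
    exact mul_lt_of_lt_one_right hc0 (pow_lt_one₀ hϖ0.le hϖ1 two_ne_zero)
  have hy2 : ‖c * p ^ 2‖ < ‖p‖ := by
    rw [norm_mul, norm_pow]
    refine (mul_le_of_le_one_left (by positivity) hc1).trans_lt ?_
    rw [pow_two]
    exact mul_lt_of_lt_one_right hϖ0 hϖ1
  let x : Point C G := ⟨c * p ^ 2, hy1.trans_le hc1⟩
  have hx0 : 0 < ‖x.val‖ := by
    change 0 < ‖c * p ^ 2‖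
    rw [norm_mul, norm_pow]
    positivity
  have h1 : ‖(map hf.1 x).val‖ = ‖c‖ * ‖x.val‖ ^ k := norm_ev_eq_leading x.norm_lt_one hmin hy1
  have h2 : ‖(ϖ • x).val‖ = ‖p‖ * ‖x.val‖ := norm_smul_of_norm_lt hy2
  have hlt : ‖(ϖ • x).val‖ < ‖c‖ := (norm_smul_le ϖ x).trans_lt hy1
  have h3 : ‖(map hf.1 (ϖ • x)).val‖ = ‖c‖ * (‖p‖ * ‖x.val‖) ^ k := by
    rw [← h2]
    exact norm_ev_eq_leading (ϖ • x).norm_lt_one hmin hlt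
  have hk0 : k ≠ 0 := by
    rintro rfl
    exact hk (algebraMap_coeff_zero hf.1)
  have h4 : ‖(map hf.1 x).val‖ < ‖p‖ := by
    rw [h1]
    refine (mul_le_of_le_one_left (by positivity) hc1).trans_lt ?_
    exact (pow_le_of_le_one hx0.le x.norm_lt_one.le hk0).trans_lt hy2
  rw [map_smul, norm_smul_of_norm_lt h4, h1, mul_pow] at h3
  have h5 : ‖p‖ ^ k = ‖p‖ ^ 1 := by
    have : (‖p‖ ^ k - ‖p‖) * (‖c‖ * ‖x.val‖ ^ k) = 0 := by linear_combination -h3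
    rw [pow_one]
    exact sub_eq_zero.1 ((mul_eq_zero.1 this).resolve_right (by positivity))
  exact (pow_right_inj₀ hϖ0 hϖ1.ne).1 h5

variable [IsAlgClosed C]

lemma exists_first_unit (hf : G.IsIsogeny H f) :
    ∃ m, m ≠ 0 ∧ IsUnit (algebraMap R (ValRing C) (PowerSeries.coeff m f)) ∧
      ∀ i < m, ¬ IsUnit (algebraMap R (ValRing C) (PowerSeries.coeff i f)) := by
  classical
  have hex : ∃ k, IsUnit (algebraMap R (ValRing C) (PowerSeries.coeff k f)) :=
    hf.2.imp fun k hk => hk.map (algebraMap R (ValRing C))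
  refine ⟨Nat.find hex, fun h0 => ?_, Nat.find_spec hex, fun i hi => Nat.find_min hex hi⟩
  have h := Nat.find_spec hex
  rw [h0, algebraMap_coeff_zero hf.1] at h
  exact not_isUnit_zero h

/-- The kernel of an isogeny is finite, its order is the index of the first coefficient that is a
unit, and `f` has the norm of the polynomial with simple zeros at the points of the kernel. -/
theorem exists_finset_ker (hϖ0 : 0 < ‖algebraMap R (ValRing C) (algebraMap O R ϖ)‖)
    (hϖ1 : ‖algebraMap R (ValRing C) (algebraMap O R ϖ)‖ < 1) (hf : G.IsIsogeny H f) :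
    ∃ s : Finset (Point C G), (∀ x, x ∈ s ↔ map hf.1 x = 0) ∧
      (∀ y, ‖(map hf.1 y).val‖ = ∏ k ∈ s, ‖y.val - k.val‖) ∧
      ∀ m, IsUnit (algebraMap R (ValRing C) (PowerSeries.coeff m f)) →
        (∀ i < m, ¬ IsUnit (algebraMap R (ValRing C) (PowerSeries.coeff i f))) → s.card = m := by
  obtain ⟨m, -, hm, hlt⟩ := exists_first_unit (C := C) hf
  obtain ⟨s₀, hs₀, hs₁, hs₂⟩ := exists_zeros
    ⟨(algebraMap R (ValRing C) (algebraMap O R ϖ) : C), hϖ0, hϖ1⟩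
    (f := f.map (algebraMap R (ValRing C))) (m := m) (by simpa using hm) (by simpa using hlt)
  obtain ⟨s, rfl⟩ : ∃ s : Multiset (Point C G), s.map Point.val = s₀ :=
    ⟨s₀.pmap Point.mk hs₁, by
      rw [Multiset.map_pmap]; exact (Multiset.pmap_eq_map _ _ _ _).trans (Multiset.map_id _)⟩
  have hprod : ∀ y : Point C G, ‖(map hf.1 y).val‖ = (s.map fun k => ‖y.val - k.val‖).prod := by
    intro y
    rw [map_val, ← ev_map (algebraMap R (ValRing C)) (fun _ => rfl) y.norm_lt_one,
      hs₂ _ y.norm_lt_one, Multiset.map_map]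
    rfl
  have hle : ∀ (t : Multiset (Point C G)) (y : Point C G),
      0 ≤ (t.map fun k => ‖y.val - k.val‖).prod ∧ (t.map fun k => ‖y.val - k.val‖).prod ≤ 1 := by
    intro t y
    induction t using Multiset.induction with
    | empty => simp
    | cons k t ih =>
      rw [Multiset.map_cons, Multiset.prod_cons]
      exact ⟨mul_nonneg (norm_nonneg _) ih.1,
        mul_le_one₀ (norm_valRing_le_one _) ih.1 ih.2⟩
  have hmem : ∀ x, x ∈ s ↔ map hf.1 x = 0 := by
    intro x
    rw [← val_eq_zero, ← norm_eq_zero, hprod, Multiset.prod_eq_zero_iff, Multiset.mem_map]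
    constructor
    · exact fun hx => ⟨x, hx, by simp⟩
    · rintro ⟨k, hk, hkx⟩
      rw [norm_eq_zero, sub_eq_zero] at hkx
      rwa [Point.ext hkx]
  have hnodup : s.Nodup := by
    rw [Multiset.nodup_iff_ne_cons_cons]
    rintro k t rfl
    -- near a double zero `k`, the norm of `f (k + x)` would be at most `‖x‖ ^ 2`
    have hc := coeff_one_ne_zero hϖ0 hϖ1 hf
    set c := algebraMap R (ValRing C) (PowerSeries.coeff 1 f) with hcdef
    set p := algebraMap R (ValRing C) (algebraMap O R ϖ) with hp
    have hc0 : 0 < ‖c‖ := norm_pos_iff.2 hc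
    have hy1 : ‖c * p‖ < ‖c‖ := by
      rw [norm_mul]
      exact mul_lt_of_lt_one_right hc0 hϖ1
    let x : Point C G := ⟨c * p, hy1.trans_le (norm_valRing_le_one c)⟩
    have hx0 : 0 < ‖x.val‖ := by
      change 0 < ‖c * p‖
      rw [norm_mul]
      positivity
    have h1 := norm_map_of_norm_lt hf.1 (x := x) hy1
    have hk : map hf.1 k = 0 := (hmem k).1 (by simp)
    have h2 := hprod (x + k)
    rw [map_add, hk, add_zero, h1, Multiset.map_cons, Multiset.map_cons, Multiset.prod_cons,
      Multiset.prod_cons, ← norm_sub_val, add_sub_cancel_right, ← mul_assoc] at h2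
    have h3 : ‖c‖ * ‖x.val‖ ≤ ‖x.val‖ * ‖x.val‖ :=
      h2.le.trans (mul_le_of_le_one_right (by positivity) (hle t (x + k)).2)
    exact (le_of_mul_le_mul_right h3 hx0).not_gt hy1
  refine ⟨⟨s, hnodup⟩, hmem, hprod, fun m' hm' hlt' => ?_⟩
  rw [Multiset.card_map] at hs₀
  rw [Finset.card_mk, hs₀]
  rcases lt_trichotomy m m' with h | h | h
  exacts [absurd hm (hlt' _ h), h, absurd hm' (hlt _ h)]

/-- Isogenies are surjective on points with values in an algebraically closed field. -/
theorem map_surjective (hϖ0 : 0 < ‖algebraMap R (ValRing C) (algebraMap O R ϖ)‖)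
    (hϖ1 : ‖algebraMap R (ValRing C) (algebraMap O R ϖ)‖ < 1) (hf : G.IsIsogeny H f) :
    Function.Surjective (map (C := C) hf.1) := by
  intro w
  obtain ⟨m, hm0, hm, hlt⟩ := exists_first_unit (C := C) hf
  obtain ⟨s, hs₀, hs₁, hs₂⟩ := exists_zeros
    ⟨(algebraMap R (ValRing C) (algebraMap O R ϖ) : C), hϖ0, hϖ1⟩
    (f := f.map (algebraMap R (ValRing C)) - PowerSeries.C w.val) (m := m)
    (by simpa [PowerSeries.coeff_C, hm0] using hm) (fun i hi => by
      rcases eq_or_ne i 0 with rfl | hi0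
      · rw [map_sub, PowerSeries.coeff_map, algebraMap_coeff_zero hf.1, PowerSeries.coeff_C,
          if_pos rfl, zero_sub, IsUnit.neg_iff, isUnit_valRing_iff]
        exact w.norm_lt_one.ne
      · simpa [PowerSeries.coeff_C, hi0] using hlt i hi)
  obtain ⟨z, hz⟩ : ∃ z, z ∈ s := Multiset.card_pos_iff_exists_mem.1 (by omega)
  refine ⟨⟨z, hs₁ z hz⟩, ?_⟩
  have h := hs₂ z (hs₁ z hz)
  rw [Multiset.prod_eq_zero (Multiset.mem_map.2 ⟨z, hz, by simp⟩), norm_eq_zero,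
    ev_sub (hs₁ z hz), ev_C, ev_map _ (fun _ => rfl) (hs₁ z hz), sub_eq_zero] at h
  ext1
  exact h

lemma finite_fiber (hϖ0 : 0 < ‖algebraMap R (ValRing C) (algebraMap O R ϖ)‖)
    (hϖ1 : ‖algebraMap R (ValRing C) (algebraMap O R ϖ)‖ < 1) (hf : G.IsIsogeny H f)
    (w : Point C H) : {y : Point C G | map hf.1 y = w}.Finite := by
  obtain ⟨s, hs, -, -⟩ := exists_finset_ker hϖ0 hϖ1 hf
  obtain ⟨y, rfl⟩ := map_surjective hϖ0 hϖ1 hf w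
  refine (s.finite_toSet.image fun k => y - k).subset fun y' hy' => ?_
  refine ⟨y - y', ?_, sub_sub_cancel _ _⟩
  rw [Finset.mem_coe, hs, map_sub, hy', sub_self]

/-- The norm of a point is the product of the norms of its preimages under an isogeny. -/
lemma norm_eq_prod_fiber (hϖ0 : 0 < ‖algebraMap R (ValRing C) (algebraMap O R ϖ)‖)
    (hϖ1 : ‖algebraMap R (ValRing C) (algebraMap O R ϖ)‖ < 1) (hf : G.IsIsogeny H f)
    (w : Point C H) :
    ‖w.val‖ = ∏ y ∈ (finite_fiber hϖ0 hϖ1 hf w).toFinset, ‖y.val‖ := by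
  obtain ⟨s, hs, hs', -⟩ := exists_finset_ker hϖ0 hϖ1 hf
  obtain ⟨y, rfl⟩ := map_surjective hϖ0 hϖ1 hf w
  rw [hs']
  refine Finset.prod_bij' (fun k _ => y - k) (fun y' _ => y - y') ?_ ?_ ?_ ?_ ?_
  · intro k hk
    rw [hs] at hk
    simp [hk]
  · intro y' hy'
    rw [Set.Finite.mem_toFinset] at hy'
    rw [hs, map_sub, show map hf.1 y' = map hf.1 y from hy', sub_self]
  · intro k _
    exact sub_sub_cancel _ _
  · intro k _
    exact sub_sub_cancel _ _
  · intro k _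
    rw [norm_sub_val]

end Point

end Isogeny

/-! ### Factorization of homomorphisms through isogenies -/

section SubstInjective

variable {R : Type*} [CommRing R] {σ : Type*} [Finite σ]

lemma hasSubst_subst_X {g : PowerSeries R} (hg : PowerSeries.constantCoeff g = 0) :
    MvPowerSeries.HasSubst
      (fun s : σ => PowerSeries.subst (MvPowerSeries.X s : MvPowerSeries σ R) g) :=
  MvPowerSeries.hasSubst_of_constantCoeff_zero fun _ =>
    PowerSeries.constantCoeff_subst_eq_zero (by simp) _ hg

/-- If `g = c T + ⋯`, then the product of the `g (X_s) ^ (d_s)` is `c ^ |d| X ^ d` up to monomials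
of higher degree that are divisible by `X ^ d`. -/
lemma coeff_prod_subst_X {g : PowerSeries R} (hg : PowerSeries.constantCoeff g = 0)
    (d n : σ →₀ ℕ) :
    (d = n → MvPowerSeries.coeff n (d.prod fun s e =>
        (PowerSeries.subst (MvPowerSeries.X s : MvPowerSeries σ R) g) ^ e) =
      (PowerSeries.coeff 1 g) ^ d.degree) ∧
    (¬ d ≤ n → MvPowerSeries.coeff n (d.prod fun s e =>
        (PowerSeries.subst (MvPowerSeries.X s : MvPowerSeries σ R) g) ^ e) = 0) := by
  classical
  obtain ⟨h, rfl⟩ := PowerSeries.X_dvd_iff.2 hg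
  have hX : ∀ s : σ, PowerSeries.subst (MvPowerSeries.X s : MvPowerSeries σ R)
      (PowerSeries.X * h) = MvPowerSeries.X s *
        PowerSeries.subst (MvPowerSeries.X s : MvPowerSeries σ R) h := fun s => by
    rw [PowerSeries.subst_mul (PowerSeries.HasSubst.X s),
      PowerSeries.subst_X (PowerSeries.HasSubst.X s)]
  have hc : ∀ s : σ, MvPowerSeries.constantCoeff
      (PowerSeries.subst (MvPowerSeries.X s : MvPowerSeries σ R) h) =
        PowerSeries.coeff 1 (PowerSeries.X * h) := fun s => by
    have h1 : h = PowerSeries.C (PowerSeries.constantCoeff h) +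
        (h - PowerSeries.C (PowerSeries.constantCoeff h)) := by ring
    rw [show PowerSeries.coeff 1 (PowerSeries.X * h) = PowerSeries.constantCoeff h from
      (PowerSeries.coeff_succ_X_mul 0 h).trans
        (PowerSeries.coeff_zero_eq_constantCoeff_apply h)]
    conv_lhs => rw [h1]
    rw [PowerSeries.subst_add (PowerSeries.HasSubst.X s), map_add, PowerSeries.subst_C,
      MvPowerSeries.constantCoeff_C, PowerSeries.constantCoeff_subst_eq_zero (by simp) _ (by simp),
      add_zero]
  have hprod : (d.prod fun s e => (PowerSeries.subst (MvPowerSeries.X s : MvPowerSeries σ R)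
      (PowerSeries.X * h)) ^ e) = MvPowerSeries.monomial d 1 *
        d.prod fun s e => (PowerSeries.subst (MvPowerSeries.X s : MvPowerSeries σ R) h) ^ e := by
    simp_rw [hX, mul_pow]
    rw [Finsupp.prod_mul]
    congr 1
    rw [MvPowerSeries.monomial_eq']
    simp
  refine ⟨fun h1 => ?_, fun h2 => ?_⟩
  · subst h1
    rw [hprod, MvPowerSeries.coeff_monomial_mul, if_pos le_rfl, tsub_self, one_mul,
      MvPowerSeries.coeff_zero_eq_constantCoeff_apply, map_finsuppProd]
    simp_rw [map_pow, hc]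
    rw [Finsupp.prod, Finset.prod_pow_eq_pow_sum]
    rfl
  · rw [hprod, MvPowerSeries.coeff_monomial_mul, if_neg h2]

/-- Substitution of a power series with nonzero linear coefficient for each variable is injective
over a domain. -/
lemma subst_injective [IsDomain R] {g : PowerSeries R} (hg : PowerSeries.constantCoeff g = 0)
    (hg1 : PowerSeries.coeff 1 g ≠ 0) : Function.Injective (MvPowerSeries.subst
      (fun s : σ => PowerSeries.subst (MvPowerSeries.X s : MvPowerSeries σ R) g) :
        MvPowerSeries σ R → MvPowerSeries σ R) := by
  classical
  intro D₁ D₂ h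
  rw [← sub_eq_zero, ← MvPowerSeries.subst_sub (hasSubst_subst_X hg)] at h
  rw [← sub_eq_zero]
  generalize D₁ - D₂ = D at h
  by_contra hD
  have hne : {n : σ →₀ ℕ | MvPowerSeries.coeff n D ≠ 0}.Nonempty := by
    by_contra hempty
    rw [Set.not_nonempty_iff_eq_empty, Set.eq_empty_iff_forall_notMem] at hempty
    exact hD (MvPowerSeries.ext fun n => by simpa using hempty n)
  obtain ⟨n, hn, hmin⟩ := WellFounded.has_min
    (wellFounded_lt : WellFounded ((· < ·) : (σ →₀ ℕ) → (σ →₀ ℕ) → Prop)) _ hne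
  have hcoeff := congrArg (MvPowerSeries.coeff n) h
  rw [MvPowerSeries.coeff_subst (hasSubst_subst_X hg), finsum_eq_single _ n] at hcoeff
  · rw [(coeff_prod_subst_X hg n n).1 rfl, map_zero, smul_eq_mul] at hcoeff
    exact mul_ne_zero hn (pow_ne_zero _ hg1) hcoeff
  · intro d hd
    by_cases hdn : d ≤ n
    · have : MvPowerSeries.coeff d D = 0 := by
        by_contra h0
        exact hmin d h0 (lt_of_le_of_ne hdn hd)
      rw [this, zero_smul]
    · rw [(coeff_prod_subst_X hg d n).2 hdn, smul_zero]

lemma powerSeries_subst_injective [IsDomain R] {g : PowerSeries R}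
    (hg : PowerSeries.constantCoeff g = 0) (hg1 : PowerSeries.coeff 1 g ≠ 0) :
    Function.Injective (PowerSeries.subst g : PowerSeries R → PowerSeries R) := by
  have h := subst_injective (σ := Unit) hg hg1
  have h2 : (fun s : Unit => PowerSeries.subst (MvPowerSeries.X s : MvPowerSeries Unit R) g) =
      fun _ => g := by
    funext s
    exact PowerSeries.X_subst g
  rw [h2] at h
  exact h

end SubstInjective

section HomFactor

variable {O R : Type*} [CommRing O] [CommRing R] [Algebra O R] {G H H' : FormalModule O R}

lemma isHom_X (G : FormalModule O R) : G.IsHom G PowerSeries.X where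
  isHom_law :=
    { constantCoeff_eq_zero := PowerSeries.constantCoeff_X
      map_add := by
        rw [PowerSeries.subst_X (PowerSeries.HasSubst.of_constantCoeff_zero
          G.law.zero_constantCoeff)]
        have : (fun i : Fin 2 => PowerSeries.subst (MvPowerSeries.X i : MvPowerSeries (Fin 2) R)
            (PowerSeries.X : PowerSeries R)) = MvPowerSeries.X := by
          funext i
          exact PowerSeries.subst_X (PowerSeries.HasSubst.X i)
        rw [this, MvPowerSeries.subst_self]
        rfl }
  map_act a := by
    rw [PowerSeries.subst_X (PowerSeries.HasSubst.of_constantCoeff_zero'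
      (G.act_isHom a).constantCoeff_eq_zero), PowerSeries.X_subst]

/-- If `g` is a homomorphism with nonzero linear coefficient and `k ∘ g` is a homomorphism, then so
is `k`. -/
lemma isHom_of_isHom_subst [IsDomain R] {g k : PowerSeries R} (hg : G.IsHom H g)
    (hg1 : PowerSeries.coeff 1 g ≠ 0) (hk0 : PowerSeries.constantCoeff k = 0)
    (hk : G.IsHom H' (PowerSeries.subst g k)) : H.IsHom H' k := by
  have hg0 := hg.isHom_law.constantCoeff_eq_zero
  have hgs : PowerSeries.HasSubst g := PowerSeries.HasSubst.of_constantCoeff_zero' hg0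
  have hGs : PowerSeries.HasSubst G.law.toPowerSeries :=
    PowerSeries.HasSubst.of_constantCoeff_zero G.law.zero_constantCoeff
  have hHs : PowerSeries.HasSubst H.law.toPowerSeries :=
    PowerSeries.HasSubst.of_constantCoeff_zero H.law.zero_constantCoeff
  refine ⟨⟨hk0, subst_injective hg0 hg1 ?_⟩, fun a => powerSeries_subst_injective hg0 hg1 ?_⟩
  · have hγ := hasSubst_subst_X (σ := Fin 2) hg0
    have hL : MvPowerSeries.subst (fun i : Fin 2 =>
        PowerSeries.subst (MvPowerSeries.X i : MvPowerSeries (Fin 2) R) g)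
          (PowerSeries.subst H.law.toPowerSeries k) =
        PowerSeries.subst G.law.toPowerSeries (PowerSeries.subst g k) := by
      rw [PowerSeries.subst_comp_subst_apply hgs hGs, hg.isHom_law.map_add]
      exact MvPowerSeries.subst_comp_subst_apply hHs.const hγ k
    rw [hL, hk.isHom_law.map_add,
      MvPowerSeries.subst_comp_subst_apply (hasSubst_subst_X hk0) hγ]
    congr 1
    funext i
    rw [PowerSeries.subst_comp_subst_apply hgs (PowerSeries.HasSubst.X i)]
    refine Eq.trans ?_
      (MvPowerSeries.subst_comp_subst_apply (PowerSeries.HasSubst.X i).const hγ k).symm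
    rw [MvPowerSeries.subst_X hγ]
    rfl
  · have hact : PowerSeries.HasSubst (H.act a) :=
      PowerSeries.HasSubst.of_constantCoeff_zero' (H.act_isHom a).constantCoeff_eq_zero
    have hact' : PowerSeries.HasSubst (G.act a) :=
      PowerSeries.HasSubst.of_constantCoeff_zero' (G.act_isHom a).constantCoeff_eq_zero
    have hks : PowerSeries.HasSubst k := PowerSeries.HasSubst.of_constantCoeff_zero' hk0
    rw [PowerSeries.subst_comp_subst_apply hact hgs, ← hg.map_act,
      ← PowerSeries.subst_comp_subst_apply hgs hact', hk.map_act,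
      PowerSeries.subst_comp_subst_apply hks hgs]

end HomFactor

section Factor

variable {O : Type*} [CommRing O] {L : Type*} [NormedField L] [IsUltrametricDist L]
  [CompleteSpace L] [Algebra O (ValRing L)]
variable {C : Type*} [NormedField C] [IsUltrametricDist C] [NormedAlgebra L C] [CompleteSpace C]
  [IsAlgClosed C]
variable {G H H' : FormalModule O (ValRing L)} {f g : PowerSeries (ValRing L)} {ϖ : O}

lemma norm_algebraMap_valRing (x : ValRing L) : ‖algebraMap (ValRing L) (ValRing C) x‖ = ‖x‖ := by
  rw [← norm_coe_valRing, ← norm_coe_valRing]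
  exact norm_algebraMap' C (x : L)

lemma isUnit_algebraMap_valRing {x : ValRing L} :
    IsUnit (algebraMap (ValRing L) (ValRing C) x) ↔ IsUnit x := by
  rw [isUnit_valRing_iff, isUnit_valRing_iff, norm_algebraMap_valRing]

lemma algebraMap_valRing_injective :
    Function.Injective (algebraMap (ValRing L) (ValRing C)) := by
  rw [injective_iff_map_eq_zero]
  intro x hx
  rw [← norm_eq_zero, ← norm_algebraMap_valRing (C := C), hx, norm_zero]

variable (C) in
/-- A power series is invariant under translation by the kernel of `g`. -/
def KernelInvariant (hg : G.IsHom H g) (φ : PowerSeries (ValRing L)) : Prop :=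
  ∀ x z : Point C G, Point.map hg z = 0 → ev (x + z).val φ = ev x.val φ

/-- A series that is invariant under the kernel of an isogeny `g` is `φ (0) + g φ₁` with an
invariant series `φ₁`. -/
lemma KernelInvariant.exists_eq (hϖ0 : 0 < ‖algebraMap O (ValRing L) ϖ‖)
    (hϖ1 : ‖algebraMap O (ValRing L) ϖ‖ < 1) (hg : G.IsIsogeny H g) {φ : PowerSeries (ValRing L)}
    (hφ : KernelInvariant C hg.1 φ) : ∃ φ₁, KernelInvariant C hg.1 φ₁ ∧
      φ = PowerSeries.C (PowerSeries.constantCoeff φ) + g * φ₁ := by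
  classical
  rw [← norm_algebraMap_valRing (C := C)] at hϖ0 hϖ1
  obtain ⟨m, -, hm, hlt⟩ := Point.exists_first_unit (C := C) hg
  obtain ⟨s, hs, -, hcard⟩ := Point.exists_finset_ker hϖ0 hϖ1 hg
  have hcard := hcard m hm hlt
  rw [norm_algebraMap_valRing] at hϖ0 hϖ1
  obtain ⟨q, r, hr, hq⟩ := exists_weierstrass_division
    ⟨((algebraMap O (ValRing L) ϖ : ValRing L) : L), hϖ0, hϖ1⟩
    (isUnit_algebraMap_valRing.1 hm) (fun i hi => mt isUnit_algebraMap_valRing.2 (hlt i hi))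
    (φ - PowerSeries.C (PowerSeries.constantCoeff φ))
  have hφ0 : ev (0 : ValRing C) φ =
      algebraMap (ValRing L) (ValRing C) (PowerSeries.constantCoeff φ) := by
    have h := norm_ev_sub_leading_le (z := (0 : ValRing C)) (f := φ) (k := 0) (by simp) (by simp)
    rw [norm_zero, zero_add, pow_one, norm_le_zero_iff, sub_eq_zero, pow_zero, mul_one,
      PowerSeries.coeff_zero_eq_constantCoeff_apply] at h
    exact h
  -- the remainder vanishes at the points of the kernel, whose number exceeds its degree
  have hr0 : r = 0 := by
    rw [← Polynomial.map_eq_zero_iff (algebraMap_valRing_injective (L := L) (C := C))]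
    refine Polynomial.eq_zero_of_degree_lt_of_eval_finset_eq_zero (s.image Point.val) ?_ ?_
    · rw [Finset.card_image_of_injective _ (fun x y h => Point.ext h), hcard]
      exact Polynomial.degree_map_le.trans_lt hr
    · intro z hz
      obtain ⟨x, hx, rfl⟩ := Finset.mem_image.1 hz
      have hx0 := (hs x).1 hx
      have h := congrArg (ev x.val) hq
      have hgx : ev x.val g = 0 := by rw [← Point.map_val hg.1, hx0, Point.zero_val]
      have hφx := hφ 0 x hx0
      rw [zero_add, Point.zero_val, hφ0] at hφx
      rw [ev_sub x.norm_lt_one, ev_add x.norm_lt_one, ev_mul x.norm_lt_one, hgx, ev_C, ev_coe,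
        zero_mul, zero_add, hφx, sub_self] at h
      rw [Polynomial.eval_map_algebraMap, ← h]
  rw [hr0, Polynomial.coe_zero, add_zero] at hq
  rw [← norm_algebraMap_valRing (C := C)] at hϖ0 hϖ1
  have hq' : φ = PowerSeries.C (PowerSeries.constantCoeff φ) + g * q := by rw [← hq]; ring
  refine ⟨q, ?_, hq'⟩
  -- at points outside of the kernel one can divide by `g`
  have hgen : ∀ x z : Point C G, Point.map hg.1 z = 0 → Point.map hg.1 x ≠ 0 →
      ev (x + z).val q = ev x.val q := by
    intro x z hz hx
    have h := hφ x z hz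
    rw [hq', ev_add (Point.norm_lt_one _), ev_add (Point.norm_lt_one _),
      ev_mul (Point.norm_lt_one _), ev_mul (Point.norm_lt_one _), ev_C, ev_C, add_right_inj,
      ← Point.map_val hg.1, ← Point.map_val hg.1, map_add, hz, add_zero] at h
    exact mul_left_cancel₀ (mt Point.val_eq_zero.1 hx) h
  intro x z hz
  by_cases hx : Point.map hg.1 x = 0
  swap
  · exact hgen x z hz hx
  -- a point of the kernel is a limit of such points
  have hc := Point.coeff_one_ne_zero hϖ0 hϖ1 hg
  set c := algebraMap (ValRing L) (ValRing C) (PowerSeries.coeff 1 g) with hcdef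
  set p := algebraMap (ValRing L) (ValRing C) (algebraMap O (ValRing L) ϖ) with hp
  have hc0 : 0 < ‖c‖ := norm_pos_iff.2 hc
  have hsmall : ∀ j : ℕ, ‖ev (x + z).val q - ev x.val q‖ ≤ ‖p‖ ^ (j + 1) := by
    intro j
    have hy1 : ‖c * p ^ (j + 1)‖ < ‖c‖ := by
      rw [norm_mul, norm_pow]
      exact mul_lt_of_lt_one_right hc0 (pow_lt_one₀ hϖ0.le hϖ1 j.succ_ne_zero)
    let e : Point C G := ⟨c * p ^ (j + 1), hy1.trans_le (norm_valRing_le_one c)⟩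
    have he0 : e ≠ 0 := by
      rw [Ne, ← Point.val_eq_zero]
      exact mul_ne_zero hc (pow_ne_zero _ (norm_pos_iff.1 hϖ0))
    have he : Point.map hg.1 (e + x) ≠ 0 := by
      rw [map_add, hx, add_zero, Ne, ← Point.val_eq_zero, ← norm_eq_zero,
        Point.norm_map_of_norm_lt hg.1 hy1]
      exact mul_ne_zero hc0.ne' (norm_ne_zero_iff.2 (mt Point.val_eq_zero.1 he0))
    have hele : ‖e.val‖ ≤ ‖p‖ ^ (j + 1) := by
      change ‖c * p ^ (j + 1)‖ ≤ _
      rw [norm_mul, norm_pow]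
      exact mul_le_of_le_one_left (by positivity) (norm_valRing_le_one _)
    have h1 := norm_ev_sub_le (e + x + z).norm_lt_one (x + z).norm_lt_one q
    have h2 := norm_ev_sub_le (e + x).norm_lt_one x.norm_lt_one q
    rw [← Point.norm_sub_val, add_sub_add_right_eq_sub, add_sub_cancel_right] at h1
    rw [← Point.norm_sub_val, add_sub_cancel_right] at h2
    rw [hgen (e + x) z hz he, norm_sub_rev] at h1
    have h3 := IsUltrametricDist.norm_add_le_max (ev (x + z).val q - ev (e + x).val q)
      (ev (e + x).val q - ev x.val q)
    rw [sub_add_sub_cancel] at h3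
    exact h3.trans (max_le (h1.trans hele) (h2.trans hele))
  have hlim := ge_of_tendsto'
    ((tendsto_pow_atTop_nhds_zero_of_lt_one hϖ0.le hϖ1).comp (tendsto_add_atTop_nat 1)) hsmall
  exact sub_eq_zero.1 (norm_le_zero_iff.1 hlim)

/-- A homomorphism that vanishes on the kernel of an isogeny factors through the isogeny. -/
theorem exists_factor (hϖ0 : 0 < ‖algebraMap O (ValRing L) ϖ‖)
    (hϖ1 : ‖algebraMap O (ValRing L) ϖ‖ < 1) (hg : G.IsIsogeny H g) (hf : G.IsHom H' f)
    (hker : ∀ z : Point C G, Point.map hg.1 z = 0 → Point.map hf z = 0) :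
    ∃ k, H.IsHom H' k ∧ f = PowerSeries.subst g k := by
  have hg0 := hg.1.isHom_law.constantCoeff_eq_zero
  have hgs : PowerSeries.HasSubst g := PowerSeries.HasSubst.of_constantCoeff_zero' hg0
  have hf' : KernelInvariant C hg.1 f := fun x z hz => by
    rw [← Point.map_val hf, map_add, hker z hz, add_zero, Point.map_val]
  choose! next hnext hnext' using fun (φ : PowerSeries (ValRing L))
    (hφ : KernelInvariant C hg.1 φ) => hφ.exists_eq hϖ0 hϖ1 hg
  -- the expansion of `f` in powers of `g`
  let φ : ℕ → PowerSeries (ValRing L) := fun j => next^[j] f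
  have hφ : ∀ j, KernelInvariant C hg.1 (φ j) := fun j => by
    induction j with
    | zero => exact hf'
    | succ j ih =>
      rw [show φ (j + 1) = next (φ j) from Function.iterate_succ_apply' _ _ _]
      exact hnext _ ih
  let k : PowerSeries (ValRing L) := PowerSeries.mk fun j => PowerSeries.constantCoeff (φ j)
  have hexp : ∀ N, ∃ r, f - PowerSeries.subst g k = g ^ N * r := by
    suffices h : ∀ N, f - PowerSeries.subst g k = g ^ N * (φ N - PowerSeries.subst g
        (PowerSeries.mk fun j => PowerSeries.constantCoeff (φ (j + N)))) from fun N => ⟨_, h N⟩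
    intro N
    induction N with
    | zero => simp [φ, k]
    | succ N ih =>
      rw [ih, pow_succ, mul_assoc]
      congr 1
      have h1 : (PowerSeries.mk fun j => PowerSeries.constantCoeff (φ (j + N))) =
          PowerSeries.C (PowerSeries.constantCoeff (φ N)) + PowerSeries.X *
            PowerSeries.mk fun j => PowerSeries.constantCoeff (φ (j + (N + 1))) := by
        ext j
        rcases j with _ | j
        · simp
        · rw [map_add, PowerSeries.coeff_succ_X_mul, PowerSeries.coeff_mk, PowerSeries.coeff_mk,
            PowerSeries.coeff_C, if_neg j.succ_ne_zero, zero_add]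
          congr 3
          omega
      have h2 := hnext' (φ N) (hφ N)
      rw [show next (φ N) = φ (N + 1) from (Function.iterate_succ_apply' _ _ _).symm] at h2
      rw [h1, PowerSeries.subst_add hgs, PowerSeries.subst_mul hgs, PowerSeries.subst_X hgs,
        PowerSeries.subst_C]
      change φ N - (PowerSeries.C _ + _) = _
      linear_combination h2
  have hfk : f = PowerSeries.subst g k := by
    rw [← sub_eq_zero]
    ext i
    obtain ⟨r, hr⟩ := hexp (i + 1)
    have hdvd : (PowerSeries.X : PowerSeries (ValRing L)) ^ (i + 1) ∣
        f - PowerSeries.subst g k := by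
      rw [hr]
      exact (pow_dvd_pow_of_dvd (PowerSeries.X_dvd_iff.2 hg0) _).mul_right _
    rw [PowerSeries.X_pow_dvd_iff.1 hdvd i i.lt_succ_self, map_zero]
  refine ⟨k, isHom_of_isHom_subst hg.1 ?_ ?_ (hfk ▸ hf), hfk⟩
  · rw [← norm_algebraMap_valRing (C := C)] at hϖ0 hϖ1
    exact fun h => Point.coeff_one_ne_zero hϖ0 hϖ1 hg (by rw [h, map_zero])
  · rw [← PowerSeries.coeff_zero_eq_constantCoeff_apply, PowerSeries.coeff_mk]
    exact hf.isHom_law.constantCoeff_eq_zero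

/-- An isogeny with trivial kernel is an isomorphism. -/
theorem isIso_of_ker_eq_bot (hϖ0 : 0 < ‖algebraMap O (ValRing L) ϖ‖)
    (hϖ1 : ‖algebraMap O (ValRing L) ϖ‖ < 1) (hg : G.IsIsogeny H g)
    (hker : ∀ z : Point C G, Point.map hg.1 z = 0 → z = 0) : G.IsIso H g := by
  have hg0 := hg.1.isHom_law.constantCoeff_eq_zero
  have hgs : PowerSeries.HasSubst g := PowerSeries.HasSubst.of_constantCoeff_zero' hg0
  obtain ⟨k, hk, hkX⟩ := exists_factor (C := C) hϖ0 hϖ1 hg (isHom_X G) fun z hz => by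
    rw [hker z hz, map_zero]
  have hks : PowerSeries.HasSubst k :=
    PowerSeries.HasSubst.of_constantCoeff_zero' hk.isHom_law.constantCoeff_eq_zero
  refine ⟨hg.1, k, hk, hkX.symm, powerSeries_subst_injective hg0 ?_ ?_⟩
  · rw [← norm_algebraMap_valRing (C := C)] at hϖ0 hϖ1
    exact fun h => Point.coeff_one_ne_zero hϖ0 hϖ1 hg (by rw [h, map_zero])
  · rw [PowerSeries.subst_comp_subst_apply hks hgs, ← hkX, PowerSeries.X_subst,
      PowerSeries.subst_X hgs]

end Factor

/-! ### Degrees of finite submodules and semistability -/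

section Degree

variable {O M M' : Type*} [CommRing O] [AddCommGroup M] [Module O M] [AddCommGroup M'] [Module O M']

/-- The degree of a finite submodule `K`, with respect to a function `ν` such as the valuation on
the points of a formal group (with the value `0` at `0`): the sum of the values of `ν` on `K`. It is
`0` by convention if infinitely many of them are nonzero. -/
noncomputable def deg (ν : M → ℝ) (K : Submodule O M) : ℝ := ∑ᶠ x ∈ (K : Set M), ν x

lemma deg_eq_sum {ν : M → ℝ} {K : Submodule O M} {s : Finset M} (hs : ∀ x, x ∈ s ↔ x ∈ K) :
    deg ν K = ∑ x ∈ s, ν x := by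
  have : (K : Set M) = s := by
    ext x
    exact (hs x).symm
  rw [deg, this, finsum_mem_coe_finset]

lemma card_eq_card {K : Submodule O M} {s : Finset M} (hs : ∀ x, x ∈ s ↔ x ∈ K) :
    Nat.card K = s.card := by
  have : (K : Set M) = s := by
    ext x
    exact (hs x).symm
  exact (Nat.card_congr (Equiv.setCongr this)).trans
    (Nat.card_eq_fintype_card.trans (Fintype.card_coe s))

lemma exists_finset_mem_iff (K : Submodule O M) [Finite K] : ∃ s : Finset M, ∀ x, x ∈ s ↔ x ∈ K :=
  ⟨(Set.toFinite (K : Set M)).toFinset, fun x => by simp⟩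

lemma exists_finset_mem_iff_map {φ : M →ₗ[O] M'} {K : Submodule O M} {s : Finset M}
    (hs : ∀ x, x ∈ s ↔ x ∈ K) [DecidableEq M'] (w : M') : w ∈ s.image φ ↔ w ∈ K.map φ := by
  simp [hs]

/-- Summation along the fibres of a linear map. -/
lemma sum_comp_eq_card_mul (φ : M →ₗ[O] M') (h : M' → ℝ) (K : Submodule O M) [Finite K] :
    ∑ᶠ x ∈ (K : Set M), h (φ x) = Nat.card (K ⊓ LinearMap.ker φ : Submodule O M) *
      deg h (K.map φ) := by
  classical
  obtain ⟨s, hs⟩ := exists_finset_mem_iff K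
  have hK : (K : Set M) = s := by
    ext x
    exact (hs x).symm
  rw [hK, finsum_mem_coe_finset, deg_eq_sum (exists_finset_mem_iff_map hs), Finset.sum_comp,
    Finset.mul_sum]
  refine Finset.sum_congr rfl fun w hw => ?_
  obtain ⟨x, hx, rfl⟩ := Finset.mem_image.1 hw
  rw [nsmul_eq_mul]
  congr 2
  rw [card_eq_card (s := {a ∈ s | φ a = 0}) (fun y => by simp [hs])]
  refine Finset.card_bij' (fun a _ => a - x) (fun a _ => a + x) ?_ ?_ ?_ ?_
  · intro a ha
    rw [Finset.mem_filter, hs] at ha ⊢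
    exact ⟨K.sub_mem ha.1 ((hs x).1 hx), by rw [map_sub, ha.2, sub_self]⟩
  · intro a ha
    rw [Finset.mem_filter, hs] at ha ⊢
    exact ⟨K.add_mem ha.1 ((hs x).1 hx), by rw [map_add, ha.2, zero_add]⟩
  · intro a _
    exact sub_add_cancel _ _
  · intro a _
    exact add_sub_cancel_right _ _

lemma card_eq_mul_card_map (φ : M →ₗ[O] M') (K : Submodule O M) [Finite K] :
    (Nat.card K : ℝ) = Nat.card (K ⊓ LinearMap.ker φ : Submodule O M) * Nat.card (K.map φ) := by
  classical
  have h := sum_comp_eq_card_mul φ (fun _ => 1) K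
  obtain ⟨s, hs⟩ := exists_finset_mem_iff K
  have hK : (K : Set M) = s := by
    ext x
    exact (hs x).symm
  rw [hK, finsum_mem_coe_finset, deg_eq_sum (exists_finset_mem_iff_map hs)] at h
  rw [card_eq_card hs, card_eq_card (exists_finset_mem_iff_map (φ := φ) hs)]
  simpa using h

/-- The degree is additive: if `φ` is such that the value at each nonzero `w` is the sum of the
values at the preimages of `w`, and `K` contains the kernel of `φ`, then the degree of `K` is the
sum of the degrees of the kernel of `φ` and of the image of `K`. -/
lemma deg_eq_deg_ker_add_deg_map {ν : M → ℝ} {ν' : M' → ℝ} (hν'0 : ν' 0 = 0) (φ : M →ₗ[O] M')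
    (hν : ∀ (w : M') (s : Finset M), w ≠ 0 → (∀ y, y ∈ s ↔ φ y = w) → ν' w = ∑ y ∈ s, ν y)
    {K : Submodule O M} [Finite K] (hK : LinearMap.ker φ ≤ K) :
    deg ν K = deg ν (LinearMap.ker φ) + deg ν' (K.map φ) := by
  classical
  obtain ⟨s, hs⟩ := exists_finset_mem_iff K
  rw [deg_eq_sum hs, deg_eq_sum (exists_finset_mem_iff_map hs),
    deg_eq_sum (K := LinearMap.ker φ) (s := {a ∈ s | φ a = 0})
      (fun y => by simpa [hs] using fun h => hK h),
    ← Finset.sum_filter_add_sum_filter_not s (fun a => φ a = 0)]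
  congr 1
  rw [← Finset.sum_filter_add_sum_filter_not (s.image φ) (fun w => w = 0),
    Finset.sum_eq_zero (s := {w ∈ s.image φ | w = 0}), zero_add]
  · rw [← Finset.sum_fiberwise_of_maps_to (t := {w ∈ s.image φ | ¬ w = 0}) (g := φ)]
    · refine Finset.sum_congr rfl fun w hw => ?_
      rw [Finset.mem_filter] at hw
      refine (hν w _ hw.2 fun y => ?_).symm
      rw [Finset.mem_filter, Finset.mem_filter]
      refine ⟨fun h => h.2, fun h => ⟨⟨?_, h ▸ hw.2⟩, h⟩⟩
      obtain ⟨x, hx, hxw⟩ := Finset.mem_image.1 hw.1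
      have hyx : y - x ∈ K := hK (by rw [LinearMap.mem_ker, map_sub, h, hxw, sub_self])
      rw [hs] at hx ⊢
      exact (K.sub_mem_iff_left hx).1 hyx
    · intro y hy
      rw [Finset.mem_filter] at hy ⊢
      exact ⟨Finset.mem_image_of_mem _ hy.1, hy.2⟩
  · intro w hw
    rw [(Finset.mem_filter.1 hw).2, hν'0]

end Degree

section Semistable

variable {O M : Type*} [CommRing O] [AddCommGroup M] [Module O M]

/-- Semistability: if the slope inequality `n * deg W ≤ log_q |W|` holds for the submodules `W` of
the `ϖ`-torsion, of order `q ^ n`, and if the values of `ν` on torsion points are multiplied by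
`q ^ n` under multiplication by `ϖ`, then the slope inequality holds for all finite submodules,
and it can only be an equality for submodules that contain, or are contained in, the
`ϖ`-torsion. -/
theorem slope_le {ν : M → ℝ} {ϖ : O} {q n : ℕ} (hq : 1 < q) (hν0 : ν 0 = 0)
    (hpos : ∀ x, x ≠ 0 → 0 < ν x) [Finite (Submodule.torsionBy O M ϖ)]
    (hcard : Nat.card (Submodule.torsionBy O M ϖ) = q ^ n)
    (hslope : ∀ W : Submodule O M, W ≤ Submodule.torsionBy O M ϖ →
      n * deg ν W ≤ Real.logb q (Nat.card W))
    (hdiv : ∀ (K : Submodule O M) [Finite K], ∀ x ∈ K, ϖ • x ≠ 0 → ν (ϖ • x) = q ^ n * ν x)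
    (hnil : ∀ (K : Submodule O M) [Finite K], K ≠ ⊥ → ∃ x ∈ K, x ≠ 0 ∧ ϖ • x = 0)
    (K : Submodule O M) [Finite K] :
    n * deg ν K ≤ Real.logb q (Nat.card K) ∧
      (n * deg ν K = Real.logb q (Nat.card K) →
        Submodule.torsionBy O M ϖ ≤ K ∨ K ≤ Submodule.torsionBy O M ϖ) := by
  classical
  have hq0 : (0 : ℝ) < q := by exact_mod_cast zero_lt_one.trans hq
  have hdeg0 : ∀ (K : Submodule O M) [Finite K], 0 ≤ deg ν K ∧ (deg ν K = 0 → K = ⊥) := by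
    intro K _
    obtain ⟨s, hs⟩ := exists_finset_mem_iff K
    have h0 : ∀ x ∈ s, 0 ≤ ν x := fun x _ => by
      rcases eq_or_ne x 0 with rfl | hx
      exacts [hν0.ge, (hpos x hx).le]
    rw [deg_eq_sum hs]
    refine ⟨Finset.sum_nonneg h0, fun h => (Submodule.eq_bot_iff _).2 fun x hx => ?_⟩
    by_contra hx0
    exact (hpos x hx0).ne' ((Finset.sum_eq_zero_iff_of_nonneg h0).1 h x ((hs x).2 hx))
  have key : ∀ (N : ℕ) (K : Submodule O M) [Finite K], Nat.card K = N →
      n * deg ν K ≤ Real.logb q (Nat.card K) ∧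
      (n * deg ν K = Real.logb q (Nat.card K) →
        Submodule.torsionBy O M ϖ ≤ K ∨ K ≤ Submodule.torsionBy O M ϖ) := by
    intro N
    induction N using Nat.strong_induction_on with
    | _ N ih =>
    intro K _ hKN
    by_cases hKbot : K = ⊥
    · subst hKbot
      have h0 : deg ν (⊥ : Submodule O M) = 0 := by
        rw [deg_eq_sum (s := {0}) (by simp), Finset.sum_singleton, hν0]
      rw [h0]
      simp
    let m : M →ₗ[O] M := LinearMap.lsmul O M ϖ
    have hm : ∀ x, m x = ϖ • x := fun x => rfl
    have hker : LinearMap.ker m = Submodule.torsionBy O M ϖ := rfl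
    set K₁ : Submodule O M := K ⊓ LinearMap.ker m with hK₁
    have hfin₁ : Finite K₁ := Finite.Set.subset (K : Set M) (fun x hx => hx.1)
    have hfin₂ : Finite (K.map m) := Set.Finite.image m (Set.toFinite (K : Set M))
    have hcardmul := card_eq_mul_card_map m K
    rw [← hK₁] at hcardmul
    have hc₁ : (0 : ℝ) < Nat.card K₁ := by exact_mod_cast Nat.card_pos
    have hc₂ : (0 : ℝ) < Nat.card (K.map m) := by exact_mod_cast Nat.card_pos
    have hc₁le : Nat.card K₁ ≤ q ^ n := by
      rw [← hcard]
      exact Nat.card_le_card_of_injective (Submodule.inclusion (inf_le_right : K₁ ≤ _))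
        (Submodule.inclusion_injective _)
    -- the kernel of multiplication by `ϖ` on `K` is nontrivial, so that its image is smaller
    have hlt : Nat.card (K.map m) < N := by
      have h1 : 1 < Nat.card K₁ := by
        rw [Finite.one_lt_card_iff_nontrivial]
        obtain ⟨x, hx, hx0, hϖx⟩ := hnil K hKbot
        exact ⟨⟨⟨x, hx, hϖx⟩, 0, fun h => hx0 (congrArg Subtype.val h)⟩⟩
      have h2 : Nat.card K = Nat.card K₁ * Nat.card (K.map m) := by exact_mod_cast hcardmul
      have h3 : 0 < Nat.card (K.map m) := Nat.card_pos
      rw [← hKN, h2]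
      exact lt_mul_of_one_lt_left h3 h1
    obtain ⟨ih, -⟩ := ih _ hlt (K.map m) rfl
    have hsplit : deg ν K = deg ν K₁ + Nat.card K₁ / q ^ n * deg ν (K.map m) := by
      have h := sum_comp_eq_card_mul m ν K
      obtain ⟨s, hs⟩ := exists_finset_mem_iff K
      have hK : (K : Set M) = s := by
        ext x
        exact (hs x).symm
      rw [hK, finsum_mem_coe_finset, ← hK₁] at h
      rw [div_mul_eq_mul_div, ← h, deg_eq_sum hs,
        deg_eq_sum (K := K₁) (s := {a ∈ s | ϖ • a = 0}) (fun y => by simp [hs, hK₁, hm]),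
        Finset.sum_div, ← Finset.sum_filter_add_sum_filter_not s (fun a => ϖ • a = 0)]
      congr 1
      rw [← Finset.sum_filter_add_sum_filter_not s (fun a => ϖ • a = 0)
        (fun x => ν (m x) / q ^ n), Finset.sum_eq_zero (s := {a ∈ s | ϖ • a = 0}), zero_add]
      · refine Finset.sum_congr rfl fun x hx => ?_
        rw [Finset.mem_filter, hs] at hx
        rw [hm, hdiv K x hx.1 hx.2, mul_div_cancel_left₀ _ (by positivity)]
      · intro x hx
        rw [hm, (Finset.mem_filter.1 hx).2, hν0, zero_div]
    have hle1 : (Nat.card K₁ : ℝ) / q ^ n ≤ 1 := by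
      rw [div_le_one (by positivity)]
      exact_mod_cast hc₁le
    have hdm := hdeg0 (K.map m)
    have hs₁ := hslope K₁ inf_le_right
    rw [hcardmul, Real.logb_mul hc₁.ne' hc₂.ne', hsplit]
    have hn0 : (0 : ℝ) ≤ n := Nat.cast_nonneg n
    have h2 : n * (Nat.card K₁ / q ^ n * deg ν (K.map m)) ≤ n * deg ν (K.map m) :=
      mul_le_mul_of_nonneg_left (mul_le_of_le_one_left hdm.1 hle1) hn0
    refine ⟨by linarith, fun heq => ?_⟩
    have h3 : n * (Nat.card K₁ / q ^ n * deg ν (K.map m)) = n * deg ν (K.map m) := by linarith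
    rcases eq_or_ne (n : ℝ) 0 with hn | hn
    · left
      have hn' : n = 0 := by exact_mod_cast hn
      rw [hn', pow_zero, Nat.card_eq_one_iff_unique] at hcard
      intro x hx
      have := hcard.1
      have h0 : (⟨x, hx⟩ : Submodule.torsionBy O M ϖ) = 0 := Subsingleton.elim _ _
      rw [show x = 0 from congrArg Subtype.val h0]
      exact K.zero_mem
    have h4 : (Nat.card K₁ / q ^ n - 1) * deg ν (K.map m) = 0 := by
      have := mul_left_cancel₀ hn h3
      linarith
    rcases mul_eq_zero.1 h4 with h5 | h5
    · left
      have h6 : Nat.card K₁ = q ^ n := by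
        rw [sub_eq_zero, div_eq_one_iff_eq (by positivity)] at h5
        exact_mod_cast h5
      have h7 : (K₁ : Set M) = (Submodule.torsionBy O M ϖ : Set M) := by
        refine Set.eq_of_subset_of_ncard_le (fun x hx => hx.2) ?_
          (Set.toFinite (Submodule.torsionBy O M ϖ : Set M))
        exact (hcard.trans h6.symm).le
      intro x hx
      have h8 : x ∈ (K₁ : Set M) := by
        rw [h7]
        exact hx
      exact h8.1
    · right
      have h6 := hdm.2 h5
      intro x hx
      have h7 : m x ∈ K.map m := Submodule.mem_map_of_mem hx
      rw [h6, Submodule.mem_bot] at h7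
      exact h7
  exact key _ K rfl

end Semistable

/-! ### Formal modules in standard coordinates -/

section Convexity

/-- The function `r ↦ 1 - i / n + q ^ i r`, the valuation of `x_i T ^ (q ^ i)` at points of
valuation `r` when `v (x_i) = 1 - i / n`. -/
noncomputable def psi (q n i : ℕ) (r : ℝ) : ℝ := 1 - i / n + q ^ i * r

variable {q n i j : ℕ} {r : ℝ}

lemma psi_succ_sub (hn : 0 < n) : n * (psi q n (j + 1) r - psi q n j r) =
    n * (q - 1) * q ^ j * r - 1 := by
  have hn' : (n : ℝ) ≠ 0 := by positivity
  simp only [psi]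
  push_cast
  field_simp
  ring

/-- The sequence `i ↦ 1 - i / n + q ^ i r` is strictly convex, and its minimum is attained at `i`
for `r` in an interval that depends on `i`. -/
lemma psi_lt_psi (hq : 1 < q) (hn : 0 < n) (hr : 0 < r) (hj : j ≤ n)
    (hlo : i < n → 1 < n * (q - 1) * q ^ i * r) (hhi : 0 < i → n * (q - 1) * q ^ i * r < q)
    (hij : j ≠ i) : psi q n i r < psi q n j r := by
  have hn' : (0 : ℝ) < n := by positivity
  have hq' : (1 : ℝ) < q := by exact_mod_cast hq
  have hpos : 0 < n * ((q : ℝ) - 1) * r := by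
    have : (0 : ℝ) < q - 1 := by linarith
    positivity
  rcases lt_or_gt_of_ne hij with h | h
  · -- the sequence decreases up to the index `i`
    have hstep : ∀ k < i, psi q n (k + 1) r < psi q n k r := by
      intro k hk
      have h1 := psi_succ_sub (q := q) (j := k) (r := r) hn
      have h2 : (q : ℝ) ^ (k + 1) ≤ q ^ i := pow_le_pow_right₀ hq'.le hk
      have h3 := hhi (k.zero_le.trans_lt hk)
      have h4 : q * (n * ((q : ℝ) - 1) * q ^ k * r) < q * 1 := by
        calc q * (n * ((q : ℝ) - 1) * q ^ k * r) = q ^ (k + 1) * (n * ((q : ℝ) - 1) * r) := by ring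
          _ ≤ q ^ i * (n * ((q : ℝ) - 1) * r) := mul_le_mul_of_nonneg_right h2 hpos.le
          _ = n * (q - 1) * q ^ i * r := by ring
          _ < q * 1 := by linarith
      have h5 := lt_of_mul_lt_mul_left h4 (by linarith)
      nlinarith
    have hdesc : ∀ d k, k + (d + 1) = i → psi q n i r < psi q n k r := by
      intro d
      induction d with
      | zero =>
        rintro k rfl
        exact hstep k (by omega)
      | succ d ih =>
        intro k hk
        exact (ih (k + 1) (by omega)).trans (hstep k (by omega))
    exact hdesc (i - j - 1) j (by omega)
  · have hstep : ∀ k, i ≤ k → psi q n k r < psi q n (k + 1) r := by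
      intro k hk
      have h1 := psi_succ_sub (q := q) (j := k) (r := r) hn
      have h2 : (q : ℝ) ^ i ≤ q ^ k := pow_le_pow_right₀ hq'.le hk
      have h3 := hlo (by omega)
      have h4 : 1 < n * ((q : ℝ) - 1) * q ^ k * r := by
        calc 1 < n * ((q : ℝ) - 1) * q ^ i * r := h3
          _ = q ^ i * (n * ((q : ℝ) - 1) * r) := by ring
          _ ≤ q ^ k * (n * ((q : ℝ) - 1) * r) := mul_le_mul_of_nonneg_right h2 hpos.le
          _ = n * (q - 1) * q ^ k * r := by ring
      nlinarith
    have hasc : ∀ d, psi q n i r < psi q n (i + (d + 1)) r := by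
      intro d
      induction d with
      | zero => exact hstep i le_rfl
      | succ d ih => exact ih.trans (hstep _ (by omega))
    have := hasc (j - i - 1)
    rwa [show i + (j - i - 1 + 1) = j by omega] at this

end Convexity

section PowerCard

/-- Submodules of the `ϖ`-torsion are vector spaces over the residue field. -/
lemma exists_card_eq_pow {O M : Type*} [CommRing O] [IsLocalRing O] [AddCommGroup M] [Module O M]
    {ϖ : O} (hϖ : IsLocalRing.maximalIdeal O = Ideal.span {ϖ}) (W : Submodule O M) [Finite W]
    (hW : W ≤ Submodule.torsionBy O M ϖ) :
    ∃ m, Nat.card W = Nat.card (IsLocalRing.ResidueField O) ^ m := by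
  have htor : Module.IsTorsionBySet O W (IsLocalRing.maximalIdeal O) := by
    rw [hϖ]
    rintro x ⟨a, ha⟩
    obtain ⟨b, rfl⟩ := Ideal.mem_span_singleton'.1 ha
    ext
    change (b * ϖ) • (x : M) = 0
    rw [mul_smul, (Submodule.mem_torsionBy_iff _ _).1 (hW x.2), smul_zero]
  let : Module (IsLocalRing.ResidueField O) W := htor.module
  have : Module.Finite (IsLocalRing.ResidueField O) W := Module.Finite.of_finite
  exact ⟨_, Module.natCard_eq_pow_finrank (K := IsLocalRing.ResidueField O) (V := W)⟩

end PowerCard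

section Standard

variable {O : Type*} [CommRing O] {L : Type*} [NormedField L] [IsUltrametricDist L]
  [CompleteSpace L] [Algebra O (ValRing L)]
variable {C : Type*} [NormedField C] [IsUltrametricDist C] [NormedAlgebra L C] [CompleteSpace C]
  [IsAlgClosed C]

/-- Multiplication by `ϖ` on `G` is `a_0 u_0 T + a_1 u_1 T ^ q + ⋯ + a_n u_n T ^ (q ^ n)` with units
`u_i`, with `a_0 = ϖ`, with `a_1, …, a_{n-1}` in the maximal ideal, and with `a_n = 1`. -/
structure IsStandard (G : FormalModule O (ValRing L)) (ϖ : O) (q n : ℕ) (a : ℕ → ValRing L) :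
    Prop where
  one_lt : 1 < q
  pos : 0 < n
  norm_pos : 0 < ‖algebraMap O (ValRing L) ϖ‖
  zero_eq : a 0 = algebraMap O (ValRing L) ϖ
  last_eq : a n = 1
  norm_lt_one : ∀ i < n, ‖a i‖ < 1
  exists_units : ∃ u : ℕ → PowerSeries (ValRing L), (∀ i, IsUnit (u i)) ∧
    G.act ϖ = ∑ i ∈ Finset.range (n + 1), PowerSeries.C (a i) * u i * PowerSeries.X ^ (q ^ i)

variable {G : FormalModule O (ValRing L)} {ϖ : O} {q n : ℕ} {a : ℕ → ValRing L}

lemma isHom_act {R : Type*} [CommRing R] [Algebra O R] (G : FormalModule O R) (b : O) :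
    G.IsHom G (G.act b) :=
  ⟨G.act_isHom b, fun a => by rw [← G.act_mul, ← G.act_mul, mul_comm]⟩

namespace IsStandard

lemma norm_lt (h : IsStandard G ϖ q n a) : ‖algebraMap O (ValRing L) ϖ‖ < 1 :=
  h.zero_eq ▸ h.norm_lt_one 0 h.pos

lemma coeff_act (h : IsStandard G ϖ q n a) :
    IsUnit (PowerSeries.coeff (q ^ n) (G.act ϖ)) ∧
      ∀ k < q ^ n, ¬ IsUnit (PowerSeries.coeff k (G.act ϖ)) := by
  obtain ⟨u, hu, hact⟩ := h.exists_units
  have hlow : ∀ k, PowerSeries.coeff k (∑ i ∈ Finset.range n,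
      PowerSeries.C (a i) * u i * PowerSeries.X ^ (q ^ i)) ∈
        IsLocalRing.maximalIdeal (ValRing L) := by
    intro k
    rw [map_sum]
    refine Ideal.sum_mem _ fun i hi => ?_
    rw [mul_assoc, PowerSeries.coeff_C_mul]
    exact Ideal.mul_mem_right _ _
      (mem_maximalIdeal_valRing_iff.2 (h.norm_lt_one i (Finset.mem_range.1 hi)))
  have hlast : ∀ k, PowerSeries.coeff k (PowerSeries.C (a n) * u n * PowerSeries.X ^ (q ^ n)) =
      if q ^ n ≤ k then PowerSeries.coeff (k - q ^ n) (u n) else 0 := by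
    intro k
    rw [h.last_eq, map_one, one_mul, PowerSeries.coeff_mul_X_pow']
  refine ⟨?_, fun k hk => ?_⟩
  · rw [hact, Finset.sum_range_succ, map_add, hlast, if_pos le_rfl, Nat.sub_self,
      PowerSeries.coeff_zero_eq_constantCoeff_apply]
    have h1 := PowerSeries.isUnit_iff_constantCoeff.1 (hu n)
    by_contra h2
    have h3 : _ ∈ IsLocalRing.maximalIdeal (ValRing L) := h2
    exact ((Ideal.add_mem_iff_right _ (hlow _)).1 h3) h1
  · rw [hact, Finset.sum_range_succ, map_add, hlast, if_neg hk.not_ge, add_zero]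
    exact hlow k

lemma isIsogeny (h : IsStandard G ϖ q n a) : G.IsIsogeny G (G.act ϖ) :=
  ⟨isHom_act G ϖ, _, h.coeff_act.1⟩

lemma norm_pos' (h : IsStandard G ϖ q n a) :
    0 < ‖algebraMap (ValRing L) (ValRing C) (algebraMap O (ValRing L) ϖ)‖ := by
  rw [norm_algebraMap_valRing]
  exact h.norm_pos

lemma norm_lt' (h : IsStandard G ϖ q n a) :
    ‖algebraMap (ValRing L) (ValRing C) (algebraMap O (ValRing L) ϖ)‖ < 1 := by
  rw [norm_algebraMap_valRing]
  exact h.norm_lt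

/-- The `ϖ`-torsion has order `q ^ n`. -/
lemma exists_finset_torsion (h : IsStandard G ϖ q n a) :
    ∃ s : Finset (Point C G), (∀ x, x ∈ s ↔ x ∈ Submodule.torsionBy O (Point C G) ϖ) ∧
      (∀ y : Point C G, ‖(ϖ • y).val‖ = ∏ k ∈ s, ‖y.val - k.val‖) ∧ s.card = q ^ n := by
  obtain ⟨s, hs, hs', hcard⟩ := Point.exists_finset_ker (C := C) h.norm_pos' h.norm_lt' h.isIsogeny
  refine ⟨s, hs, hs', hcard _ (h.coeff_act.1.map _) fun i hi => ?_⟩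
  rw [isUnit_algebraMap_valRing]
  exact h.coeff_act.2 i hi

lemma finite_torsion (h : IsStandard G ϖ q n a) :
    Finite (Submodule.torsionBy O (Point C G) ϖ) := by
  obtain ⟨s, hs, -⟩ := h.exists_finset_torsion (C := C)
  exact Set.Finite.subset s.finite_toSet fun x hx => (hs x).2 hx

lemma card_torsion (h : IsStandard G ϖ q n a) :
    Nat.card (Submodule.torsionBy O (Point C G) ϖ) = q ^ n := by
  obtain ⟨s, hs, -, hcard⟩ := h.exists_finset_torsion (C := C)
  rw [card_eq_card hs, hcard]

end IsStandard

/-- The additive valuation of a point, normalized by the valuation of an element of norm `t`. The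
value at `0` is the junk value `0`, so that `0` does not contribute to sums. -/
noncomputable def nu (t : ℝ) (x : Point C G) : ℝ := Real.log ‖x.val‖ / Real.log t

section Nu

variable {t : ℝ} {x y : Point C G}

lemma nu_zero : nu t (0 : Point C G) = 0 := by simp [nu, Point.zero_val]

lemma norm_val_pos (hx : x ≠ 0) : 0 < ‖x.val‖ := norm_pos_iff.2 (mt Point.val_eq_zero.1 hx)

lemma norm_eq_rpow_nu (ht0 : 0 < t) (ht1 : t < 1) (hx : x ≠ 0) : ‖x.val‖ = t ^ nu t x := by
  rw [nu, Real.rpow_def_of_pos ht0, mul_div_cancel₀ _ (Real.log_neg ht0 ht1).ne,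
    Real.exp_log (norm_val_pos hx)]

lemma nu_eq_of_norm_eq (ht0 : 0 < t) (ht1 : t < 1) {r : ℝ} (hx : ‖x.val‖ = t ^ r) :
    nu t x = r := by
  rw [nu, hx, Real.log_rpow ht0, mul_div_cancel_right₀ _ (Real.log_neg ht0 ht1).ne]

lemma nu_pos (ht0 : 0 < t) (ht1 : t < 1) (hx : x ≠ 0) : 0 < nu t x :=
  div_pos_of_neg_of_neg (Real.log_neg (norm_val_pos hx) x.norm_lt_one) (Real.log_neg ht0 ht1)

end Nu

lemma rpow_le_rpow_iff_of_lt_one {t : ℝ} (ht0 : 0 < t) (ht1 : t < 1) {r s : ℝ} :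
    t ^ r ≤ t ^ s ↔ s ≤ r := Real.rpow_le_rpow_left_iff_of_base_lt_one ht0 ht1

end Standard

/-! ### The Newton polygon of multiplication by the uniformizer -/

section Standard

variable {O : Type*} [CommRing O] {L : Type*} [NormedField L] [IsUltrametricDist L]
  [CompleteSpace L] [Algebra O (ValRing L)]
variable {C : Type*} [NormedField C] [IsUltrametricDist C] [NormedAlgebra L C] [CompleteSpace C]
  [IsAlgClosed C]
variable {G : FormalModule O (ValRing L)} {ϖ : O} {q n : ℕ} {a : ℕ → ValRing L}

namespace IsStandard

/-- The value of `[ϖ]` at a point as the sum of its terms. -/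
lemma exists_smul_val_eq_sum (h : IsStandard G ϖ q n a) {t : ℝ}
    (ht : t = ‖algebraMap O (ValRing L) ϖ‖) {r : ℝ} {y : Point C G} (hy : ‖y.val‖ = t ^ r) :
    ∃ c : ℕ → ValRing C, (∀ j, ‖c j‖ = ‖a j‖ * t ^ (q ^ j * r : ℝ)) ∧
      (ϖ • y).val = ∑ j ∈ Finset.range (n + 1), c j := by
  have ht0 : 0 < t := ht ▸ h.norm_pos
  obtain ⟨u, hu, hact⟩ := h.exists_units
  refine ⟨fun j => algebraMap (ValRing L) (ValRing C) (a j) * ev y.val (u j) * y.val ^ q ^ j,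
    fun j => ?_, ?_⟩
  · rw [norm_mul, norm_mul, norm_pow, norm_algebraMap_valRing,
      norm_ev_of_isUnit y.norm_lt_one (hu j), mul_one, hy, mul_comm ((q : ℝ) ^ j) r,
      Real.rpow_mul ht0.le]
    congr 1
    rw [← Real.rpow_natCast]
    norm_cast
  · rw [Point.smul_val, hact, ev_sum y.norm_lt_one]
    refine Finset.sum_congr rfl fun j _ => ?_
    rw [ev_mul y.norm_lt_one, ev_mul y.norm_lt_one, ev_C, ev_pow y.norm_lt_one, ev_X]

/-- In the valuation range where the `i`-th term of `[ϖ]` dominates for the points of the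
fundamental domain, `[ϖ]` is approximated by this term. -/
lemma exists_norm_smul_sub_lt (h : IsStandard G ϖ q n a) {t : ℝ}
    (ht : t = ‖algebraMap O (ValRing L) ϖ‖) {B : ℝ} (hB : 0 < B)
    (ha : ∀ j ≤ n, ‖a j‖ ≤ B * t ^ (1 - j / n : ℝ)) {i : ℕ} (hi : i ≤ n) {r : ℝ} (hr : 0 < r)
    (hlo : i < n → 1 < n * (q - 1) * q ^ i * r) (hhi : 0 < i → n * (q - 1) * q ^ i * r < q)
    {y : Point C G} (hy : ‖y.val‖ = t ^ r) :
    ∃ c : ValRing C, ‖c‖ = ‖a i‖ * t ^ (q ^ i * r : ℝ) ∧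
      ‖(ϖ • y).val - c‖ < B * t ^ psi q n i r := by
  have ht0 : 0 < t := ht ▸ h.norm_pos
  have ht1 : t < 1 := ht ▸ h.norm_lt
  obtain ⟨c, hc, hsum⟩ := h.exists_smul_val_eq_sum ht hy
  refine ⟨c i, hc i, ?_⟩
  rw [hsum, ← Finset.add_sum_erase _ _ (Finset.mem_range.2 (Nat.lt_succ_of_le hi)),
    add_sub_cancel_left]
  obtain ⟨j, hj, hle⟩ := IsUltrametricDist.exists_norm_finsetSum_le
    ((Finset.range (n + 1)).erase i) c
  rcases ((Finset.range (n + 1)).erase i).eq_empty_or_nonempty with hemp | hne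
  · rw [hemp, Finset.sum_empty, norm_zero]
    positivity
  refine hle.trans_lt ?_
  have hj' := hj hne
  rw [Finset.mem_erase, Finset.mem_range] at hj'
  have hjn : j ≤ n := by omega
  rw [hc]
  calc ‖a j‖ * t ^ (q ^ j * r : ℝ) ≤ B * t ^ (1 - j / n : ℝ) * t ^ (q ^ j * r : ℝ) :=
        mul_le_mul_of_nonneg_right (ha j hjn) (by positivity)
    _ = B * t ^ psi q n j r := by rw [mul_assoc, ← Real.rpow_add ht0, psi]
    _ < B * t ^ psi q n i r := mul_lt_mul_of_pos_left
        (Real.rpow_lt_rpow_of_exponent_gt ht0 ht1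
          (psi_lt_psi h.one_lt h.pos hr hjn hlo hhi hj'.1)) hB

/-- There are points with valuation in any given interval and outside of any given finite set. -/
lemma exists_point (h : IsStandard G ϖ q n a) {t : ℝ} (ht : t = ‖algebraMap O (ValRing L) ϖ‖)
    {b c : ℝ} (hb : 0 ≤ b) (hbc : b < c) {A : Set ℝ} (hA : A.Finite) :
    ∃ (r : ℝ) (y : Point C G), b < r ∧ r < c ∧ r ∉ A ∧ ‖y.val‖ = t ^ r := by
  have ht0 : 0 < t := ht ▸ h.norm_pos
  have ht1 : t < 1 := ht ▸ h.norm_lt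
  have hopen : IsOpen (Set.Ioo b c \ A) := isOpen_Ioo.sdiff hA.isClosed
  obtain ⟨ρ, hρ⟩ := Rat.denseRange_cast.exists_mem_open hopen
    ((Set.Ioo_infinite hbc).sdiff hA).nonempty
  have hρ0 : (0 : ℝ) < ρ := hb.trans_lt hρ.1.1
  have hρ0' : 0 < ρ := by exact_mod_cast hρ0
  set p : ValRing C := algebraMap (ValRing L) (ValRing C) (algebraMap O (ValRing L) ϖ) with hp
  have hpt : ‖(p : C)‖ = t := by rw [norm_coe_valRing, hp, norm_algebraMap_valRing, ht]
  obtain ⟨z, hz⟩ := IsAlgClosed.exists_pow_nat_eq ((p : C) ^ ρ.num.toNat) ρ.den_pos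
  have hnum : ((ρ.num.toNat : ℕ) : ℝ) = ρ * ρ.den := by
    have h1 : ((ρ.num.toNat : ℤ) : ℚ) = ρ * ρ.den := by
      rw [Int.toNat_of_nonneg (Rat.num_pos.2 hρ0').le, Rat.mul_den_eq_num]
    exact_mod_cast h1
  have hznorm : ‖z‖ = t ^ (ρ : ℝ) := by
    have h1 : ‖z‖ ^ ρ.den = (t ^ (ρ : ℝ)) ^ ρ.den := by
      rw [← norm_pow, hz, norm_pow, hpt, ← Real.rpow_natCast, ← Real.rpow_natCast (t ^ (ρ : ℝ)),
        ← Real.rpow_mul ht0.le, hnum]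
    exact (pow_left_inj₀ (norm_nonneg z) (by positivity) ρ.den_pos.ne').1 h1
  have hz1 : ‖z‖ < 1 := hznorm ▸ Real.rpow_lt_one ht0.le ht1 hρ0
  exact ⟨ρ, ⟨⟨z, mem_valRing_iff.2 hz1.le⟩, hz1⟩, hρ.1.1, hρ.1.2, hρ.2, hznorm⟩

/-- The product of the nonzero points of the `ϖ`-torsion is `ϖ`, up to a unit. -/
lemma deg_torsion (h : IsStandard G ϖ q n a) {t : ℝ} (ht : t = ‖algebraMap O (ValRing L) ϖ‖) :
    deg (nu t) (Submodule.torsionBy O (Point C G) ϖ) = 1 := by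
  classical
  have ht0 : 0 < t := ht ▸ h.norm_pos
  have ht1 : t < 1 := ht ▸ h.norm_lt
  obtain ⟨s, hs, hprod, -⟩ := h.exists_finset_torsion (C := C)
  -- compare the linear term of `[ϖ]` with the product formula at a small point `y`
  obtain ⟨r₀, hr₀⟩ : ∃ r₀ : ℝ, ∀ k ∈ s, nu t k ≤ r₀ := by
    obtain ⟨r₀, hr₀⟩ := (s.image (nu t)).bddAbove
    exact ⟨r₀, fun k hk => hr₀ (by simpa using ⟨k, hk, rfl⟩)⟩
  obtain ⟨r, y, hr1, -, -, hy⟩ := h.exists_point (C := C) (G := G) ht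
    (b := max r₀ 1) (c := max r₀ 1 + 1) (by positivity) (by linarith) Set.finite_empty
  have hyk : ∀ k ∈ s.erase 0, ‖y.val - k.val‖ = ‖k.val‖ := by
    intro k hk
    rw [Finset.mem_erase] at hk
    have hlt : ‖y.val‖ < ‖k.val‖ := by
      rw [hy, norm_eq_rpow_nu ht0 ht1 hk.1]
      exact Real.rpow_lt_rpow_of_exponent_gt ht0 ht1
        ((hr₀ k hk.2).trans_lt ((le_max_left _ _).trans_lt hr1))
    rw [norm_sub_rev, sub_eq_add_neg, IsUltrametricDist.norm_add_eq_max_of_norm_ne_norm, norm_neg,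
      max_eq_left hlt.le]
    rw [norm_neg]
    exact hlt.ne'
  have hyt : ‖y.val‖ < ‖algebraMap (ValRing L) (ValRing C) (algebraMap O (ValRing L) ϖ)‖ := by
    rw [norm_algebraMap_valRing, ← ht, hy]
    conv_rhs => rw [← Real.rpow_one t]
    exact Real.rpow_lt_rpow_of_exponent_gt ht0 ht1 ((le_max_right _ _).trans_lt hr1)
  have hy0 : 0 < ‖y.val‖ := by rw [hy]; positivity
  have h0 : (0 : Point C G) ∈ s := (hs 0).2 (Submodule.zero_mem _)
  have hval := hprod y
  rw [Point.norm_smul_of_norm_lt hyt, norm_algebraMap_valRing, ← ht, ← Finset.mul_prod_erase _ _ h0,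
    Point.zero_val, sub_zero, Finset.prod_congr rfl hyk, mul_comm] at hval
  have hval' := mul_left_cancel₀ hy0.ne' hval
  rw [deg_eq_sum hs, ← Finset.add_sum_erase _ _ h0, nu_zero, zero_add]
  simp only [nu]
  rw [← Finset.sum_div, ← Real.log_prod, ← hval', div_self (Real.log_neg ht0 ht1).ne]
  intro k hk
  exact (norm_val_pos (Finset.ne_of_mem_erase hk)).ne'

/-- The value of `[ϖ]` at a point whose valuation `r` is not that of a torsion point, in terms of
the submodule `S` of torsion points of valuation `> r`. -/
lemma exists_norm_smul_eq (h : IsStandard G ϖ q n a) {t : ℝ}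
    (ht : t = ‖algebraMap O (ValRing L) ϖ‖) {r : ℝ} {y : Point C G} (hy : ‖y.val‖ = t ^ r)
    (hgen : ∀ k ∈ Submodule.torsionBy O (Point C G) ϖ, k ≠ 0 → nu t k ≠ r) :
    ∃ S ≤ Submodule.torsionBy O (Point C G) ϖ,
      (∀ k ∈ Submodule.torsionBy O (Point C G) ϖ, k ∈ S ↔ k = 0 ∨ r < nu t k) ∧
      ‖(ϖ • y).val‖ = t ^ (Nat.card S * r + 1 - deg (nu t) S) := by
  classical
  have ht0 : 0 < t := ht ▸ h.norm_pos
  have ht1 : t < 1 := ht ▸ h.norm_lt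
  obtain ⟨s, hs, hprod, -⟩ := h.exists_finset_torsion (C := C)
  let S : Submodule O (Point C G) :=
    Submodule.torsionBy O (Point C G) ϖ ⊓ Point.ball G (norm_nonneg y.val)
  have hS : ∀ k ∈ Submodule.torsionBy O (Point C G) ϖ, k ∈ S ↔ k = 0 ∨ r < nu t k := by
    intro k hk
    have h1 : k ∈ S ↔ ‖k.val‖ ≤ ‖y.val‖ := ⟨fun h => h.2, fun h => ⟨hk, h⟩⟩
    rw [h1]
    rcases eq_or_ne k 0 with rfl | hk0
    · simp [Point.zero_val]
    · rw [norm_eq_rpow_nu ht0 ht1 hk0, hy, rpow_le_rpow_iff_of_lt_one ht0 ht1]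
      exact ⟨fun h => Or.inr (lt_of_le_of_ne h (hgen k hk hk0).symm),
        fun h => (h.resolve_left hk0).le⟩
  refine ⟨S, inf_le_left, hS, ?_⟩
  have hsS : ∀ k, k ∈ s.filter (· ∈ S) ↔ k ∈ S := by
    intro k
    rw [Finset.mem_filter, hs]
    exact ⟨fun h => h.2, fun h => ⟨h.1, h⟩⟩
  have hdeg : deg (nu t) S + ∑ k ∈ s.filter (· ∉ S), nu t k = 1 := by
    rw [deg_eq_sum hsS, Finset.sum_filter_add_sum_filter_not, ← deg_eq_sum hs, h.deg_torsion ht]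
  have hin : ∀ k ∈ s.filter (· ∈ S), ‖y.val - k.val‖ = t ^ r := by
    intro k hk
    rw [Finset.mem_filter, hs] at hk
    rw [← hy]
    have hlt : ‖k.val‖ < ‖y.val‖ := by
      rcases ((hS k hk.1).1 hk.2) with rfl | hlt
      · rw [Point.zero_val, norm_zero, hy]
        positivity
      · have hk0 : k ≠ 0 := by
          rintro rfl
          rw [nu_zero] at hlt
          have := y.norm_lt_one
          rw [hy] at this
          exact this.not_ge (Real.one_le_rpow_of_pos_of_le_one_of_nonpos ht0 ht1.le hlt.le)
        rw [norm_eq_rpow_nu ht0 ht1 hk0, hy]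
        exact Real.rpow_lt_rpow_of_exponent_gt ht0 ht1 hlt
    rw [sub_eq_add_neg, IsUltrametricDist.norm_add_eq_max_of_norm_ne_norm, norm_neg,
      max_eq_left hlt.le]
    rw [norm_neg]
    exact hlt.ne'
  have hout : ∀ k ∈ s.filter (· ∉ S), ‖y.val - k.val‖ = t ^ nu t k := by
    intro k hk
    rw [Finset.mem_filter, hs] at hk
    have hk1 := mt (hS k hk.1).2 hk.2
    push Not at hk1
    rw [← norm_eq_rpow_nu ht0 ht1 hk1.1]
    have hlt : ‖y.val‖ < ‖k.val‖ := by
      rw [norm_eq_rpow_nu ht0 ht1 hk1.1, hy]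
      exact Real.rpow_lt_rpow_of_exponent_gt ht0 ht1
        (lt_of_le_of_ne hk1.2 (hgen k hk.1 hk1.1))
    rw [norm_sub_rev, sub_eq_add_neg, IsUltrametricDist.norm_add_eq_max_of_norm_ne_norm, norm_neg,
      max_eq_left hlt.le]
    rw [norm_neg]
    exact hlt.ne'
  rw [hprod, ← Finset.prod_filter_mul_prod_filter_not s (· ∈ S), Finset.prod_congr rfl hin,
    Finset.prod_congr rfl hout, Finset.prod_const, ← card_eq_card hsS,
    ← Real.rpow_sum_of_pos ht0, ← Real.rpow_natCast, ← Real.rpow_mul ht0.le, ← Real.rpow_add ht0]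
  congr 1
  linear_combination hdeg

/-- For each `i` there is a point `y` at which the `i`-th term of `[ϖ]` dominates for the points of
the fundamental domain, and whose valuation is not that of a torsion point. -/
lemma exists_generic_point (h : IsStandard G ϖ q n a) {t : ℝ}
    (ht : t = ‖algebraMap O (ValRing L) ϖ‖) (i : ℕ) :
    ∃ (r : ℝ) (y : Point C G), 0 < r ∧ 1 < n * (q - 1) * q ^ i * r ∧
      n * (q - 1) * q ^ i * r < q ∧ ‖y.val‖ = t ^ r ∧
      ∀ k ∈ Submodule.torsionBy O (Point C G) ϖ, k ≠ 0 → nu t k ≠ r := by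
  have hq : (1 : ℝ) < q := by exact_mod_cast h.one_lt
  have hn : (0 : ℝ) < n := by exact_mod_cast h.pos
  have hpos : 0 < n * ((q : ℝ) - 1) * q ^ i := by
    have : (0 : ℝ) < q - 1 := by linarith
    positivity
  have := h.finite_torsion (C := C)
  obtain ⟨r, y, hr1, hr2, hrA, hy⟩ := h.exists_point (C := C) (G := G) ht
    (b := 1 / (n * ((q : ℝ) - 1) * q ^ i)) (c := q / (n * ((q : ℝ) - 1) * q ^ i)) (by positivity)
    (div_lt_div_of_pos_right hq hpos)
    ((Set.toFinite (Submodule.torsionBy O (Point C G) ϖ : Set (Point C G))).image (nu t))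
  refine ⟨r, y, lt_trans (by positivity) hr1, ?_, ?_, hy, fun k hk _ hkr =>
    hrA ⟨k, hk, hkr⟩⟩
  · rw [div_lt_iff₀ hpos] at hr1
    linarith
  · rw [lt_div_iff₀ hpos] at hr2
    linarith

end IsStandard

end Standard

/-! ### The fundamental domain and semistability -/

section Largest

variable {O M : Type*} [CommRing O] [AddCommGroup M] [Module O M]

/-- Among the submodules `W` of `T`, the one made of the elements with `ν > r` maximizes
`deg W - r |W|`. -/
lemma deg_sub_card_mul_le {ν : M → ℝ} {r : ℝ} {T W S : Submodule O M} [Finite T] (hW : W ≤ T)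
    (hST : S ≤ T) (hS : ∀ k ∈ T, k ∈ S ↔ k = 0 ∨ r < ν k) (hr : ∀ k ∈ T, k ≠ 0 → ν k ≠ r) :
    deg ν W - Nat.card W * r ≤ deg ν S - Nat.card S * r ∧
      (deg ν W - Nat.card W * r = deg ν S - Nat.card S * r → W = S) := by
  classical
  obtain ⟨s, hs⟩ := exists_finset_mem_iff T
  have hsum : ∀ V ≤ T, deg ν V - Nat.card V * r = ∑ k ∈ s, if k ∈ V then ν k - r else 0 := by
    intro V hV
    have hsV : ∀ k, k ∈ s.filter (· ∈ V) ↔ k ∈ V := by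
      intro k
      rw [Finset.mem_filter, hs]
      exact ⟨fun h => h.2, fun h => ⟨hV h, h⟩⟩
    rw [deg_eq_sum hsV, card_eq_card hsV, ← Finset.sum_filter, Finset.sum_sub_distrib,
      Finset.sum_const, nsmul_eq_mul]
  have hterm : ∀ k ∈ s, (if k ∈ W then ν k - r else 0) ≤ (if k ∈ S then ν k - r else 0) ∧
      ((if k ∈ W then ν k - r else 0) = (if k ∈ S then ν k - r else 0) → (k ∈ W ↔ k ∈ S)) := by
    intro k hk
    rw [hs] at hk
    rcases eq_or_ne k 0 with rfl | hk0
    · simp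
    have hSk : k ∈ S ↔ r < ν k := by rw [hS k hk, or_iff_right hk0]
    rcases lt_or_gt_of_ne (hr k hk hk0) with hlt | hlt
    · have h1 : k ∉ S := fun h => hlt.not_gt (hSk.1 h)
      by_cases hkW : k ∈ W
      · simp only [hkW, h1, if_true, if_false]
        exact ⟨by linarith, fun h => by linarith⟩
      · simp [hkW, h1]
    · have h1 : k ∈ S := hSk.2 hlt
      by_cases hkW : k ∈ W
      · simp [hkW, h1]
      · simp only [hkW, h1, if_true, if_false]
        exact ⟨by linarith, fun h => by linarith⟩
  rw [hsum W hW, hsum S hST]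
  refine ⟨Finset.sum_le_sum fun k hk => (hterm k hk).1, fun heq => ?_⟩
  have h1 := (Finset.sum_eq_sum_iff_of_le fun k hk => (hterm k hk).1).1 heq
  ext k
  constructor
  · intro hk
    have hks := (hs k).2 (hW hk)
    exact ((hterm k hks).2 (h1 k hks)).1 hk
  · intro hk
    have hks := (hs k).2 (hST hk)
    exact ((hterm k hks).2 (h1 k hks)).2 hk

end Largest

section Standard

variable {O : Type*} [CommRing O] {L : Type*} [NormedField L] [IsUltrametricDist L]
  [CompleteSpace L] [Algebra O (ValRing L)]
variable {C : Type*} [NormedField C] [IsUltrametricDist C] [NormedAlgebra L C] [CompleteSpace C]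
  [IsAlgClosed C]
variable {G : FormalModule O (ValRing L)} {ϖ : O} {q n : ℕ} {a : ℕ → ValRing L}

namespace IsStandard

lemma le_of_card_eq_pow (h : IsStandard G ϖ q n a) {W : Submodule O (Point C G)}
    (hW : W ≤ Submodule.torsionBy O (Point C G) ϖ) {m : ℕ} (hm : Nat.card W = q ^ m) : m ≤ n := by
  have := h.finite_torsion (C := C)
  have h2 : Nat.card W ≤ q ^ n := by
    rw [← h.card_torsion (C := C)]
    exact Nat.card_le_card_of_injective _ (Submodule.inclusion_injective hW)
  rw [hm] at h2
  exact (Nat.pow_le_pow_iff_right h.one_lt).1 h2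

/-- Comparison of the vertex of index `i` of the Newton polygon of `[ϖ]` with the torsion points of
large valuation. -/
lemma exists_torsion_submodule (h : IsStandard G ϖ q n a) {t : ℝ}
    (ht : t = ‖algebraMap O (ValRing L) ϖ‖) {B : ℝ} (hB : 0 < B)
    (ha : ∀ j ≤ n, ‖a j‖ ≤ B * t ^ (1 - j / n : ℝ)) {i : ℕ} (hi : i ≤ n) :
    ∃ (r : ℝ) (S : Submodule O (Point C G)), 0 < r ∧ 1 < n * (q - 1) * q ^ i * r ∧
      n * (q - 1) * q ^ i * r < q ∧ S ≤ Submodule.torsionBy O (Point C G) ϖ ∧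
      (∀ k ∈ Submodule.torsionBy O (Point C G) ϖ, k ∈ S ↔ k = 0 ∨ r < nu t k) ∧
      (∀ k ∈ Submodule.torsionBy O (Point C G) ϖ, k ≠ 0 → nu t k ≠ r) ∧
      t ^ (Nat.card S * r + 1 - deg (nu t) S) ≤ B * t ^ psi q n i r ∧
      (t ^ (Nat.card S * r + 1 - deg (nu t) S) = B * t ^ psi q n i r ↔
        ‖a i‖ = B * t ^ (1 - i / n : ℝ)) := by
  have ht0 : 0 < t := ht ▸ h.norm_pos
  obtain ⟨r, y, hr, hlo, hhi, hy, hgen⟩ := h.exists_generic_point (C := C) ht i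
  obtain ⟨S, hST, hS, hSy⟩ := h.exists_norm_smul_eq ht hy hgen
  obtain ⟨c, hc, hlt⟩ := h.exists_norm_smul_sub_lt ht hB ha hi hr (fun _ => hlo) (fun _ => hhi) hy
  have hpsi : B * t ^ psi q n i r = B * t ^ (1 - i / n : ℝ) * t ^ (q ^ i * r : ℝ) := by
    rw [mul_assoc, ← Real.rpow_add ht0, psi]
  have hpow : 0 < t ^ (q ^ i * r : ℝ) := by positivity
  refine ⟨r, S, hr, hlo, hhi, hST, hS, hgen, ?_⟩
  rw [← hSy]
  rcases (ha i hi).lt_or_eq with hai | hai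
  · have hclt : ‖c‖ < B * t ^ psi q n i r := by
      rw [hc, hpsi]
      exact mul_lt_mul_of_pos_right hai hpow
    have hylt : ‖(ϖ • y).val‖ < B * t ^ psi q n i r := by
      have h1 := IsUltrametricDist.norm_add_le_max ((ϖ • y).val - c) c
      rw [sub_add_cancel] at h1
      exact h1.trans_lt (max_lt hlt hclt)
    exact ⟨hylt.le, fun h1 => absurd h1 hylt.ne, fun h1 => absurd h1 hai.ne⟩
  · have hceq : ‖c‖ = B * t ^ psi q n i r := by rw [hc, hpsi, hai]
    have hyeq : ‖(ϖ • y).val‖ = B * t ^ psi q n i r := by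
      rw [← hceq] at hlt ⊢
      have h1 := IsUltrametricDist.norm_add_eq_max_of_norm_ne_norm hlt.ne
      rwa [sub_add_cancel, max_eq_right hlt.le] at h1
    exact ⟨hyeq.le, fun _ => hai, fun _ => hyeq⟩

/-- The elements of valuation `> r` are closer to `0` than the others. -/
lemma norm_lt_norm_of_mem_iff {t : ℝ} (ht0 : 0 < t) (ht1 : t < 1) {r : ℝ}
    {T S : Submodule O (Point C G)} (hS : ∀ k ∈ T, k ∈ S ↔ k = 0 ∨ r < nu t k)
    {k k' : Point C G} (hk : k ∈ T) (hkS : k ∈ S) (hk' : k' ∈ T) (hkS' : k' ∉ S) :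
    ‖k.val‖ < ‖k'.val‖ := by
  rw [hS k' hk', not_or, not_lt] at hkS'
  rcases (hS k hk).1 hkS with rfl | hlt
  · rw [Point.zero_val, norm_zero]
    exact norm_val_pos hkS'.1
  · rcases eq_or_ne k 0 with rfl | hk0
    · rw [Point.zero_val, norm_zero]
      exact norm_val_pos hkS'.1
    rw [norm_eq_rpow_nu ht0 ht1 hk0, norm_eq_rpow_nu ht0 ht1 hkS'.1]
    exact Real.rpow_lt_rpow_of_exponent_gt ht0 ht1 (hkS'.2.trans_lt hlt)

/-- On the fundamental domain, a submodule of order `q ^ i` of the `ϖ`-torsion has degree at most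
`i / n`; equality forces `v (x_i) = 1 - i / n`, and the submodule consists of the points of largest
valuation. -/
lemma deg_le_of_card_eq_pow (h : IsStandard G ϖ q n a) {t : ℝ}
    (ht : t = ‖algebraMap O (ValRing L) ϖ‖) (ha : ∀ j ≤ n, ‖a j‖ ≤ t ^ (1 - j / n : ℝ))
    {i : ℕ} (hi : i ≤ n) {W : Submodule O (Point C G)}
    (hW : W ≤ Submodule.torsionBy O (Point C G) ϖ) (hcard : Nat.card W = q ^ i) :
    n * deg (nu t) W ≤ i ∧ (n * deg (nu t) W = i → ‖a i‖ = t ^ (1 - i / n : ℝ) ∧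
      ∀ k ∈ W, ∀ k' ∈ Submodule.torsionBy O (Point C G) ϖ, k' ∉ W → ‖k.val‖ < ‖k'.val‖) := by
  have ht0 : 0 < t := ht ▸ h.norm_pos
  have ht1 : t < 1 := ht ▸ h.norm_lt
  have hn : (n : ℝ) ≠ 0 := by exact_mod_cast h.pos.ne'
  have hn0 : (0 : ℝ) < n := by exact_mod_cast h.pos
  have := h.finite_torsion (C := C)
  obtain ⟨r, S, -, -, -, hST, hS, hgen, hle, heq⟩ := h.exists_torsion_submodule (C := C) ht one_pos
    (by simpa only [one_mul] using ha) hi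
  rw [one_mul, rpow_le_rpow_iff_of_lt_one ht0 ht1] at hle
  obtain ⟨h1, h2⟩ := deg_sub_card_mul_le hW hST hS hgen
  rw [hcard] at h1 h2
  push_cast at h1 h2
  have hdiv : n * ((i : ℝ) / n) = i := mul_div_cancel₀ _ hn
  rw [psi] at hle
  have h3 : deg (nu t) W ≤ i / n := by linarith
  refine ⟨by
    calc n * deg (nu t) W ≤ n * (i / n : ℝ) := mul_le_mul_of_nonneg_left h3 hn0.le
      _ = i := hdiv, fun h4 => ?_⟩
  have h5 : deg (nu t) W = i / n := by rw [eq_div_iff hn, mul_comm, h4]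
  have h6 : deg (nu t) W - q ^ i * r = deg (nu t) S - Nat.card S * r := by linarith
  obtain rfl := h2 h6
  refine ⟨?_, fun k hk k' hk' hkW' => norm_lt_norm_of_mem_iff ht0 ht1 hS (hW hk) hk hk' hkW'⟩
  rw [one_mul, one_mul] at heq
  refine heq.1 ?_
  rw [psi, hcard, h5]
  push_cast
  congr 1
  ring

/-- On the part `v (x_i) = 1 - i / n` of the boundary of the fundamental domain, the `q ^ i` points
of largest valuation of the `ϖ`-torsion form a submodule of degree `i / n`. -/
lemma exists_submodule_of_norm_eq (h : IsStandard G ϖ q n a) {t : ℝ}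
    (ht : t = ‖algebraMap O (ValRing L) ϖ‖) (ha : ∀ j ≤ n, ‖a j‖ ≤ t ^ (1 - j / n : ℝ))
    (hpow : ∀ W ≤ Submodule.torsionBy O (Point C G) ϖ, ∃ m, Nat.card W = q ^ m)
    {i : ℕ} (hi : i ≤ n) (hai : ‖a i‖ = t ^ (1 - i / n : ℝ)) :
    ∃ S ≤ Submodule.torsionBy O (Point C G) ϖ, Nat.card S = q ^ i ∧ n * deg (nu t) S = i ∧
      ∀ k ∈ S, ∀ k' ∈ Submodule.torsionBy O (Point C G) ϖ, k' ∉ S → ‖k.val‖ < ‖k'.val‖ := by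
  have ht0 : 0 < t := ht ▸ h.norm_pos
  have ht1 : t < 1 := ht ▸ h.norm_lt
  have hn0 : (0 : ℝ) < n := by exact_mod_cast h.pos
  obtain ⟨r, S, hr, hlo, hhi, hST, hS, hgen, -, heq⟩ := h.exists_torsion_submodule (C := C) ht
    one_pos (by simpa only [one_mul] using ha) hi
  rw [one_mul, one_mul] at heq
  have h1 := (Real.rpow_right_inj ht0 ht1.ne).1 (heq.2 hai)
  obtain ⟨m, hm⟩ := hpow S hST
  have hmn : m ≤ n := h.le_of_card_eq_pow hST hm
  have h3 := (h.deg_le_of_card_eq_pow ht ha hmn hST hm).1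
  have hmi : m = i := by
    by_contra hne
    have h4 := psi_lt_psi h.one_lt h.pos hr hmn (fun _ => hlo) (fun _ => hhi) hne
    rw [hm] at h1
    push_cast at h1
    rw [← h1, psi] at h4
    have h5 : deg (nu t) S ≤ m / n := by rwa [le_div_iff₀ hn0, mul_comm]
    linarith
  subst hmi
  refine ⟨S, hST, hm, ?_, fun k hk k' hk' hkS' =>
    norm_lt_norm_of_mem_iff ht0 ht1 hS (hST hk) hk hk' hkS'⟩
  rw [hm, psi] at h1
  push_cast at h1
  have h5 : deg (nu t) S = m / n := by linarith
  rw [h5, mul_div_cancel₀ _ hn0.ne']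

/-- Semistability of the `ϖ`-torsion characterizes the fundamental domain. -/
lemma norm_le_of_deg_le (h : IsStandard G ϖ q n a) {t : ℝ}
    (ht : t = ‖algebraMap O (ValRing L) ϖ‖)
    (hpow : ∀ W ≤ Submodule.torsionBy O (Point C G) ϖ, ∃ m, Nat.card W = q ^ m)
    (hdeg : ∀ W ≤ Submodule.torsionBy O (Point C G) ϖ,
      n * deg (nu t) W ≤ Real.logb q (Nat.card W)) :
    ∀ j ≤ n, ‖a j‖ ≤ t ^ (1 - j / n : ℝ) := by
  have ht0 : 0 < t := ht ▸ h.norm_pos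
  have ht1 : t < 1 := ht ▸ h.norm_lt
  have hn0 : (0 : ℝ) < n := by exact_mod_cast h.pos
  have hq : (1 : ℝ) < q := by exact_mod_cast h.one_lt
  -- let `i` be an index where the condition is violated the most, by a factor `B`
  obtain ⟨i, hi, hmax⟩ := Finset.exists_max_image (Finset.range (n + 1))
    (fun j : ℕ => ‖a j‖ / t ^ (1 - j / n : ℝ)) ⟨0, by simp⟩
  rw [Finset.mem_range] at hi
  set B := ‖a i‖ / t ^ (1 - i / n : ℝ) with hBdef
  have ha : ∀ j ≤ n, ‖a j‖ ≤ B * t ^ (1 - j / n : ℝ) := by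
    intro j hj
    exact (div_le_iff₀ (by positivity)).1 (hmax j (Finset.mem_range.2 (by omega)))
  rcases le_or_gt B 1 with hB | hB
  · exact fun j hj => (ha j hj).trans (mul_le_of_le_one_left (by positivity) hB)
  exfalso
  obtain ⟨r, S, hr, hlo, hhi, hST, -, -, -, heq⟩ := h.exists_torsion_submodule (C := C) ht
    (one_pos.trans hB) ha (Nat.lt_succ_iff.1 hi)
  have h1 := heq.2 (by rw [hBdef, div_mul_cancel₀ _ (by positivity)])
  have h2 : t ^ psi q n i r < t ^ (Nat.card S * r + 1 - deg (nu t) S) := by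
    rw [h1]
    exact lt_mul_of_one_lt_left (by positivity) hB
  rw [Real.rpow_lt_rpow_left_iff_of_base_lt_one ht0 ht1] at h2
  obtain ⟨m, hm⟩ := hpow S hST
  have hmn : m ≤ n := h.le_of_card_eq_pow hST hm
  have h3 := hdeg S hST
  rw [hm] at h2 h3
  push_cast at h2 h3
  rw [Real.logb_pow, Real.logb_self_eq_one hq, mul_one] at h3
  have h5 : deg (nu t) S ≤ m / n := by rwa [le_div_iff₀ hn0, mul_comm]
  have h6 : psi q n i r ≤ psi q n m r := by
    rcases eq_or_ne m i with rfl | hne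
    · exact le_rfl
    · exact (psi_lt_psi h.one_lt h.pos hr hmn (fun _ => hlo) (fun _ => hhi) hne).le
  rw [psi] at h2 h6
  rw [psi] at h6
  linarith

/-- On the fundamental domain, the nonzero `ϖ`-torsion points have valuation at most
`1 / (n (q - 1))`. -/
lemma nu_le_of_smul_eq_zero (h : IsStandard G ϖ q n a) {t : ℝ}
    (ht : t = ‖algebraMap O (ValRing L) ϖ‖) (ha : ∀ j ≤ n, ‖a j‖ ≤ t ^ (1 - j / n : ℝ))
    {y : Point C G} (hy : y ≠ 0) (hϖy : ϖ • y = 0) : n * (q - 1) * nu t y ≤ 1 := by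
  have ht0 : 0 < t := ht ▸ h.norm_pos
  have ht1 : t < 1 := ht ▸ h.norm_lt
  by_contra! hlt
  -- at such points the linear term of `[ϖ]` would dominate
  obtain ⟨c, hc, hlt'⟩ := h.exists_norm_smul_sub_lt ht one_pos (by simpa only [one_mul] using ha)
    (Nat.zero_le n) (nu_pos ht0 ht1 hy) (fun _ => by simpa using hlt)
    (fun h => absurd h (lt_irrefl 0)) (norm_eq_rpow_nu ht0 ht1 hy)
  rw [hϖy, Point.zero_val, zero_sub, norm_neg, hc, h.zero_eq, ← ht, one_mul, psi,
    Real.rpow_add ht0] at hlt'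
  simp at hlt'

/-- On the fundamental domain, division by `ϖ` of points of valuation at most `1 / (n (q - 1))`
divides the valuation by `q ^ n`. -/
lemma nu_smul_of_nu_smul_le (h : IsStandard G ϖ q n a) {t : ℝ}
    (ht : t = ‖algebraMap O (ValRing L) ϖ‖) (ha : ∀ j ≤ n, ‖a j‖ ≤ t ^ (1 - j / n : ℝ))
    {y : Point C G} (hϖy : ϖ • y ≠ 0) (hle : n * (q - 1) * nu t (ϖ • y) ≤ 1) :
    nu t (ϖ • y) = q ^ n * nu t y := by
  have ht0 : 0 < t := ht ▸ h.norm_pos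
  have ht1 : t < 1 := ht ▸ h.norm_lt
  have hq : (1 : ℝ) < q := by exact_mod_cast h.one_lt
  have hn0 : (0 : ℝ) < n := by exact_mod_cast h.pos
  have hy : y ≠ 0 := by
    rintro rfl
    exact hϖy (Point.smul_zero ϖ)
  have hs := nu_pos ht0 ht1 hy
  have hy' := norm_eq_rpow_nu ht0 ht1 hy
  rcases lt_or_ge (n * ((q : ℝ) - 1) * q ^ n * nu t y) q with hlt | hge
  · -- the last term of `[ϖ]` dominates
    obtain ⟨c, hc, hlt'⟩ := h.exists_norm_smul_sub_lt ht one_pos (by simpa only [one_mul] using ha)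
      le_rfl hs (fun h => absurd h (lt_irrefl n)) (fun _ => hlt) hy'
    have hpsi : psi q n n (nu t y) = q ^ n * nu t y := by
      rw [psi, div_self hn0.ne', sub_self, zero_add]
    rw [h.last_eq, norm_one, one_mul] at hc
    rw [one_mul, hpsi, ← hc] at hlt'
    have h1 := IsUltrametricDist.norm_add_eq_max_of_norm_ne_norm hlt'.ne
    rw [sub_add_cancel, max_eq_right hlt'.le, hc] at h1
    exact nu_eq_of_norm_eq ht0 ht1 h1
  · -- all terms of `[ϖ]` are too small
    exfalso
    obtain ⟨c, hc, hsum⟩ := h.exists_smul_val_eq_sum ht hy'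
    obtain ⟨j, hj, hjle⟩ := IsUltrametricDist.exists_norm_finsetSum_le (Finset.range (n + 1)) c
    have hjn : j ≤ n := Nat.lt_succ_iff.1 (Finset.mem_range.1 (hj ⟨0, by simp⟩))
    have h1 : t ^ nu t (ϖ • y) ≤ t ^ psi q n j (nu t y) := by
      rw [← norm_eq_rpow_nu ht0 ht1 hϖy, hsum]
      refine hjle.trans ?_
      rw [hc, psi, Real.rpow_add ht0]
      exact mul_le_mul_of_nonneg_right (ha j hjn) (by positivity)
    rw [rpow_le_rpow_iff_of_lt_one ht0 ht1] at h1
    have h2 : 1 < n * ((q : ℝ) - 1) * psi q n j (nu t y) := by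
      have h3 : n * ((q : ℝ) - 1) * psi q n j (nu t y) =
          (q - 1) * (n - j) + n * (q - 1) * q ^ j * nu t y := by
        rw [psi]
        field_simp
      rw [h3]
      have hq1 : (0 : ℝ) < q - 1 := by linarith
      rcases hjn.eq_or_lt with rfl | hlt
      · linarith
      · have h4 : (1 : ℝ) ≤ q - 1 := by
          have : (2 : ℝ) ≤ q := by exact_mod_cast h.one_lt
          linarith
        have h5 : (1 : ℝ) ≤ n - j := by
          have : (j : ℝ) + 1 ≤ n := by exact_mod_cast hlt
          linarith
        have h6 : 0 < n * ((q : ℝ) - 1) * q ^ j * nu t y := by positivity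
        nlinarith
    have h7 : (0 : ℝ) < n * (q - 1) := mul_pos hn0 (by linarith)
    have h8 := mul_le_mul_of_nonneg_left h1 h7.le
    linarith

/-- Every nonzero finite submodule contains nonzero `ϖ`-torsion. -/
lemma exists_smul_eq_zero (h : IsStandard G ϖ q n a) (K : Submodule O (Point C G)) [Finite K]
    (hK : K ≠ ⊥) : ∃ x ∈ K, x ≠ 0 ∧ ϖ • x = 0 := by
  obtain ⟨x₀, hx₀, hx₀'⟩ := K.exists_mem_ne_zero_of_ne_bot hK
  obtain ⟨x, ⟨hx, hx0⟩, hmin⟩ := Set.exists_min_image {x | x ∈ K ∧ x ≠ 0} (fun x => ‖x.val‖)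
    ((Set.toFinite (K : Set (Point C G))).subset fun x hx => hx.1) ⟨x₀, hx₀, hx₀'⟩
  refine ⟨x, hx, hx0, by_contra fun h1 => ?_⟩
  exact (Point.norm_smul_lt h.norm_lt' hx0).not_ge (hmin _ ⟨K.smul_mem ϖ hx, h1⟩)

/-- On the fundamental domain, division by `ϖ` of points of finite order divides the valuation by
`q ^ n`. -/
lemma nu_smul (h : IsStandard G ϖ q n a) {t : ℝ}
    (ht : t = ‖algebraMap O (ValRing L) ϖ‖) (ha : ∀ j ≤ n, ‖a j‖ ≤ t ^ (1 - j / n : ℝ))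
    (K : Submodule O (Point C G)) [Finite K] {x : Point C G} (hx : x ∈ K) (hϖx : ϖ • x ≠ 0) :
    nu t (ϖ • x) = q ^ n * nu t x := by
  have ht0 : 0 < t := ht ▸ h.norm_pos
  have ht1 : t < 1 := ht ▸ h.norm_lt
  have hq : (1 : ℝ) < q := by exact_mod_cast h.one_lt
  have hn0 : (0 : ℝ) < n := by exact_mod_cast h.pos
  refine h.nu_smul_of_nu_smul_le ht ha hϖx ?_
  by_contra! hlt
  -- consider a point of `K` with valuation `> 1 / (n (q - 1))` and minimal norm
  obtain ⟨y, ⟨hy, hy0, hylt⟩, hmin⟩ := Set.exists_min_image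
    {x | x ∈ K ∧ x ≠ 0 ∧ 1 < n * (q - 1) * nu t x} (fun x => ‖x.val‖)
    ((Set.toFinite (K : Set (Point C G))).subset fun x hx => hx.1)
    ⟨ϖ • x, K.smul_mem ϖ hx, hϖx, hlt⟩
  have hϖy : ϖ • y ≠ 0 := fun h1 => hylt.not_ge (h.nu_le_of_smul_eq_zero ht ha hy0 h1)
  have hle : n * (q - 1) * nu t (ϖ • y) ≤ 1 := by
    by_contra! h1
    exact (Point.norm_smul_lt h.norm_lt' hy0).not_ge (hmin _ ⟨K.smul_mem ϖ hy, hϖy, h1⟩)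
  have h2 := h.nu_smul_of_nu_smul_le ht ha hϖy hle
  have h3 : nu t y ≤ nu t (ϖ • y) := by
    rw [h2]
    exact le_mul_of_one_le_left (nu_pos ht0 ht1 hy0).le (one_le_pow₀ hq.le)
  have h7 : (0 : ℝ) < n * (q - 1) := mul_pos hn0 (by linarith)
  exact hylt.not_ge ((mul_le_mul_of_nonneg_left h3 h7.le).trans hle)

/-- On the fundamental domain, the formal module is semistable. -/
lemma slope_le (h : IsStandard G ϖ q n a) {t : ℝ} (ht : t = ‖algebraMap O (ValRing L) ϖ‖)
    (ha : ∀ j ≤ n, ‖a j‖ ≤ t ^ (1 - j / n : ℝ))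
    (hpow : ∀ W ≤ Submodule.torsionBy O (Point C G) ϖ, ∃ m, Nat.card W = q ^ m)
    (K : Submodule O (Point C G)) [Finite K] :
    n * deg (nu t) K ≤ Real.logb q (Nat.card K) ∧
      (n * deg (nu t) K = Real.logb q (Nat.card K) →
        Submodule.torsionBy O (Point C G) ϖ ≤ K ∨ K ≤ Submodule.torsionBy O (Point C G) ϖ) := by
  have ht0 : 0 < t := ht ▸ h.norm_pos
  have ht1 : t < 1 := ht ▸ h.norm_lt
  have hq : (1 : ℝ) < q := by exact_mod_cast h.one_lt
  have := h.finite_torsion (C := C)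
  refine LubinTate.slope_le h.one_lt nu_zero (fun x hx => nu_pos ht0 ht1 hx) h.card_torsion
    (fun W hW => ?_) (fun K _ x hx hϖx => h.nu_smul ht ha K (x := x) hx hϖx)
    (fun K _ hK => h.exists_smul_eq_zero K hK) K
  obtain ⟨m, hm⟩ := hpow W hW
  have hmn : m ≤ n := h.le_of_card_eq_pow hW hm
  rw [hm]
  push_cast
  rw [Real.logb_pow, Real.logb_self_eq_one hq, mul_one]
  exact (h.deg_le_of_card_eq_pow ht ha hmn hW hm).1

end IsStandard

end Standard

/-! ### Isogenies between semistable formal modules -/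

section Standard

variable {O : Type*} [CommRing O] {L : Type*} [NormedField L] [IsUltrametricDist L]
  [CompleteSpace L] [Algebra O (ValRing L)]
variable {C : Type*} [NormedField C] [IsUltrametricDist C] [NormedAlgebra L C] [CompleteSpace C]
  [IsAlgClosed C]
variable {G H : FormalModule O (ValRing L)} {ϖ : O} {q n : ℕ} {a a' : ℕ → ValRing L}
  {f : PowerSeries (ValRing L)}

namespace IsStandard

lemma finite_ker (h : IsStandard G ϖ q n a) (hf : G.IsIsogeny H f) :
    Finite (LinearMap.ker (Point.map (C := C) hf.1)) := by
  obtain ⟨s, hs, -⟩ := Point.exists_finset_ker (C := C) h.norm_pos' h.norm_lt' hf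
  exact Set.Finite.subset s.finite_toSet fun x hx => (hs x).2 hx

lemma finite_comap (h : IsStandard G ϖ q n a) (hf : G.IsIsogeny H f)
    (W : Submodule O (Point C H)) [Finite W] :
    Finite (W.comap (Point.map (C := C) hf.1)) :=
  (Set.toFinite (W : Set (Point C H))).preimage' fun w _ =>
    Point.finite_fiber h.norm_pos' h.norm_lt' hf w

/-- The degree is additive along isogenies. -/
lemma deg_eq_add (h : IsStandard G ϖ q n a) (hf : G.IsIsogeny H f) {t : ℝ}
    {K : Submodule O (Point C G)} [Finite K] (hK : LinearMap.ker (Point.map (C := C) hf.1) ≤ K) :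
    deg (nu t) K = deg (nu t) (LinearMap.ker (Point.map (C := C) hf.1)) +
      deg (nu t) (K.map (Point.map (C := C) hf.1)) := by
  refine deg_eq_deg_ker_add_deg_map nu_zero _ (fun w s hw hs => ?_) hK
  have hs' : s = (Point.finite_fiber (C := C) h.norm_pos' h.norm_lt' hf w).toFinset := by
    ext y
    rw [hs, Set.Finite.mem_toFinset]
    rfl
  rw [nu, Point.norm_eq_prod_fiber h.norm_pos' h.norm_lt' hf w, ← hs', Real.log_prod,
    Finset.sum_div]
  · rfl
  · rintro y hy
    refine (norm_val_pos ?_).ne'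
    rintro rfl
    rw [hs, map_zero] at hy
    exact hw hy.symm

lemma card_eq_mul (hf : G.IsIsogeny H f) {K : Submodule O (Point C G)} [Finite K]
    (hK : LinearMap.ker (Point.map (C := C) hf.1) ≤ K) :
    (Nat.card K : ℝ) = Nat.card (LinearMap.ker (Point.map (C := C) hf.1)) *
      Nat.card (K.map (Point.map (C := C) hf.1)) := by
  rw [card_eq_mul_card_map (Point.map (C := C) hf.1) K, inf_eq_right.2 hK]

/-- The torsion submodules of `ϖ ^ e` have slope `1 / n`. -/
lemma card_deg_torsion_pow (h : IsStandard G ϖ q n a) {t : ℝ}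
    (ht : t = ‖algebraMap O (ValRing L) ϖ‖) (e : ℕ) :
    Finite (Submodule.torsionBy O (Point C G) (ϖ ^ e)) ∧
      Nat.card (Submodule.torsionBy O (Point C G) (ϖ ^ e)) = q ^ (n * e) ∧
      deg (nu t) (Submodule.torsionBy O (Point C G) (ϖ ^ e)) = e := by
  have hmap : ∀ x : Point C G, Point.map h.isIsogeny.1 x = ϖ • x := fun x => rfl
  have hker : LinearMap.ker (Point.map (C := C) h.isIsogeny.1) =
      Submodule.torsionBy O (Point C G) ϖ := rfl
  induction e with
  | zero =>
    have h0 : Submodule.torsionBy O (Point C G) (ϖ ^ 0) = ⊥ := by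
      rw [pow_zero, Submodule.torsionBy_one]
    rw [h0, deg_eq_sum (s := {0}) (by simp), Finset.sum_singleton, nu_zero]
    exact ⟨inferInstance, by simp, by simp⟩
  | succ e ih =>
    obtain ⟨hfin, hcard, hdeg⟩ := ih
    have hcomap : Submodule.torsionBy O (Point C G) (ϖ ^ (e + 1)) =
        (Submodule.torsionBy O (Point C G) (ϖ ^ e)).comap (Point.map h.isIsogeny.1) := by
      ext x
      rw [Submodule.mem_comap, Submodule.mem_torsionBy_iff, Submodule.mem_torsionBy_iff, hmap,
        pow_succ, mul_smul]
    have hfin' := h.finite_comap h.isIsogeny (Submodule.torsionBy O (Point C G) (ϖ ^ e))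
    have hle : LinearMap.ker (Point.map (C := C) h.isIsogeny.1) ≤
        (Submodule.torsionBy O (Point C G) (ϖ ^ e)).comap (Point.map h.isIsogeny.1) :=
      LinearMap.ker_le_comap _
    have hsurj := Submodule.map_comap_eq_of_surjective
      (Point.map_surjective (C := C) h.norm_pos' h.norm_lt' h.isIsogeny)
      (Submodule.torsionBy O (Point C G) (ϖ ^ e))
    rw [hcomap]
    refine ⟨hfin', ?_, ?_⟩
    · have h1 := card_eq_mul h.isIsogeny hle
      rw [hsurj, hcard, hker, h.card_torsion] at h1
      rw [mul_add, mul_one, pow_add, mul_comm (q ^ (n * e))]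
      exact_mod_cast h1
    · rw [h.deg_eq_add h.isIsogeny hle, hsurj, hdeg, hker, h.deg_torsion ht]
      push_cast
      ring

/-- Finite submodules are `ϖ`-primary. -/
lemma exists_le_torsion_pow (h : IsStandard G ϖ q n a) (K : Submodule O (Point C G)) [Finite K] :
    ∃ e, K ≤ Submodule.torsionBy O (Point C G) (ϖ ^ e) := by
  classical
  have hx : ∀ x : K, ∃ e : ℕ, ϖ ^ e • (x : Point C G) = 0 := by
    intro x
    obtain ⟨b, c, hbc, heq⟩ := Finite.exists_ne_map_eq_of_infinite (fun e : ℕ => ϖ ^ e • x)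
    wlog hlt : b < c generalizing b c
    · exact this c b hbc.symm heq.symm (lt_of_le_of_ne (not_lt.1 hlt) hbc.symm)
    obtain ⟨d, rfl⟩ := Nat.exists_eq_add_of_lt hlt
    refine ⟨b, by_contra fun hne => ?_⟩
    have h1 : ϖ ^ b • (x : Point C G) = ϖ ^ d • ϖ • ϖ ^ b • (x : Point C G) := by
      rw [← mul_smul, ← mul_smul, ← pow_succ, ← pow_add, show d + 1 + b = b + d + 1 by ring]
      exact congrArg Subtype.val heq
    have h2 := Point.norm_smul_lt h.norm_lt' hne
    have h3 := Point.norm_smul_le (ϖ ^ d) (ϖ • ϖ ^ b • (x : Point C G))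
    rw [← h1] at h3
    exact h2.not_ge h3
  choose e he using hx
  have := Fintype.ofFinite K
  refine ⟨∑ x, e x, fun x hxK => ?_⟩
  rw [Submodule.mem_torsionBy_iff, ← Finset.sum_erase_add _ _ (Finset.mem_univ ⟨x, hxK⟩), pow_add,
    mul_smul, he ⟨x, hxK⟩, Point.smul_zero]

/-- An isogeny between semistable formal modules has a kernel of slope `1 / n`; if it is nonzero and
does not contain the `ϖ`-torsion, it is a proper submodule of the `ϖ`-torsion. -/
lemma exists_of_isogeny (h : IsStandard G ϖ q n a) (h' : IsStandard H ϖ q n a') {t : ℝ}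
    (ht : t = ‖algebraMap O (ValRing L) ϖ‖) (ha : ∀ j ≤ n, ‖a j‖ ≤ t ^ (1 - j / n : ℝ))
    (ha' : ∀ j ≤ n, ‖a' j‖ ≤ t ^ (1 - j / n : ℝ))
    (hpow : ∀ W ≤ Submodule.torsionBy O (Point C G) ϖ, ∃ m, Nat.card W = q ^ m)
    (hpow' : ∀ W ≤ Submodule.torsionBy O (Point C H) ϖ, ∃ m, Nat.card W = q ^ m)
    (hf : G.IsIsogeny H f) (hbot : LinearMap.ker (Point.map (C := C) hf.1) ≠ ⊥)
    (htor : ¬ Submodule.torsionBy O (Point C G) ϖ ≤ LinearMap.ker (Point.map (C := C) hf.1)) :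
    ∃ i, 0 < i ∧ i < n ∧ Nat.card (LinearMap.ker (Point.map (C := C) hf.1)) = q ^ i ∧
      LinearMap.ker (Point.map (C := C) hf.1) ≤ Submodule.torsionBy O (Point C G) ϖ ∧
      n * deg (nu t) (LinearMap.ker (Point.map (C := C) hf.1)) = i := by
  have hq : (1 : ℝ) < q := by exact_mod_cast h.one_lt
  have := h.finite_torsion (C := C)
  have := h.finite_ker (C := C) hf
  -- compare the slopes of a torsion submodule that contains the kernel and of its image
  obtain ⟨e, he⟩ := h.exists_le_torsion_pow (LinearMap.ker (Point.map (C := C) hf.1))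
  obtain ⟨hfin, hcard, hdeg⟩ := h.card_deg_torsion_pow (C := C) ht e
  have hfin' : Finite ((Submodule.torsionBy O (Point C G) (ϖ ^ e)).map
      (Point.map (C := C) hf.1)) :=
    Set.Finite.image _ (Set.toFinite (Submodule.torsionBy O (Point C G) (ϖ ^ e) : Set (Point C G)))
  have hd := h.deg_eq_add hf (t := t) he
  have hc := card_eq_mul hf he
  have hs' := (h'.slope_le ht ha' hpow' ((Submodule.torsionBy O (Point C G) (ϖ ^ e)).map
    (Point.map (C := C) hf.1))).1
  obtain ⟨hs, heq⟩ := h.slope_le ht ha hpow (LinearMap.ker (Point.map (C := C) hf.1))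
  have hlog : Real.logb q (Nat.card (Submodule.torsionBy O (Point C G) (ϖ ^ e))) = n * e := by
    rw [hcard]
    push_cast
    rw [Real.logb_pow, Real.logb_self_eq_one hq, mul_one]
    push_cast
    rfl
  rw [hc, Real.logb_mul (by exact_mod_cast Nat.card_pos.ne') (by exact_mod_cast Nat.card_pos.ne')]
    at hlog
  rw [hdeg] at hd
  have hdn : (n : ℝ) * e = n * (deg (nu t) (LinearMap.ker (Point.map (C := C) hf.1)) +
    deg (nu t) ((Submodule.torsionBy O (Point C G) (ϖ ^ e)).map (Point.map (C := C) hf.1))) := by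
    rw [hd]
  have heq1 : n * deg (nu t) (LinearMap.ker (Point.map (C := C) hf.1)) =
      Real.logb q (Nat.card (LinearMap.ker (Point.map (C := C) hf.1))) := by linarith
  have hle := (heq heq1).resolve_left htor
  obtain ⟨i, hi⟩ := hpow _ hle
  have hlog' : Real.logb q (Nat.card (LinearMap.ker (Point.map (C := C) hf.1))) = i := by
    rw [hi]
    push_cast
    rw [Real.logb_pow, Real.logb_self_eq_one hq, mul_one]
  refine ⟨i, Nat.pos_of_ne_zero ?_, lt_of_le_of_ne (h.le_of_card_eq_pow hle hi) ?_, hi, hle,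
    heq1.trans hlog'⟩
  · rintro rfl
    rw [pow_zero] at hi
    have := (Nat.card_eq_one_iff_unique.1 hi).1
    exact hbot Submodule.eq_bot_of_subsingleton
  · rintro rfl
    refine htor fun x hx => ?_
    have h7 : (LinearMap.ker (Point.map (C := C) hf.1) : Set (Point C G)) =
        (Submodule.torsionBy O (Point C G) ϖ : Set (Point C G)) :=
      Set.eq_of_subset_of_ncard_le hle ((h.card_torsion (C := C)).trans hi.symm).le
        (Set.toFinite (Submodule.torsionBy O (Point C G) ϖ : Set (Point C G)))
    have h8 : x ∈ (LinearMap.ker (Point.map (C := C) hf.1) : Set (Point C G)) := by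
      rw [h7]
      exact hx
    exact h8

/-- The submodule of order `m` of the points of `T` of largest valuation is unique. -/
lemma eq_of_norm_lt_norm {T K S : Submodule O (Point C G)} [Finite T] (hK : K ≤ T) (hS : S ≤ T)
    (hcard : Nat.card K = Nat.card S)
    (hK' : ∀ k ∈ K, ∀ k' ∈ T, k' ∉ K → ‖k.val‖ < ‖k'.val‖)
    (hS' : ∀ k ∈ S, ∀ k' ∈ T, k' ∉ S → ‖k.val‖ < ‖k'.val‖) : K = S := by
  have hT := Set.toFinite (T : Set (Point C G))
  have hKf : (K : Set (Point C G)).Finite := hT.subset hK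
  have hSf : (S : Set (Point C G)).Finite := hT.subset hS
  by_cases h1 : K ≤ S
  · exact SetLike.coe_injective (Set.eq_of_subset_of_ncard_le h1 hcard.ge hSf)
  by_cases h2 : S ≤ K
  · exact (SetLike.coe_injective (Set.eq_of_subset_of_ncard_le h2 hcard.le hKf)).symm
  obtain ⟨k, hk, hkS⟩ := SetLike.not_le_iff_exists.1 h1
  obtain ⟨s, hs, hsK⟩ := SetLike.not_le_iff_exists.1 h2
  exact absurd (hK' k hk s (hS hs) hsK) (hS' s hs k (hK hk) hkS).not_gt

/-- The quotient of a formal module by a submodule of slope `1 / n` is semistable. -/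
lemma norm_le_of_isogeny (h : IsStandard G ϖ q n a) (h' : IsStandard H ϖ q n a') {t : ℝ}
    (ht : t = ‖algebraMap O (ValRing L) ϖ‖) (ha : ∀ j ≤ n, ‖a j‖ ≤ t ^ (1 - j / n : ℝ))
    (hpow : ∀ W ≤ Submodule.torsionBy O (Point C G) ϖ, ∃ m, Nat.card W = q ^ m)
    (hpow' : ∀ W ≤ Submodule.torsionBy O (Point C H) ϖ, ∃ m, Nat.card W = q ^ m)
    (hf : G.IsIsogeny H f) {i j : ℕ} (hij : i + j = n) (hai : ‖a i‖ = t ^ (1 - i / n : ℝ))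
    (hcard : Nat.card (LinearMap.ker (Point.map (C := C) hf.1)) = q ^ i)
    (hle : LinearMap.ker (Point.map (C := C) hf.1) ≤ Submodule.torsionBy O (Point C G) ϖ)
    (hlarge : ∀ k ∈ LinearMap.ker (Point.map (C := C) hf.1),
      ∀ k' ∈ Submodule.torsionBy O (Point C G) ϖ,
        k' ∉ LinearMap.ker (Point.map (C := C) hf.1) → ‖k.val‖ < ‖k'.val‖) :
    (∀ j ≤ n, ‖a' j‖ ≤ t ^ (1 - j / n : ℝ)) ∧ ‖a' j‖ = t ^ (1 - j / n : ℝ) := by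
  have hq : (1 : ℝ) < q := by exact_mod_cast h.one_lt
  have hq0 : (0 : ℝ) < q := by linarith
  have := h.finite_torsion (C := C)
  have := h'.finite_torsion (C := C)
  have := h.finite_ker (C := C) hf
  have hsurj := Point.map_surjective (C := C) h.norm_pos' h.norm_lt' hf
  have hdegK : n * deg (nu t) (LinearMap.ker (Point.map (C := C) hf.1)) = i := by
    obtain ⟨S, hS, hScard, hSdeg, hSlarge⟩ :=
      h.exists_submodule_of_norm_eq (C := C) ht ha hpow (by omega) hai
    rw [eq_of_norm_lt_norm hle hS (hcard.trans hScard.symm) hlarge hSlarge, hSdeg]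
  have hD : ∀ j ≤ n, ‖a' j‖ ≤ t ^ (1 - j / n : ℝ) := by
    refine h'.norm_le_of_deg_le ht hpow' fun W hW => ?_
    have : Finite W := Set.Finite.subset
      (Set.toFinite (Submodule.torsionBy O (Point C H) ϖ : Set (Point C H))) hW
    have hfin := h.finite_comap hf W
    have hker := LinearMap.ker_le_comap (p := W) (Point.map (C := C) hf.1)
    have h1 := h.deg_eq_add hf (t := t) hker
    have h2 := card_eq_mul hf hker
    rw [Submodule.map_comap_eq_of_surjective hsurj] at h1 h2
    have h3 := (h.slope_le ht ha hpow (W.comap (Point.map (C := C) hf.1))).1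
    rw [h1, h2, hcard, Real.logb_mul (by push_cast; positivity)
      (by exact_mod_cast Nat.card_pos.ne'), mul_add, hdegK] at h3
    push_cast at h3
    rw [Real.logb_pow, Real.logb_self_eq_one hq, mul_one] at h3
    linarith
  refine ⟨hD, ?_⟩
  -- the image of the `ϖ`-torsion has order `q ^ j` and slope `1 / n`
  have hmap : (Submodule.torsionBy O (Point C G) ϖ).map (Point.map (C := C) hf.1) ≤
      Submodule.torsionBy O (Point C H) ϖ := by
    rintro _ ⟨x, hx, rfl⟩
    rw [Submodule.mem_torsionBy_iff, ← map_smul, (Submodule.mem_torsionBy_iff _ _).1 hx, map_zero]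
  have h1 := h.deg_eq_add hf (t := t) hle
  have h2 := card_eq_mul hf hle
  rw [h.deg_torsion ht] at h1
  rw [h.card_torsion, hcard, ← hij, pow_add] at h2
  have h3 : Nat.card ((Submodule.torsionBy O (Point C G) ϖ).map (Point.map (C := C) hf.1)) =
      q ^ j := by
    push_cast at h2
    have h4 := mul_left_cancel₀ (by positivity) h2
    exact_mod_cast h4.symm
  refine ((h'.deg_le_of_card_eq_pow ht hD (by omega) hmap h3).2 ?_).1
  have h5 : (n : ℝ) = i + j := by exact_mod_cast hij.symm
  have h6 := congrArg ((n : ℝ) * ·) h1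
  simp only [mul_add, mul_one, hdegK] at h6
  linarith

end IsStandard

end Standard

/-! ### Points of the Lubin-Tate space -/

section Valuation

variable {F K : Type*} [NormedField F] [NormedField K] {ϖ : F}

lemma le_normVal_iff (h0 : 0 < ‖ϖ‖) (h1 : ‖ϖ‖ < 1) {s : ℝ} {z : K} :
    (s : WithTop ℝ) ≤ normVal ϖ z ↔ ‖z‖ ≤ ‖ϖ‖ ^ s := by
  rw [normVal]
  split_ifs with hz
  · simp only [hz, norm_zero, le_top, true_iff]
    positivity
  · rw [WithTop.coe_le_coe, le_div_iff_of_neg (Real.log_neg h0 h1), ← Real.log_rpow h0,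
      Real.log_le_log_iff (norm_pos_iff.2 hz) (by positivity)]

lemma normVal_eq_iff (h0 : 0 < ‖ϖ‖) (h1 : ‖ϖ‖ < 1) {s : ℝ} {z : K} :
    normVal ϖ z = (s : WithTop ℝ) ↔ ‖z‖ = ‖ϖ‖ ^ s := by
  rw [normVal]
  split_ifs with hz
  · have : 0 < ‖ϖ‖ ^ s := by positivity
    simp [hz, this.ne]
  · rw [WithTop.coe_eq_coe, div_eq_iff (Real.log_neg h0 h1).ne, ← Real.log_rpow h0]
    exact Real.log_injOn_pos.eq_iff (norm_pos_iff.2 hz) (Set.mem_Ioi.2 (by positivity))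

lemma normVal_lt_normVal_iff (h0 : 0 < ‖ϖ‖) (h1 : ‖ϖ‖ < 1) {z w : K} :
    normVal ϖ w < normVal ϖ z ↔ ‖z‖ < ‖w‖ := by
  rcases eq_or_ne w 0 with rfl | hw
  · simp [normVal, (norm_nonneg z).not_gt]
  rcases eq_or_ne z 0 with rfl | hz
  · simp [normVal, hw]
  rw [normVal, normVal, if_neg hw, if_neg hz, WithTop.coe_lt_coe,
    div_lt_div_right_of_neg (Real.log_neg h0 h1),
    Real.log_lt_log_iff (norm_pos_iff.2 hz) (norm_pos_iff.2 hw)]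

end Valuation

section KernelPoints

variable {O : Type*} [CommRing O] {L : Type*} [NormedField L] [IsUltrametricDist L]
  [Algebra O (ValRing L)]
variable {C : Type*} [NormedField C] [IsUltrametricDist C] [NormedAlgebra L C] [CompleteSpace C]
variable {G H : FormalModule O (ValRing L)} {f : PowerSeries (ValRing L)}

lemma evalSeries_eq_ev {z : ValRing C} (hz : ‖z‖ < 1) (f : PowerSeries (ValRing L)) :
    evalSeries f (z : C) = (ev z f : C) := by
  have h := (hasSum_ev hz f).map (ValRing C).subtype.toAddMonoidHom continuous_subtype_val
  exact h.tsum_eq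

/-- The coordinate of a point, as an element of the field `C`. -/
def Point.coe (x : Point C G) : C := x.val

lemma Point.coe_injective : Function.Injective (Point.coe : Point C G → C) :=
  fun _ _ h => Point.ext (Subtype.ext h)

lemma kernelPoints_eq_image (hf : G.IsHom H f) :
    kernelPoints C f = Point.coe '' (LinearMap.ker (Point.map (C := C) hf) : Set (Point C G)) := by
  ext z
  constructor
  · rintro ⟨hz, hz'⟩
    have hz1 : z ∈ ValRing C := mem_valRing_iff.2 hz.le
    refine ⟨⟨⟨z, hz1⟩, hz⟩, ?_, rfl⟩
    have h := evalSeries_eq_ev (z := ⟨z, hz1⟩) hz f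
    rw [hz'] at h
    exact Point.val_eq_zero.1 (Subtype.ext h.symm)
  · rintro ⟨x, hx, rfl⟩
    refine ⟨x.norm_lt_one, ?_⟩
    rw [Point.coe, evalSeries_eq_ev x.norm_lt_one, ← Point.map_val hf, (LinearMap.mem_ker).1 hx,
      Point.zero_val]
    rfl

lemma isLargestValuationSubset_image_iff {F : Type*} [NormedField F] {ϖ : F} (h0 : 0 < ‖ϖ‖)
    (h1 : ‖ϖ‖ < 1) {m : ℕ} {K T : Submodule O (Point C G)} [Finite K] :
    IsLargestValuationSubset ϖ m (Point.coe '' (K : Set (Point C G)))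
      (Point.coe '' (T : Set (Point C G))) ↔
      K ≤ T ∧ Nat.card K = m ∧ ∀ k ∈ K, ∀ k' ∈ T, k' ∉ K → ‖k.val‖ < ‖k'.val‖ := by
  refine and_congr (Set.image_subset_image_iff Point.coe_injective) (and_congr ?_ ?_)
  · rw [Point.coe_injective.encard_image, ← (Set.toFinite (K : Set (Point C G))).cast_ncard_eq,
      Nat.cast_inj]
    rfl
  · rw [← Set.image_sdiff Point.coe_injective, Set.forall_mem_image]
    refine forall₂_congr fun k _ => ?_
    rw [Set.forall_mem_image]
    refine forall_congr' fun k' => ?_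
    rw [normVal_lt_normVal_iff h0 h1]
    exact ⟨fun h hT hK => h ⟨hT, hK⟩, fun h hk => h hk.1 hk.2⟩

end KernelPoints

section Fiber

variable {F L : Type*} [NormedField F] [IsUltrametricDist F] [NormedField L] [IsUltrametricDist L]
  [NormedAlgebra F L]

lemma norm_algebraMap_base (b : ValRing F) : ‖algebraMap (ValRing F) (ValRing L) b‖ = ‖(b : F)‖ :=
  norm_algebraMap' L (b : F)

lemma norm_uniformizer (p : ℕ) [Fact p.Prime] [NormedAlgebra ℚ_[p] F] {ϖ : ValRing F}
    (hϖ : IsLocalRing.maximalIdeal (ValRing F) = Ideal.span {ϖ}) :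
    0 < ‖(ϖ : F)‖ ∧ ‖(ϖ : F)‖ < 1 := by
  have h1 : ϖ ∈ IsLocalRing.maximalIdeal (ValRing F) := hϖ ▸ Ideal.mem_span_singleton_self ϖ
  refine ⟨norm_pos_iff.2 fun h0 => ?_, mem_maximalIdeal_valRing_iff.1 h1⟩
  have hp : ‖algebraMap ℚ_[p] F p‖ < 1 := by
    rw [norm_algebraMap']
    exact Padic.norm_p_lt_one
  have hp0 : algebraMap ℚ_[p] F p ≠ 0 := by
    rw [Ne, map_eq_zero]
    exact_mod_cast (Fact.out : p.Prime).ne_zero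
  have h2 : (⟨algebraMap ℚ_[p] F p, mem_valRing_iff.2 hp.le⟩ : ValRing F) ∈
    IsLocalRing.maximalIdeal (ValRing F) := mem_maximalIdeal_valRing_iff.2 hp
  rw [hϖ, Ideal.mem_span_singleton', show ϖ = 0 from Subtype.ext h0] at h2
  obtain ⟨b, hb⟩ := h2
  rw [mul_zero] at hb
  exact hp0 (congrArg Subtype.val hb.symm)

/-- The residue field is finite: otherwise `q = 0` by convention, and the order of the series `[ϖ]`,
which has no constant term, could not be `q ^ n`. -/
lemma one_lt_card_residueField {O : Type*} [CommRing O] [IsLocalRing O]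
    {Φ : FormalModule O (IsLocalRing.ResidueField O)} {ϖ : O} {n : ℕ} (hn : 1 ≤ n)
    (hΦ : Φ.HasHeight ϖ n) : 1 < Nat.card (IsLocalRing.ResidueField O) := by
  have h0 : Nat.card (IsLocalRing.ResidueField O) ≠ 0 := by
    intro h0
    rw [FormalModule.HasHeight, h0, zero_pow (by omega)] at hΦ
    have h1 := PowerSeries.order_ne_zero_iff_constCoeff_eq_zero.2
      (Φ.act_isHom ϖ).constantCoeff_eq_zero
    exact h1 hΦ
  have := Nat.finite_of_card_ne_zero h0
  exact Finite.one_lt_card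

lemma map_ltCoord_zero {n : ℕ} (ϖ : ValRing F) (x : LTPoint L F n) :
    x.toAlgHom (ltCoord n ϖ 0) = algebraMap (ValRing F) (ValRing L) ϖ := by
  rw [← x.toAlgHom.commutes, ltCoord, dif_neg (by omega), if_pos rfl,
    MvPowerSeries.algebraMap_apply, Algebra.algebraMap_self_apply]

/-- The fibres of a formal module in standard coordinates are standard: the units `u_i` stay units,
and the coordinates of a point lie in the maximal ideal. -/
lemma isStandard_fiber {ϖ : ValRing F} {n : ℕ} (hn : 1 ≤ n) (h0 : 0 < ‖(ϖ : F)‖)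
    (h1 : ‖(ϖ : F)‖ < 1) (hq : 1 < Nat.card (IsLocalRing.ResidueField (ValRing F)))
    {𝓕 : FormalModule (ValRing F) (MvPowerSeries (LTIndex n) (ValRing F))}
    (hcoord : IsInStandardCoordinates 𝓕 ϖ) (x : LTPoint L F n) :
    IsStandard (x.fiber 𝓕) ϖ (Nat.card (IsLocalRing.ResidueField (ValRing F))) n
      (fun i => x.toAlgHom (ltCoord n ϖ i)) := by
  refine ⟨hq, hn, ?_, map_ltCoord_zero ϖ x, ?_, fun i hi => ?_, ?_⟩
  · rwa [norm_algebraMap_base]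
  · rw [ltCoord, dif_neg (by omega), if_neg (by omega), map_one]
  · rcases Nat.eq_zero_or_pos i with rfl | hi0
    · rwa [map_ltCoord_zero, norm_algebraMap_base]
    · rw [← mem_maximalIdeal_valRing_iff, IsLocalRing.mem_maximalIdeal, mem_nonunits_iff]
      intro hunit
      have := x.isLocalHom
      have h2 : IsUnit (ltCoord n ϖ i) := isUnit_of_map_unit x.toAlgHom.toRingHom _ hunit
      rw [ltCoord, dif_pos ⟨hi0, hi⟩, MvPowerSeries.isUnit_iff_constantCoeff,
        MvPowerSeries.constantCoeff_X] at h2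
      exact not_isUnit_zero h2
  · obtain ⟨u, hu, hact⟩ := hcoord
    refine ⟨fun i => PowerSeries.map (x.toAlgHom : _ →+* ValRing L) (u i),
      fun i => (hu i).map _, ?_⟩
    change PowerSeries.map (x.toAlgHom : _ →+* ValRing L) (𝓕.act ϖ) = _
    rw [hact, map_sum]
    refine Finset.sum_congr rfl fun i _ => ?_
    rw [map_mul, map_mul, map_pow, PowerSeries.map_C, PowerSeries.map_X]
    rfl

lemma coord_eq {n : ℕ} (ϖ : ValRing F) (x : LTPoint L F n) (i : LTIndex n) :
    x.coord i = (x.toAlgHom (ltCoord n ϖ i) : L) := by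
  rw [LTPoint.coord, ltCoord, dif_pos i.2]

/-- The conditions for `j = 0` and `j = n` hold automatically. -/
lemma mem_fundamentalDomain_iff {ϖ : ValRing F} {n : ℕ} (hn : 1 ≤ n) (h0 : 0 < ‖(ϖ : F)‖)
    (h1 : ‖(ϖ : F)‖ < 1) (x : LTPoint L F n) :
    x ∈ fundamentalDomain L (ϖ : F) n ↔
      ∀ j ≤ n, ‖x.toAlgHom (ltCoord n ϖ j)‖ ≤ ‖(ϖ : F)‖ ^ (1 - j / n : ℝ) := by
  have hn0 : (n : ℝ) ≠ 0 := by exact_mod_cast (by omega : n ≠ 0)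
  constructor
  · intro hx j hj
    rcases Nat.eq_zero_or_pos j with rfl | hj0
    · rw [map_ltCoord_zero, norm_algebraMap_base]
      simp
    rcases hj.eq_or_lt with rfl | hjn
    · rw [div_self hn0, sub_self, Real.rpow_zero]
      exact norm_valRing_le_one _
    · have h2 := (le_normVal_iff h0 h1).1 (hx ⟨j, hj0, hjn⟩)
      rwa [coord_eq ϖ] at h2
  · intro hx i
    rw [le_normVal_iff h0 h1, coord_eq ϖ]
    exact hx i i.2.2.le

lemma mem_fundamentalDomainBoundary_iff {ϖ : ValRing F} {n : ℕ} (h0 : 0 < ‖(ϖ : F)‖)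
    (h1 : ‖(ϖ : F)‖ < 1) (x : LTPoint L F n) (i : LTIndex n) :
    x ∈ fundamentalDomainBoundary L (ϖ : F) n i ↔ x ∈ fundamentalDomain L (ϖ : F) n ∧
      ‖x.toAlgHom (ltCoord n ϖ i)‖ = ‖(ϖ : F)‖ ^ (1 - (i : ℕ) / n : ℝ) := by
  refine and_congr_right fun _ => ?_
  rw [normVal_eq_iff h0 h1, coord_eq ϖ]
  rfl

end Fiber

end LubinTate

theorem proposition3p5 (p : ℕ) [Fact p.Prime]
    -- a finite extension `F` of `ℚ_p` and a uniformizer `ϖ` of `F`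
    (F : Type u) [NormedField F] [IsUltrametricDist F] [NormedAlgebra ℚ_[p] F]
    [FiniteDimensional ℚ_[p] F]
    (ϖ : ValRing F) (hϖ : IsLocalRing.maximalIdeal (ValRing F) = Ideal.span {ϖ})
    -- a formal module of height `n` over the residue field and its universal deformation
    (n : ℕ) (hn : 1 ≤ n)
    (Φ : FormalModule (ValRing F) (IsLocalRing.ResidueField (ValRing F))) (hΦ : Φ.HasHeight ϖ n)
    (𝓕 : FormalModule (ValRing F) (MvPowerSeries (LTIndex n) (ValRing F)))
    (h𝓕 : IsUniversalDeformation Φ 𝓕) (hcoord : IsInStandardCoordinates 𝓕 ϖ)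
    -- a complete valued extension `L` of `F`, and a complete algebraically closed extension `C`
    (L : Type*) [NormedField L] [IsUltrametricDist L] [NormedAlgebra F L] [CompleteSpace L]
    (C : Type*) [NormedField C] [IsUltrametricDist C] [NormedAlgebra L C] [CompleteSpace C]
    [IsAlgClosed C]
    (x x' : LTPoint L F n) (hx : x ∈ fundamentalDomain L (ϖ : F) n)
    (f : PowerSeries (ValRing L))
    (hf : (x.fiber 𝓕).IsIsogeny (x'.fiber 𝓕) f)
    (hf_iso : ¬ (x.fiber 𝓕).IsIso (x'.fiber 𝓕) f)
    (hf_mul : ¬ (x.fiber 𝓕).FactorsThroughMul (x'.fiber 𝓕) f ϖ) :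
    (x' ∈ fundamentalDomain L (ϖ : F) n ↔
      ∃ i : LTIndex n, x ∈ fundamentalDomainBoundary L (ϖ : F) n i ∧
        IsLargestValuationSubset (ϖ : F)
          (Nat.card (IsLocalRing.ResidueField (ValRing F)) ^ (i : ℕ))
          (kernelPoints C f) (kernelPoints C ((x.fiber 𝓕).act ϖ))) ∧
    ∀ (i : LTIndex n) (j : LTIndex n), (i : ℕ) + j = n →
      x ∈ fundamentalDomainBoundary L (ϖ : F) n i →
      IsLargestValuationSubset (ϖ : F)
        (Nat.card (IsLocalRing.ResidueField (ValRing F)) ^ (i : ℕ))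
        (kernelPoints C f) (kernelPoints C ((x.fiber 𝓕).act ϖ)) →
      x' ∈ fundamentalDomainBoundary L (ϖ : F) n j := by
  open LubinTate in
  obtain ⟨h0, h1⟩ := norm_uniformizer p hϖ
  have hq := one_lt_card_residueField hn hΦ
  have h := isStandard_fiber hn h0 h1 hq hcoord x
  have h' := isStandard_fiber hn h0 h1 hq hcoord x'
  have ht : ‖(ϖ : F)‖ = ‖algebraMap (ValRing F) (ValRing L) ϖ‖ := (norm_algebraMap_base ϖ).symm
  have ha := (mem_fundamentalDomain_iff hn h0 h1 x).1 hx
  have hpow : ∀ W ≤ Submodule.torsionBy (ValRing F) (Point C (x.fiber 𝓕)) ϖ,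
      ∃ m, Nat.card W = Nat.card (IsLocalRing.ResidueField (ValRing F)) ^ m := fun W hW =>
    have := h.finite_torsion (C := C)
    have : Finite W := Finite.Set.subset
      (Submodule.torsionBy (ValRing F) (Point C (x.fiber 𝓕)) ϖ : Set (Point C (x.fiber 𝓕))) hW
    exists_card_eq_pow hϖ W hW
  have hpow' : ∀ W ≤ Submodule.torsionBy (ValRing F) (Point C (x'.fiber 𝓕)) ϖ,
      ∃ m, Nat.card W = Nat.card (IsLocalRing.ResidueField (ValRing F)) ^ m := fun W hW =>
    have := h'.finite_torsion (C := C)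
    have : Finite W := Finite.Set.subset
      (Submodule.torsionBy (ValRing F) (Point C (x'.fiber 𝓕)) ϖ : Set (Point C (x'.fiber 𝓕))) hW
    exists_card_eq_pow hϖ W hW
  have hfin := h.finite_ker (C := C) hf
  have hker : LinearMap.ker (Point.map (C := C) h.isIsogeny.1) =
      Submodule.torsionBy (ValRing F) (Point C (x.fiber 𝓕)) ϖ := rfl
  rw [kernelPoints_eq_image hf.1, kernelPoints_eq_image h.isIsogeny.1, hker]
  simp only [isLargestValuationSubset_image_iff h0 h1]
  have hback : ∀ i j : ℕ, i + j = n →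
      ‖x.toAlgHom (ltCoord n ϖ i)‖ = ‖(ϖ : F)‖ ^ (1 - i / n : ℝ) →
      (LinearMap.ker (Point.map (C := C) hf.1) ≤
        Submodule.torsionBy (ValRing F) (Point C (x.fiber 𝓕)) ϖ ∧
        Nat.card (LinearMap.ker (Point.map (C := C) hf.1)) =
          Nat.card (IsLocalRing.ResidueField (ValRing F)) ^ i ∧
        ∀ k ∈ LinearMap.ker (Point.map (C := C) hf.1),
          ∀ k' ∈ Submodule.torsionBy (ValRing F) (Point C (x.fiber 𝓕)) ϖ,
            k' ∉ LinearMap.ker (Point.map (C := C) hf.1) → ‖k.val‖ < ‖k'.val‖) →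
      x' ∈ fundamentalDomain L (ϖ : F) n ∧
        ‖x'.toAlgHom (ltCoord n ϖ j)‖ = ‖(ϖ : F)‖ ^ (1 - j / n : ℝ) := by
    rintro i j hij hi ⟨hle, hcard, hlarge⟩
    rw [mem_fundamentalDomain_iff hn h0 h1]
    exact h.norm_le_of_isogeny h' ht ha hpow hpow' hf hij hi hcard hle hlarge
  refine ⟨⟨fun hx' => ?_, ?_⟩, fun i j hij hi hlarge => ?_⟩
  -- if the kernel is trivial, then `f` is an isomorphism; if it contains the `ϖ`-torsion, then `f`
  -- factors through `ϖ`
  · have hbot : LinearMap.ker (Point.map (C := C) hf.1) ≠ ⊥ := fun hbot =>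
      hf_iso (isIso_of_ker_eq_bot (C := C) h.norm_pos h.norm_lt hf fun z hz => by
        rwa [← LinearMap.mem_ker, hbot, Submodule.mem_bot] at hz)
    have htor : ¬ Submodule.torsionBy (ValRing F) (Point C (x.fiber 𝓕)) ϖ ≤
        LinearMap.ker (Point.map (C := C) hf.1) := fun htor =>
      hf_mul (exists_factor (C := C) h.norm_pos h.norm_lt h.isIsogeny hf.1 fun z hz => htor hz)
    obtain ⟨i, hi0, hin, hcard, hle, hdeg⟩ := h.exists_of_isogeny h' ht ha
      ((mem_fundamentalDomain_iff hn h0 h1 x').1 hx') hpow hpow' hf hbot htor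
    obtain ⟨hai, hlarge⟩ := (h.deg_le_of_card_eq_pow ht ha hin.le hle hcard).2 hdeg
    exact ⟨⟨i, hi0, hin⟩, (mem_fundamentalDomainBoundary_iff h0 h1 x _).2 ⟨hx, hai⟩, hle, hcard,
      hlarge⟩
  · rintro ⟨i, hi, hlarge⟩
    exact (hback i (n - i) (Nat.add_sub_cancel' i.2.2.le)
      ((mem_fundamentalDomainBoundary_iff h0 h1 x i).1 hi).2 hlarge).1
  · exact (mem_fundamentalDomainBoundary_iff h0 h1 x' j).2
      (hback i j hij ((mem_fundamentalDomainBoundary_iff h0 h1 x i).1 hi).2 hlarge)
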